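/- **Definitions.** A polytope in $\mathbb R^{D}$ (of full dimension $D$) is *neighborly* if any $\lfloor D/2\rfloor$ of its vertices form a face. Two polytopes are *combinatorially equivalent* if their face lattices are isomorphic. A *vector Gale diagram* of points $a_1,\dots,a_N$ affinely spanning $\mathbb R^D$ is a family of vectors $g_1,\dots,g_N\in\mathbb R^{N-D-1}$ such that the rows of the matrix with columns $g_i$ form a basis of the space of affine dependencies $\{c\in\mathbb R^N:\sum c_i=0,\ \sum c_ia_i=0\}$. Let $N=D+4$, and let $y$ be a linear functional on $\mathbb R^3$ with $y(g_i)\ne0$ for all $i$. The points $g_i/y(g_i)$ of the plane $\{y=1\}\cong\mathbb R^2$, coloured black if $y(g_i)>0$ and white if $y(g_i)<0$, form an *(affine) Gale diagram* of the points $a_i$. A Gale diagram of a polytope is a Gale diagram of its set of vertices. A *$T$-diagram* is a planar diagram of $2d+4$ black and white points such that exactly $d+3$ points are black, the black points are in convex position, and the diagram is a Gale diagram of a neighborly polytope in $\mathbb R^{2d}$. A *$T$-polytope* is a neighborly polytope in $\mathbb R^{2d}$ that has a Gale diagram which is a $T$-diagram (a *$T$-Gale diagram* of the polytope). A *3-tree*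 is a finite tree all of whose vertices have degree 1 or 3, with a cyclic order on the three edges at each vertex of degree 3; these orders induce a cyclic order on the vertices of degree 1 (leaves $a,b,c$ are ordered as the three edges at which the disjoint paths to $a,b,c$ leave their branching vertex). A 3-tree is a *characteristic tree* of a $T$-diagram if there is a bijection between the points of the diagram and the vertices of the tree such that (1) white points correspond to vertices of degree 3 and black points to vertices of degree 1; (2) up to reversal, the cyclic order on the vertices of degree 1 agrees with the cyclic order of the black points along the boundary of their convex hull; (3) a white point $B$ lies inside the triangle with distinct black vertices $A_i,A_j,A_k$ if and only if there are three paths in the tree from the vertex of $B$ to the vertices of $A_i,A_j,A_k$ that are disjoint except for their common beginning. **Theorem.** 1. For every $T$-polytope $P$ there is a 3-tree $G$ that is a characteristic tree of every $T$-Gale diagram of $P$. It is unique up to isomorphism and simultaneous reversal of all the cyclic orders, and depends only on the combinatorial type of $P$: if $P'$ is a $T$-polytope combinatorially equivalent to $P$ (for instance $P'=P$), then every characteristic tree of every $T$-Gale diagram of $P'$ is isomorphic, as a 3-tree, to $G$ or to the 3-tree obtained from $G$ by reversing the cyclic orders at all vertices. 2. For every 3-tree $G$ with $n\ge 8$ vertices,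 $n$ is even and there is a $T$-polytope (of dimension $n-4$) such that $G$ is a characteristic tree of one of its $T$-Gale diagrams. Any two $T$-polytopes with this property are combinatorially equivalent. -/

import Mathlib

namespace Neighborly

/-- Euclidean `n`-space. -/
abbrev E (n : ℕ) : Type := EuclideanSpace ℝ (Fin n)

/-! ### Polytopes -/

/-- A `D`-dimensional convex polytope in `ℝ^D`. -/
def IsPolytope {D : ℕ} (P : Set (E D)) : Prop :=
  (∃ s : Finset (E D), P = convexHull ℝ (s : Set (E D))) ∧ affineSpan ℝ P = ⊤

/-- The faces of `P`, ordered by inclusion: the empty face, and all the sets of points of `P` where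
some linear functional attains its maximum over `P` (in particular `P` itself). -/
abbrev Face {D : ℕ} (P : Set (E D)) : Type := {F : Set (E D) // IsExposed ℝ P F}

/-- Combinatorial equivalence of polytopes: isomorphism of the face lattices. -/
def CombEquiv {D D' : ℕ} (P : Set (E D)) (Q : Set (E D')) : Prop :=
  Nonempty (Face P ≃o Face Q)

/-- Neighborly polytopes: any `⌊D/2⌋` vertices are the vertices of a face. -/
def IsNeighborlyPolytope {D : ℕ} (P : Set (E D)) : Prop :=
  IsPolytope P ∧ ∀ S : Set (E D), S ⊆ P.extremePoints ℝ → S.ncard = D / 2 →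
    IsExposed ℝ P (convexHull ℝ S)

/-! ### Gale diagrams -/

/-- `g` is a vector Gale diagram of the point configuration `a`: the rows of the matrix with
columns `g i` form a basis of the space of affine dependencies of `a`. -/
def IsVectorGaleDiagram {ι : Type*} [Fintype ι] {D n : ℕ} (a : ι → E D) (g : ι → E n) : Prop :=
  (∀ l : E n →ₗ[ℝ] ℝ, (∀ i, l (g i) = 0) → l = 0) ∧
  ∀ c : ι → ℝ, (∑ i, c i = 0 ∧ ∑ i, c i • a i = 0) ↔ ∃ l : E n →ₗ[ℝ] ℝ, ∀ i, c i = l (g i)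

/-- A planar diagram: a finite family of black and white points that affinely spans the plane. -/
structure PlanarDiagram (ι : Type*) where
  pt : ι → E 2
  black : Set ι
  spans : affineSpan ℝ (Set.range pt) = ⊤

namespace PlanarDiagram

variable {ι : Type*}

/-- `X` is an affine Gale diagram of `a`: the vectors `g i` of a vector Gale diagram of `a` in `ℝ³`
are projected from the origin to a plane `e = {x | y x = 1}`, which is identified with `ℝ²` by an
affine map `φ`; black points come from vectors on the side of `e`, white points from vectors on the
other side of the parallel plane through the origin. -/
def IsAffineGaleDiagram [Fintype ι] {D : ℕ} (X : PlanarDiagram ι) (a : ι → E D) : Prop :=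
  ∃ (g : ι → E 3) (y : E 3 →ₗ[ℝ] ℝ) (φ : E 2 →ᵃ[ℝ] E 3),
    IsVectorGaleDiagram a g ∧ Function.Injective φ ∧ (∀ q, y (φ q) = 1) ∧
    ∀ i, y (g i) ≠ 0 ∧ φ (X.pt i) = (y (g i))⁻¹ • g i ∧ (i ∈ X.black ↔ 0 < y (g i))

/-- `X` is an affine Gale diagram of the polytope `P`, that is, of its set of vertices. -/
def IsGaleDiagramOf [Fintype ι] {D : ℕ} (X : PlanarDiagram ι) (P : Set (E D)) : Prop :=
  ∃ a : ι → E D, Function.Injective a ∧ Set.range a = P.extremePoints ℝ ∧ X.IsAffineGaleDiagram a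

/-- A `T`-diagram with `2 d + 4` points: it has exactly `d + 3` black points, they are in convex
position, and it is a Gale diagram of a neighborly polytope in `ℝ^(2d)`. -/
def IsTDiagram {d : ℕ} (X : PlanarDiagram (Fin (2 * d + 4))) : Prop :=
  X.black.ncard = d + 3 ∧
  ConvexIndependent ℝ (fun i : X.black => X.pt i) ∧
  ∃ P : Set (E (2 * d)), IsNeighborlyPolytope P ∧ X.IsGaleDiagramOf P

/-- Twice the oriented area of the triangle with vertices `i`, `j`, `k`. For points in convex
position, it is positive if and only if `i`, `j`, `k` are distinct and follow each other in this
cyclic order on the counterclockwise boundary of the polygon, and negative for the clockwise one. -/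
def orient (X : PlanarDiagram ι) (i j k : ι) : ℝ :=
  (X.pt j 0 - X.pt i 0) * (X.pt k 1 - X.pt i 1) - (X.pt j 1 - X.pt i 1) * (X.pt k 0 - X.pt i 0)

end PlanarDiagram

/-- `T`-polytopes: neighborly polytopes in `ℝ^(2d)` with a Gale diagram that is a `T`-diagram. -/
def IsTPolytope {d : ℕ} (P : Set (E (2 * d))) : Prop :=
  IsNeighborlyPolytope P ∧
  ∃ X : PlanarDiagram (Fin (2 * d + 4)), X.IsTDiagram ∧ X.IsGaleDiagramOf P

/-! ### 3-trees -/

/-- A 3-tree: a finite tree with all degrees 1 or 3, and a cyclic order on the three edges at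
each vertex of degree 3. The cyclic order at `v` is given by the permutation `rot v` that takes each
edge (that is, neighbor of `v`) to the next one; at a vertex of degree 1 it is the identity. -/
structure ThreeTree (V : Type*) where
  finite : Finite V
  graph : SimpleGraph V
  isTree : graph.IsTree
  degree_eq : ∀ v, (graph.neighborSet v).ncard = 1 ∨ (graph.neighborSet v).ncard = 3
  rot : ∀ v, Equiv.Perm (graph.neighborSet v)
  rot_cycle : ∀ v, (rot v).IsCycleOn Set.univ

namespace ThreeTree

variable {V W : Type*}

/-- The 3-tree with all the cyclic orders reversed. -/
def reverse (G : ThreeTree V) : ThreeTree V where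
  finite := G.finite
  graph := G.graph
  isTree := G.isTree
  degree_eq := G.degree_eq
  rot := fun v => (G.rot v)⁻¹
  rot_cycle := fun v => (G.rot_cycle v).inv

/-- Isomorphism of 3-trees: a graph isomorphism that preserves the cyclic orders. -/
def Isomorphic (G : ThreeTree V) (H : ThreeTree W) : Prop :=
  ∃ f : G.graph ≃g H.graph, ∀ v (x : G.graph.neighborSet v),
    H.rot (f v) (f.mapNeighborSet v x) = f.mapNeighborSet v (G.rot v x)

/-- Three walks from `v` that are paths and have no common vertices except `v`. -/
def DisjointPaths (G : ThreeTree V) {v a b c : V}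
    (p : G.graph.Walk v a) (q : G.graph.Walk v b) (r : G.graph.Walk v c) : Prop :=
  p.IsPath ∧ q.IsPath ∧ r.IsPath ∧
  (∀ x, x ∈ p.support → x ∈ q.support → x = v) ∧
  (∀ x, x ∈ q.support → x ∈ r.support → x = v) ∧
  (∀ x, x ∈ r.support → x ∈ p.support → x = v)

/-- Three disjoint paths lead from `v` to `a`, `b`, `c`. -/
def HasDisjointPaths (G : ThreeTree V) (v a b c : V) : Prop :=
  ∃ (p : G.graph.Walk v a) (q : G.graph.Walk v b) (r : G.graph.Walk v c), G.DisjointPaths p q r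

/-- The cyclic order on the vertices of degree 1: `a`, `b`, `c` follow each other in this cyclic
order if the disjoint paths from their branching point `v` to `a`, `b`, `c` start with three edges
that follow each other in this cyclic order at `v`. -/
def LeafOrder (G : ThreeTree V) (a b c : V) : Prop :=
  ∃ (v : V) (p : G.graph.Walk v a) (q : G.graph.Walk v b) (r : G.graph.Walk v c)
    (x : G.graph.neighborSet v), G.DisjointPaths p q r ∧
    p.snd = x ∧ q.snd = G.rot v x ∧ r.snd = G.rot v (G.rot v x)

/-- `G` is a characteristic tree of the diagram `X`. -/
def IsCharacteristicTree {ι : Type*} (G : ThreeTree V) (X : PlanarDiagram ι) : Prop :=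
  ∃ f : ι ≃ V,
    -- white points correspond to vertices of degree 3, black points to vertices of degree 1
    (∀ i, i ∉ X.black → (G.graph.neighborSet (f i)).ncard = 3) ∧
    (∀ i, i ∈ X.black → (G.graph.neighborSet (f i)).ncard = 1) ∧
    -- the cyclic orders on leaves and on black points agree up to reversal
    ((∀ i ∈ X.black, ∀ j ∈ X.black, ∀ k ∈ X.black,
        G.LeafOrder (f i) (f j) (f k) ↔ 0 < X.orient i j k) ∨
     (∀ i ∈ X.black, ∀ j ∈ X.black, ∀ k ∈ X.black,
        G.LeafOrder (f i) (f j) (f k) ↔ X.orient i j k < 0)) ∧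
    -- white points inside triangles with black vertices are branching points
    (∀ b, b ∉ X.black → ∀ i ∈ X.black, ∀ j ∈ X.black, ∀ k ∈ X.black, i ≠ j → j ≠ k → k ≠ i →
      (X.pt b ∈ interior (convexHull ℝ {X.pt i, X.pt j, X.pt k}) ↔
        G.HasDisjointPaths (f b) (f i) (f j) (f k)))

/-- `G` is a characteristic tree of some `T`-diagram that is a Gale diagram of `P`. -/
def IsTreeOf {d : ℕ} (G : ThreeTree V) (P : Set (E (2 * d))) : Prop :=
  ∃ X : PlanarDiagram (Fin (2 * d + 4)),
    X.IsTDiagram ∧ X.IsGaleDiagramOf P ∧ G.IsCharacteristicTree X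

end ThreeTree

end Neighborly

/-!
Three-trees and `T`-diagrams are two views of the same combinatorial structure, a tripod system
(`TripodSystem`): a set of leaves (black points) with a cyclic order, and branching points (white
points), each of which sorts the leaves into three classes, such that every three leaves are told
apart by exactly one branching point.

* In a 3-tree, a branching vertex sorts the leaves by the direction in which they are seen. A 3-tree
  is determined by its tripod system (`ThreeTree.isomorphic_of_bijection`), and every tripod system
  comes from a 3-tree (`TripodSystem.exists_threeTree`). The construction proceeds by induction,
  since every tripod system has a cherry, that is, two consecutive leaves at the same branching point
  (`TripodSystem.exists_isCherry`).
* By Gale duality, the faces of a polytope correspond to its cofaces, the supports of dependencies of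
  the diagram with signs given by the colours
  (`PlanarDiagram.IsGaleDiagramOf.exists_orderIso`). In these terms, neighborliness says that every
  half-plane contains many points, counted with colours. Counting shows that every triangle of black
  points of a `T`-diagram contains exactly one white point (`isTripodDiagram_of_isCoface`). Therefore
  a white point sorts the black ones by the triangles that contain it: the only obstruction would be
  a pentagram (`no_pentagram`), and one obtains a tripod system
  (`IsTripodDiagram.exists_tripodSystem`).
* Conversely, every tripod system is realized by points in the plane, because a black point can be
  split into two black points and a white point
  (`TripodSystem.exists_isTripodDiagram`). In such a diagram, every set with more points than there
  are black ones is a coface (`IsTripodDiagram.isCoface_of_ncard_lt`); hence it is a Gale diagram of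
  a neighborly polytope (`PlanarDiagram.exists_isGaleDiagramOf`).
* The minimal cofaces have four points and are of two kinds: a black triangle with its white point,
  or two black points with two white points on different sides of the line through them. The tripod
  system determines them, and so the face lattice (`IsTripodDiagram.isCoface_image`). With at least
  five black points, the cofaces determine first the colours
  (`IsTripodDiagram.subset_of_isCoface_iff`) and then the tripod system up to reversal. The remaining
  polytopes are hexagons: the cofaces do not determine the colours, but up to equivalence there is
  only one tripod system with four leaves
  (`TripodSystem.exists_tripodEquiv_of_ncard_four`).
-/

universe u

namespace Neighborly

/-! ### Directions in a tree -/

section TreeStep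

variable {V : Type*} {T : SimpleGraph V}

/-- The direction of `u` seen from `v` in a tree: the second vertex of the path from `v` to `u`.
By convention it is `v` itself if `u = v`. -/
noncomputable def treeStep (hT : T.IsTree) (v u : V) : V :=
  (hT.existsUnique_path v u).choose.snd

theorem treeStep_eq_snd (hT : T.IsTree) {v u : V} {p : T.Walk v u} (hp : p.IsPath) :
    treeStep hT v u = p.snd := by
  unfold treeStep
  rw [(hT.existsUnique_path v u).unique (hT.existsUnique_path v u).choose_spec.1 hp]

@[simp] theorem treeStep_self (hT : T.IsTree) (v : V) : treeStep hT v v = v := by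
  rw [treeStep_eq_snd hT (p := SimpleGraph.Walk.nil) (by simp)]
  simp [SimpleGraph.Walk.snd]

theorem adj_treeStep (hT : T.IsTree) {v u : V} (h : u ≠ v) : T.Adj v (treeStep hT v u) := by
  obtain ⟨p, hp, -⟩ := hT.existsUnique_path v u
  rw [treeStep_eq_snd hT hp]
  exact p.adj_snd (SimpleGraph.Walk.not_nil_of_ne h.symm)

theorem treeStep_of_adj (hT : T.IsTree) {v x : V} (h : T.Adj v x) : treeStep hT v x = x := by
  rw [treeStep_eq_snd hT (p := h.toWalk) (by simp [h.ne])]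
  simp [SimpleGraph.Walk.snd]

/-- An edge splits the vertices of a tree into two sides. -/
theorem treeStep_eq_iff (hT : T.IsTree) {v x : V} (h : T.Adj v x) (u : V) :
    treeStep hT v u = x ↔ treeStep hT x u ≠ v := by
  constructor
  · intro h1 h2
    obtain ⟨p, hp, -⟩ := hT.existsUnique_path v u
    rw [treeStep_eq_snd hT hp] at h1
    cases p with
    | nil => simp [SimpleGraph.Walk.snd] at h1; exact h.ne h1
    | cons hh q =>
      rw [SimpleGraph.Walk.snd_cons] at h1
      subst h1
      rw [SimpleGraph.Walk.cons_isPath_iff] at hp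
      rw [treeStep_eq_snd hT hp.1] at h2
      apply hp.2
      rw [← h2]
      exact q.getVert_mem_support 1
  · intro h1
    obtain ⟨q, hq, -⟩ := hT.existsUnique_path x u
    rw [treeStep_eq_snd hT hq] at h1
    have hv : v ∉ q.support := by
      intro hv
      apply h1
      have := hT.isAcyclic.eq_snd_of_adj_start hq h.symm hv
      exact this.symm
    rw [treeStep_eq_snd hT (p := SimpleGraph.Walk.cons h q)
      ((SimpleGraph.Walk.cons_isPath_iff _ _).2 ⟨hq, hv⟩), SimpleGraph.Walk.snd_cons]

theorem treeStep_of_mem_support (hT : T.IsTree) {v u z : V} {p : T.Walk v u} (hp : p.IsPath)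
    (hz : z ∈ p.support) (hzv : z ≠ v) : treeStep hT v z = treeStep hT v u := by
  classical
  rw [treeStep_eq_snd hT hp, treeStep_eq_snd hT (hp.takeUntil hz),
    SimpleGraph.Walk.snd_takeUntil hzv]

theorem isPath_append_of_treeStep_ne (hT : T.IsTree) {v a b : V} {p : T.Walk v a}
    {q : T.Walk v b} (hp : p.IsPath) (hq : q.IsPath)
    (h : treeStep hT v a ≠ treeStep hT v b) : (p.reverse.append q).IsPath := by
  rw [SimpleGraph.Walk.isPath_def, SimpleGraph.Walk.support_append, List.nodup_append]
  refine ⟨?_, ?_, ?_⟩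
  · exact (hp.reverse).support_nodup
  · exact hq.support_nodup.sublist (List.tail_sublist _)
  · rintro x hx y hy rfl
    have hxv : x ≠ v := by
      rintro rfl
      have := hq.support_nodup
      rw [← SimpleGraph.Walk.cons_tail_support] at this
      exact (List.nodup_cons.1 this).1 hy
    rw [SimpleGraph.Walk.support_reverse, List.mem_reverse] at hx
    exact h ((treeStep_of_mem_support hT hp hx hxv).symm.trans
      (treeStep_of_mem_support hT hq (List.mem_of_mem_tail hy) hxv))

/-- If `a` and `b` lie in different directions from `v`, the path from `a` to `b` visits `v`. -/
theorem treeStep_eq_of_ne (hT : T.IsTree) {v a b : V} (h : treeStep hT v a ≠ treeStep hT v b)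
    (ha : a ≠ v) : treeStep hT a b = treeStep hT a v := by
  obtain ⟨p, hp, -⟩ := hT.existsUnique_path v a
  obtain ⟨q, hq, -⟩ := hT.existsUnique_path v b
  rw [treeStep_eq_snd hT (isPath_append_of_treeStep_ne hT hp hq h),
    treeStep_eq_snd hT hp.reverse]
  have hn : ¬ p.reverse.Nil := SimpleGraph.Walk.not_nil_of_ne ha
  cases hr : p.reverse with
  | nil => rw [hr] at hn; simp at hn
  | cons h1 r => simp [SimpleGraph.Walk.snd]

/-- The vertices seen from `v` in the direction of `x`. -/
def branch (hT : T.IsTree) (v x : V) : Set V := {u | treeStep hT v u = x}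

theorem branch_ssubset (hT : T.IsTree) {v x z : V} (h : T.Adj v x) (h' : T.Adj x z)
    (hz : z ≠ v) : branch hT x z ⊂ branch hT v x := by
  refine Set.ssubset_iff_subset_ne.2 ⟨fun u hu => ?_, fun he => ?_⟩
  · exact (treeStep_eq_iff hT h u).2 fun h2 => hz (hu.symm.trans h2)
  · have : x ∈ branch hT x z := by rw [he]; exact treeStep_of_adj hT h
    exact h'.ne ((treeStep_self hT x).symm.trans this)

/-- In a finite tree, a function that picks at `v` an edge for every target `u ≠ v` and never
turns back on an edge picks the edges of the paths: otherwise it would walk away for ever. -/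
theorem eq_treeStep [Finite V] (hT : T.IsTree) (f : V → V → V)
    (hadj : ∀ v u, u ≠ v → T.Adj v (f v u))
    (hback : ∀ v x u, T.Adj v x → f v u = x → f x u ≠ v) {v u : V} (h : u ≠ v) :
    f v u = treeStep hT v u := by
  by_contra hne
  have key : ∀ n v, (branch hT v (f v u)).ncard ≤ n → u ≠ v → f v u ≠ treeStep hT v u → False := by
    intro n
    induction n with
    | zero =>
      intro v hn hu _
      have h0 := (Set.ncard_eq_zero (Set.toFinite _)).1 (Nat.le_zero.1 hn)
      have : f v u ∈ branch hT v (f v u) := treeStep_of_adj hT (hadj v u hu)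
      rw [h0] at this
      exact this
    | succ n ih =>
      intro v hn hu hne
      set x := f v u with hx
      have hvx : T.Adj v x := hadj v u hu
      have hxu : treeStep hT x u = v := by
        by_contra h2
        exact hne ((treeStep_eq_iff hT hvx u).2 h2).symm
      have hux : u ≠ x := by
        rintro h2
        rw [h2, treeStep_self] at hxu
        exact hvx.ne hxu.symm
      have h3 : f x u ≠ v := hback v x u hvx hx.symm
      refine ih x ?_ hux (by rw [hxu]; exact h3)
      have := Set.ncard_lt_ncard (branch_ssubset hT hvx (hadj x u hux) h3) (Set.toFinite _)
      omega
  exact key _ v le_rfl h hne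

/-- A graph with a consistent choice of directions is a tree: following the directions to `u` leads
to `u`, as fewer and fewer vertices remain ahead, and no walk can bypass an edge. -/
theorem isTree_of_directions [Finite V] [Nonempty V] (f : V → V → V)
    (hadj : ∀ v u, u ≠ v → T.Adj v (f v u))
    (hedge : ∀ v x u, T.Adj v x → (f v u = x ↔ f x u ≠ v))
    (hself : ∀ v, f v v = v)
    (hconst : ∀ v z z', T.Adj z z' → z ≠ v → z' ≠ v → f v z = f v z') : T.IsTree := by
  have hnb : ∀ v x, T.Adj v x → f v x = x := fun v x h =>
    (hedge v x x h).2 (by rw [hself]; exact h.ne')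
  refine ⟨?_, ?_⟩
  · rw [SimpleGraph.connected_iff]
    refine ⟨fun v u => ?_, inferInstance⟩
    have key : ∀ n v, {y | f v y = f v u}.ncard ≤ n → T.Reachable v u := by
      intro n
      induction n with
      | zero =>
        intro v hn
        have h0 := (Set.ncard_eq_zero (Set.toFinite _)).1 (Nat.le_zero.1 hn)
        have : u ∈ {y | f v y = f v u} := rfl
        rw [h0] at this
        exact this.elim
      | succ n ih =>
        intro v hn
        by_cases hu : u = v
        · rw [hu]
        · have hv := hadj v u hu
          refine hv.reachable.trans ?_
          set x := f v u with hx
          by_cases hux : u = x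
          · rw [← hux]
          refine ih x ?_
          have hss : {y | f x y = f x u} ⊂ {y | f v y = x} := by
            refine Set.ssubset_iff_subset_ne.2 ⟨fun y hy => ?_, fun he => ?_⟩
            · refine (hedge v x y hv).2 ?_
              rw [show f x y = f x u from hy]
              exact (hedge v x u hv).1 rfl
            · have : x ∈ {y | f x y = f x u} := by rw [he]; exact hnb v x hv
              have h2 : f x x = f x u := this
              rw [hself] at h2
              exact (hadj x u hux).ne h2
          have := Set.ncard_lt_ncard hss (Set.toFinite _)
          omega
    exact key _ v le_rfl
  · rw [SimpleGraph.isAcyclic_iff_forall_adj_isBridge]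
    intro v x h
    rw [SimpleGraph.isBridge_iff]
    rintro ⟨p⟩
    -- a walk that avoids the edge `vx` does not change its side
    have inv : ∀ {a b : V} (p : (T \ SimpleGraph.fromEdgeSet {s(v, x)}).Walk a b),
        f v a ≠ x → f v b ≠ x := by
      intro a b p
      induction p with
      | nil => exact id
      | @cons a b c hab q ih =>
        intro ha
        apply ih
        rw [SimpleGraph.sdiff_adj, SimpleGraph.fromEdgeSet_adj] at hab
        intro hb
        by_cases hav : a = v
        · subst hav
          have := hnb _ _ hab.1
          rw [hb] at this
          exact hab.2 ⟨by simp [this], hab.1.ne⟩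
        · by_cases hbv : b = v
          · subst hbv
            rw [hself] at hb
            exact h.ne hb
          · exact ha ((hconst v a b hab.1 hav hbv).trans hb)
    exact inv p (by rw [hself]; exact h.ne) (hnb v x h)

end TreeStep

/-! ### Tripod systems -/

/-- `c` takes three different values at `i`, `j`, `k`. -/
def Splits {ι κ : Type*} (c : ι → κ) (i j k : ι) : Prop := c i ≠ c j ∧ c j ≠ c k ∧ c k ≠ c i

namespace Splits

variable {ι κ : Type*} {c : ι → κ} {i j k l : ι}

theorem rot (h : Splits c i j k) : Splits c j k i := ⟨h.2.1, h.2.2, h.1⟩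

theorem swap (h : Splits c i j k) : Splits c j i k := ⟨h.1.symm, h.2.2.symm, h.2.1.symm⟩

theorem congr (h : Splits c i j k) (hl : c l = c k) : Splits c i j l := by
  unfold Splits at *
  rw [hl]
  exact h

end Splits

/-- The common combinatorial structure of 3-trees and of `T`-diagrams. The elements of `B` are the
leaves (black points), cyclically ordered by `o`; every other element `w` (a branching vertex, or a
white point) sorts `B` into three classes, the fibres of `br w`, and every three leaves are told
apart by exactly one `w`. -/
structure TripodSystem {ι κ : Type*} (B : Set ι) (o : ι → ι → ι → Prop) (br : ι → ι → κ) :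
    Prop where
  cyc : ∀ {i j k}, i ∈ B → j ∈ B → k ∈ B → o i j k → o j k i
  asymm : ∀ {i j k}, i ∈ B → j ∈ B → k ∈ B → o i j k → ¬ o k j i
  total : ∀ {i j k}, i ∈ B → j ∈ B → k ∈ B → i ≠ j → j ≠ k → k ≠ i → o i j k ∨ o k j i
  three : ∀ {w i j k l}, w ∉ B → i ∈ B → j ∈ B → k ∈ B → l ∈ B → Splits (br w) i j k →
    br w l = br w i ∨ br w l = br w j ∨ br w l = br w k
  ex : ∀ {i j k}, i ∈ B → j ∈ B → k ∈ B → i ≠ j → j ≠ k → k ≠ i → ∃ w, w ∉ B ∧ Splits (br w) i j k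
  un : ∀ {w w' i j k}, w ∉ B → w' ∉ B → i ∈ B → j ∈ B → k ∈ B → Splits (br w) i j k →
    Splits (br w') i j k → w = w'
  planar : ∀ {w i j k l}, w ∉ B → i ∈ B → j ∈ B → k ∈ B → l ∈ B → Splits (br w) i j k →
    br w l = br w k → o i j k → o i j l
  surj : ∀ {w}, w ∉ B → ∃ i ∈ B, ∃ j ∈ B, ∃ k ∈ B, Splits (br w) i j k

/-- Two leaves `a₁`, `a₂`, consecutive in the cyclic order, that are two of the three classes of
`w`. -/
structure IsCherry {ι κ : Type*} (B : Set ι) (o : ι → ι → ι → Prop) (br : ι → ι → κ)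
    (a₁ a₂ w : ι) : Prop where
  mem₁ : a₁ ∈ B
  mem₂ : a₂ ∈ B
  ne : a₁ ≠ a₂
  notMem : w ∉ B
  splits : ∀ k ∈ B, k ≠ a₁ → k ≠ a₂ → Splits (br w) a₁ a₂ k
  order : ∀ k ∈ B, k ≠ a₁ → k ≠ a₂ → o a₁ a₂ k

namespace TripodSystem

variable {ι κ : Type*} {B : Set ι} {o : ι → ι → ι → Prop} {br : ι → ι → κ}
variable {i j k l a₁ a₂ w b : ι}

theorem ne_of_order (h : TripodSystem B o br) (hi : i ∈ B) (hj : j ∈ B) (hk : k ∈ B)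
    (ho : o i j k) : i ≠ j ∧ j ≠ k ∧ k ≠ i := by
  have key : ∀ {i k}, i ∈ B → k ∈ B → ¬ o i i k := fun {i k} hi hk h1 =>
    h.asymm hi hi hk h1 (h.cyc hi hk hi (h.cyc hi hi hk h1))
  refine ⟨?_, ?_, ?_⟩
  · rintro rfl; exact key hi hk ho
  · rintro rfl; exact key hj hi (h.cyc hi hj hj ho)
  · rintro rfl; exact key hk hj (h.cyc hj hk hk (h.cyc hk hj hk ho))

/-- The relation `o` is a cyclic order; its transitivity comes from the position of `l` relative to
the branching point of `i`, `j`, `k`. -/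
theorem order_trans (h : TripodSystem B o br) (hi : i ∈ B) (hj : j ∈ B) (hk : k ∈ B) (hl : l ∈ B)
    (h1 : o i j k) (h2 : o i k l) : o i j l := by
  obtain ⟨n1, n2, n3⟩ := h.ne_of_order hi hj hk h1
  obtain ⟨m1, m2, m3⟩ := h.ne_of_order hi hk hl h2
  have hjl : j ≠ l := by
    rintro rfl
    exact h.asymm hi hj hk h1 (h.cyc hi hk hj h2)
  obtain ⟨u, hu, su⟩ := h.ex hi hj hk n1 n2 n3
  obtain ⟨v, hv, sv⟩ := h.ex hi hk hl m1 m2 m3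
  rcases h.three hu hi hj hk hl su with e | e | e
  · have s2 : Splits (br u) l j k := (su.rot.congr e).rot.rot
    rcases h.three hv hi hk hl hj sv with e' | e' | e'
    · have s3 : Splits (br v) j k l := (sv.rot.congr e').rot.rot
      obtain rfl := h.un hu hv hj hk hl s2.rot s3
      exact absurd e.symm sv.2.2.symm
    · exact h.cyc hl hi hj
        (h.planar hv hl hi hk hj sv.rot.rot e' (h.cyc hk hl hi (h.cyc hi hk hl h2)))
    · have s3 : Splits (br v) i k j := sv.congr e'
      obtain rfl := h.un hu hv hi hk hj (su.swap.rot.rot.swap.rot.rot.swap.rot) s3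
      exact absurd e.symm sv.2.2.symm
  · have s2 : Splits (br u) i k l :=
      ⟨su.2.2.symm, by rw [e]; exact su.2.1.symm, by rw [e]; exact su.1.symm⟩
    have := h.planar hu hi hk hl hj s2 e.symm h2
    exact absurd (h.cyc hi hk hj this) (h.asymm hi hj hk h1)
  · exact h.planar hu hi hj hk hl su e h1

/-- One leaf of a cherry may be replaced by the other one without changing the order. -/
theorem order_cherry (h : TripodSystem B o br) (hc : IsCherry B o br a₁ a₂ w) (hj : j ∈ B)
    (hk : k ∈ B) (hj1 : j ≠ a₁) (hj2 : j ≠ a₂) (hk1 : k ≠ a₁) (hk2 : k ≠ a₂) :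
    o a₂ j k ↔ o a₁ j k := by
  have key : ∀ {j k}, j ∈ B → k ∈ B → j ≠ a₁ → j ≠ a₂ → k ≠ a₁ → k ≠ a₂ →
      o a₁ j k → o a₂ j k := by
    intro j k hj hk hj1 hj2 hk1 hk2 ho
    have h1 := h.cyc hc.mem₂ hj hc.mem₁ (h.cyc hc.mem₁ hc.mem₂ hj (hc.order j hj hj1 hj2))
    have h2 := h.cyc hc.mem₁ hj hk ho
    exact h.cyc hk hc.mem₂ hj (h.cyc hj hk hc.mem₂ (h.order_trans hj hk hc.mem₁ hc.mem₂ h2 h1))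
  refine ⟨fun ho => ?_, key hj hk hj1 hj2 hk1 hk2⟩
  obtain ⟨-, n2, -⟩ := h.ne_of_order hc.mem₂ hj hk ho
  rcases h.total hc.mem₁ hj hk hj1.symm n2 hk1 with h1 | h1
  · exact h1
  · have h2 := key hk hj hk1 hk2 hj1 hj2 (h.cyc hj hc.mem₁ hk (h.cyc hk hj hc.mem₁ h1))
    exact absurd (h.cyc hc.mem₂ hk hj h2) (h.asymm hc.mem₂ hj hk ho)

/-- Only its own branching point tells the leaves of a cherry apart. -/
theorem br_cherry (h : TripodSystem B o br) (hc : IsCherry B o br a₁ a₂ w)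
    (hb : b ∉ B) (hbw : b ≠ w) : br b a₁ = br b a₂ := by
  by_contra hne
  obtain ⟨i, hi, j, hj, k, hk, s⟩ := h.surj hb
  have : ∃ l ∈ B, Splits (br b) a₁ a₂ l := by
    have e1 := h.three hb hi hj hk hc.mem₁ s
    have e2 := h.three hb hi hj hk hc.mem₂ s
    by_contra hno
    push Not at hno
    have h1 := hno i hi
    have h2 := hno j hj
    have h3 := hno k hk
    unfold Splits at *
    grind
  obtain ⟨l, hl, sl⟩ := this
  refine hbw (h.un hb hc.notMem hc.mem₁ hc.mem₂ hl sl (hc.splits l hl ?_ ?_))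
  · rintro rfl; exact sl.2.2 rfl
  · rintro rfl; exact sl.2.1 rfl

theorem splits_cherry (h : TripodSystem B o br) (hc : IsCherry B o br a₁ a₂ w) (hi : i ∈ B)
    (hj : j ∈ B) (hi1 : i ≠ a₁) (hi2 : i ≠ a₂) (hj1 : j ≠ a₁) (hj2 : j ≠ a₂) :
    br w i = br w j := by
  have s := hc.splits i hi hi1 hi2
  have s' := hc.splits j hj hj1 hj2
  rcases h.three hc.notMem hc.mem₁ hc.mem₂ hj hi s' with e | e | e
  · exact absurd e s.2.2
  · exact absurd e s.2.1.symm
  · exact e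

/-- A class that lies strictly inside another one is smaller; a smallest union of two classes that
avoids a fixed leaf consists of two leaves. -/
theorem exists_isCherry (h : TripodSystem B o br) (hf : B.Finite) (hB : 3 ≤ B.ncard) :
    ∃ a₁ a₂ w, IsCherry B o br a₁ a₂ w := by
  classical
  obtain ⟨z, s₀, t₀, hz, hs₀, ht₀, n1, n2, n3⟩ : ∃ z s t, z ∈ B ∧ s ∈ B ∧ t ∈ B ∧ s ≠ t ∧ t ≠ z ∧
      z ≠ s := by
    obtain ⟨x, hx⟩ := (Set.two_lt_ncard hf).1 hB
    obtain ⟨hx, y, hy, z, hz, h1, h2, h3⟩ := hx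
    exact ⟨z, x, y, hz, hx, hy, h1, h3, h2.symm⟩
  obtain ⟨w₀, hw₀, sw₀⟩ := h.ex hs₀ ht₀ hz n1 n2 n3
  let N : ι → Set ι := fun w => {x ∈ B | br w x ≠ br w z}
  have hN : ∀ w, (N w).Finite := fun w => hf.subset fun x hx => hx.1
  have hex : ∃ n w s t, w ∉ B ∧ s ∈ B ∧ t ∈ B ∧ Splits (br w) s t z ∧ (N w).ncard = n :=
    ⟨_, w₀, s₀, t₀, hw₀, hs₀, ht₀, sw₀, rfl⟩
  -- `w` is chosen such that its two classes that avoid `z` are as small as possible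
  obtain ⟨w, s, t, hw, hs, ht, sw, hn⟩ := Nat.find_spec hex
  have hmin : ∀ w' s t, w' ∉ B → s ∈ B → t ∈ B → Splits (br w') s t z →
      (N w).ncard ≤ (N w').ncard := fun w' s t h1 h2 h3 h4 => by
    rw [hn]
    exact Nat.find_min' hex ⟨w', s, t, h1, h2, h3, h4, rfl⟩
  -- if a class contained a second leaf `x`, the branching point of `s`, `x`, `z` would be smaller
  have key : ∀ s t, s ∈ B → t ∈ B → Splits (br w) s t z → ∀ x ∈ B, br w x = br w s → x = s := by
    intro s t hs ht sw x hx hxs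
    by_contra hne
    have hxz : x ≠ z := by rintro rfl; exact sw.2.2 hxs
    have hsz : z ≠ s := by rintro rfl; exact sw.2.2 rfl
    obtain ⟨w', hw', sw'⟩ := h.ex hs hx hz (Ne.symm hne) hxz hsz
    have hww : w ≠ w' := by rintro rfl; exact sw'.1 hxs.symm
    have ht' : br w' t = br w' z := by
      by_contra hcon
      rcases h.three hw' hs hx hz ht sw' with e | e | e
      · refine hww (h.un hw hw' ht hx hz ?_ ?_)
        · unfold Splits at *; grind
        · unfold Splits at *; grind
      · refine hww (h.un hw hw' hs ht hz sw ?_)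
        unfold Splits at *; grind
      · exact hcon e
    have hlt : (N w').ncard < (N w).ncard := by
      refine Set.ncard_lt_ncard (Set.ssubset_iff_subset_ne.2 ⟨fun y hy => ⟨hy.1, fun hyz => ?_⟩,
        fun he => ?_⟩) (hN w)
      · rcases h.three hw' hs hx hz hy.1 sw' with e | e | e
        · refine hww (h.un hw hw' hy.1 hx ht ?_ ?_) <;> unfold Splits at * <;> grind
        · refine hww (h.un hw hw' hs hy.1 ht ?_ ?_) <;> unfold Splits at * <;> grind
        · exact hy.2 e
      · have : t ∈ N w' := by rw [he]; exact ⟨ht, sw.2.1⟩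
        exact this.2 ht'
    exact absurd (hmin w' s x hw' hs hx sw') (not_le.2 hlt)
  have hcl : ∀ k ∈ B, k ≠ s → k ≠ t → br w k = br w z := by
    intro k hk hks hkt
    rcases h.three hw hs ht hz hk sw with e | e | e
    · exact absurd (key s t hs ht sw k hk e) hks
    · exact absurd (key t s ht hs sw.swap k hk e) hkt
    · exact e
  have hst : s ≠ t := by rintro rfl; exact sw.1 rfl
  have htz : t ≠ z := by rintro rfl; exact sw.2.1 rfl
  have hzs : z ≠ s := by rintro rfl; exact sw.2.2 rfl
  rcases h.total hs ht hz hst htz hzs with ho | ho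
  · exact ⟨s, t, w, hs, ht, hst, hw, fun k hk h1 h2 => sw.congr (hcl k hk h1 h2),
      fun k hk h1 h2 => h.planar hw hs ht hz hk sw (hcl k hk h1 h2) ho⟩
  · exact ⟨t, s, w, ht, hs, hst.symm, hw, fun k hk h1 h2 => sw.swap.congr (hcl k hk h2 h1),
      fun k hk h1 h2 => h.planar hw ht hs hz hk sw.swap (hcl k hk h2 h1)
        (h.cyc hz ht hs ho)⟩

/-- Removing a leaf of a cherry together with its branching point. -/
theorem restrict (h : TripodSystem B o br) (hc : IsCherry B o br a₁ a₂ w) :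
    TripodSystem (ι := {i // i ≠ a₂ ∧ i ≠ w}) {i | i.1 ∈ B} (fun i j k => o i.1 j.1 k.1)
      (fun v i => br v.1 i.1) where
  cyc := h.cyc
  asymm := h.asymm
  total hi hj hk h1 h2 h3 := h.total hi hj hk (by simpa [Subtype.ext_iff] using h1)
    (by simpa [Subtype.ext_iff] using h2) (by simpa [Subtype.ext_iff] using h3)
  three := h.three
  ex {i j k} hi hj hk h1 h2 h3 := by
    obtain ⟨v, hv, s⟩ := h.ex hi hj hk (by simpa [Subtype.ext_iff] using h1)
      (by simpa [Subtype.ext_iff] using h2) (by simpa [Subtype.ext_iff] using h3)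
    refine ⟨⟨v, ?_, ?_⟩, hv, s⟩
    · rintro rfl; exact hv hc.mem₂
    · rintro rfl
      have key : ∀ x y : {i // i ≠ a₂ ∧ i ≠ v}, x.1 ∈ B → y.1 ∈ B → x ≠ y →
          br v x.1 ≠ br v y.1 → x.1 = a₁ ∨ y.1 = a₁ := by
        intro x y hx hy _ hne
        by_contra hcon
        push Not at hcon
        exact hne (h.splits_cherry hc hx hy hcon.1 x.2.1 hcon.2 y.2.1)
      have e1 := key i j hi hj h1 s.1
      have e2 := key j k hj hk h2 s.2.1
      have e3 := key k i hk hi h3 s.2.2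
      rw [Ne, Subtype.ext_iff] at h1 h2 h3
      grind
  un hw hw' hi hj hk s s' := Subtype.ext (h.un hw hw' hi hj hk s s')
  planar := h.planar
  surj {v} hv := by
    obtain ⟨i, hi, j, hj, k, hk, s⟩ := h.surj hv
    have hva := h.br_cherry hc hv v.2.2
    have hw : ∀ {x}, x ∈ B → x ≠ w := by rintro x hx rfl; exact hc.notMem hx
    have key : ∀ x ∈ B, ∃ x' : {i // i ≠ a₂ ∧ i ≠ w}, x'.1 ∈ B ∧ br v.1 x'.1 = br v.1 x := by
      intro x hx
      by_cases hxa : x = a₂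
      · exact ⟨⟨a₁, hc.ne, hw hc.mem₁⟩, hc.mem₁, by rw [hxa]; exact hva⟩
      · exact ⟨⟨x, hxa, hw hx⟩, hx, rfl⟩
    obtain ⟨i', hi', ei⟩ := key i hi
    obtain ⟨j', hj', ej⟩ := key j hj
    obtain ⟨k', hk', ek⟩ := key k hk
    refine ⟨i', hi', j', hj', k', hk', ?_⟩
    simpa only [Splits, ei, ej, ek] using s

theorem ncard_restrict (hf : B.Finite) (ha : a₂ ∈ B) (hw : w ∉ B) :
    {i : {i // i ≠ a₂ ∧ i ≠ w} | i.1 ∈ B}.ncard + 1 = B.ncard := by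
  have : Subtype.val '' {i : {i // i ≠ a₂ ∧ i ≠ w} | i.1 ∈ B} = B \ {a₂} := by
    ext x
    simp only [Set.mem_image, Set.mem_ofPred_eq, Subtype.exists, Set.mem_sdiff,
      Set.mem_singleton_iff]
    constructor
    · rintro ⟨y, hy, hyB, rfl⟩; exact ⟨hyB, hy.1⟩
    · rintro ⟨hx, hxa⟩
      exact ⟨x, ⟨hxa, by rintro rfl; exact hw hx⟩, hx, rfl⟩
  rw [← Set.ncard_image_of_injective _ Subtype.val_injective, this,
    Set.ncard_sdiff_singleton_add_one ha hf]

/-- Induction on tripod systems by removing cherries. -/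
theorem cherry_induction {κ : Type*}
    {P : ∀ (ι : Type u) (_ : Set ι) (_ : ι → ι → ι → Prop) (_ : ι → ι → κ), Prop}
    (base : ∀ ι B o br, Finite ι → TripodSystem B o br → B.ncard = 2 → P ι B o br)
    (step : ∀ ι B o br a₁ a₂ w, Finite ι → TripodSystem B o br → 3 ≤ B.ncard →
      IsCherry B o br a₁ a₂ w → P {i : ι // i ≠ a₂ ∧ i ≠ w} {i | i.1 ∈ B}
        (fun i j k => o i.1 j.1 k.1) (fun v i => br v.1 i.1) → P ι B o br)
    {ι : Type u} [hι : Finite ι] {B : Set ι} {o : ι → ι → ι → Prop} {br : ι → ι → κ}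
    (h : TripodSystem B o br) (hB : 2 ≤ B.ncard) : P ι B o br := by
  obtain ⟨n, hn⟩ := Nat.exists_eq_add_of_le hB
  induction n generalizing ι with
  | zero => exact base ι B o br hι h (by omega)
  | succ n ih =>
    obtain ⟨a₁, a₂, w, hc⟩ := h.exists_isCherry (Set.toFinite _) (by omega)
    have := ncard_restrict (Set.toFinite _) hc.mem₂ hc.notMem
    exact step ι B o br a₁ a₂ w hι h (by omega) hc
      (ih (h.restrict hc) (by omega) (by omega))

theorem eq_empty_of_ncard_two (h : TripodSystem B o br) (hf : B.Finite) (hB : B.ncard = 2) :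
    w ∈ B := by
  by_contra hw
  obtain ⟨i, hi, j, hj, k, hk, s⟩ := h.surj hw
  have : 2 < B.ncard := (Set.two_lt_ncard hf).2 ⟨i, hi, j, hj, k, hk, fun e => s.1 (by rw [e]),
    fun e => s.2.2 (by rw [e]), fun e => s.2.1 (by rw [e])⟩
  omega

/-- There are two more leaves than branching points. -/
theorem ncard_compl [Finite ι] (h : TripodSystem B o br) (hB : 2 ≤ B.ncard) :
    Bᶜ.ncard + 2 = B.ncard := by
  refine cherry_induction (P := fun ι B _ _ => Bᶜ.ncard + 2 = B.ncard) ?_ ?_ h hB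
  · intro ι B o br _ h hB
    have : Bᶜ = ∅ := by
      ext x
      simpa using h.eq_empty_of_ncard_two (Set.toFinite _) hB
    rw [this, hB, Set.ncard_empty]
  · intro ι B o br a₁ a₂ w _ h hB hc ih
    have h1 := ncard_restrict (Set.toFinite _) hc.mem₂ hc.notMem
    have h2 : {i : {i // i ≠ a₂ ∧ i ≠ w} | i.1 ∈ B}ᶜ.ncard + 1 = Bᶜ.ncard := by
      have : Subtype.val '' {i : {i // i ≠ a₂ ∧ i ≠ w} | i.1 ∈ B}ᶜ = Bᶜ \ {w} := by
        ext x
        simp only [Set.mem_image, Set.mem_compl_iff, Set.mem_ofPred_eq, Subtype.exists,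
          Set.mem_sdiff, Set.mem_singleton_iff]
        constructor
        · rintro ⟨y, hy, hyB, rfl⟩; exact ⟨hyB, hy.2⟩
        · rintro ⟨hx, hxa⟩
          exact ⟨x, ⟨by rintro rfl; exact hx hc.mem₂, hxa⟩, hx, rfl⟩
      rw [← Set.ncard_image_of_injective _ Subtype.val_injective, this,
        Set.ncard_sdiff_singleton_add_one hc.notMem (Set.toFinite _)]
    omega

end TripodSystem

/-! ### 3-trees as tripod systems -/

namespace ThreeTree

variable {V W : Type*} (G : ThreeTree V)

/-- The vertices of degree 1. -/
def leaves : Set V := {v | (G.graph.neighborSet v).ncard = 1}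

/-- The direction of `u` seen from `v`. -/
noncomputable def step (v u : V) : V := treeStep G.isTree v u

open Classical in
/-- The cyclic order at `v` as a function on all vertices: the neighbor that follows the neighbor
`x` of `v`, and `x` itself if `x` is not a neighbor. -/
noncomputable def next (v x : V) : V :=
  if h : G.graph.Adj v x then (G.rot v ⟨x, h⟩ : G.graph.neighborSet v) else x

variable {G} {v x y z t u a b c i j k l : V}

theorem next_of_adj (h : G.graph.Adj v x) : G.next v x = (G.rot v ⟨x, h⟩).1 := dif_pos h

theorem adj_next (h : G.graph.Adj v x) : G.graph.Adj v (G.next v x) := by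
  rw [next_of_adj h]
  exact (G.rot v ⟨x, h⟩).2

theorem ncard_of_notMem (h : v ∉ G.leaves) : (G.graph.neighborSet v).ncard = 3 :=
  (G.degree_eq v).resolve_left h

theorem iterate_rot_eq_iff (h : v ∉ G.leaves) (x : G.graph.neighborSet v) (n : ℕ) :
    (G.rot v ^ n) x = x ↔ 3 ∣ n := by
  have := G.finite
  have := Fintype.ofFinite (G.graph.neighborSet v)
  have hc : (Finset.univ : Finset (G.graph.neighborSet v)).card = 3 := by
    rw [← ncard_of_notMem h, ← Nat.card_coe_set_eq, Nat.card_eq_fintype_card, Finset.card_univ]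
  rw [← hc]
  refine Equiv.Perm.IsCycleOn.pow_apply_eq ?_ (Finset.mem_univ x)
  simpa using G.rot_cycle v

theorem next_ne (hv : v ∉ G.leaves) (h : G.graph.Adj v x) : G.next v x ≠ x := by
  intro e
  have := (iterate_rot_eq_iff hv ⟨x, h⟩ 1).1 (Subtype.ext (by rw [pow_one, ← next_of_adj h, e]))
  omega

theorem next_next (h : G.graph.Adj v x) :
    G.next v (G.next v x) = ((G.rot v ^ 2) ⟨x, h⟩).1 := by
  rw [next_of_adj (adj_next h)]
  simp only [next_of_adj h]
  rfl

theorem next_next_ne (hv : v ∉ G.leaves) (h : G.graph.Adj v x) :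
    G.next v (G.next v x) ≠ x := by
  intro e
  have := (iterate_rot_eq_iff hv ⟨x, h⟩ 2).1 (Subtype.ext (by rw [← next_next h, e]))
  omega

theorem next_next_next (hv : v ∉ G.leaves) (h : G.graph.Adj v x) :
    G.next v (G.next v (G.next v x)) = x := by
  rw [next_next (adj_next h)]
  simp only [next_of_adj h]
  exact congrArg Subtype.val ((iterate_rot_eq_iff hv ⟨x, h⟩ 3).2 dvd_rfl)

theorem eq_of_adj_of_mem_leaves (hv : v ∈ G.leaves) (hx : G.graph.Adj v x)
    (hy : G.graph.Adj v y) : x = y := by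
  obtain ⟨z, hz⟩ := Set.ncard_eq_one.1 hv
  have h1 : x ∈ G.graph.neighborSet v := hx
  have h2 : y ∈ G.graph.neighborSet v := hy
  rw [hz] at h1 h2
  exact h1.trans h2.symm

theorem next_of_mem_leaves (hv : v ∈ G.leaves) (h : G.graph.Adj v x) : G.next v x = x :=
  eq_of_adj_of_mem_leaves hv (adj_next h) h

theorem eq_or_eq_or_eq_of_adj (hv : v ∉ G.leaves) (hx : G.graph.Adj v x) (hy : G.graph.Adj v y)
    (hz : G.graph.Adj v z) (hxy : x ≠ y) (hyz : y ≠ z) (hzx : z ≠ x) (ht : G.graph.Adj v t) :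
    t = x ∨ t = y ∨ t = z := by
  have := G.finite
  have hs : ({x, y, z} : Set V) = G.graph.neighborSet v := by
    refine Set.eq_of_subset_of_ncard_le ?_ ?_ (Set.toFinite _)
    · rintro w (rfl | rfl | rfl) <;> assumption
    · rw [ncard_of_notMem hv, Set.ncard_eq_three.2 ⟨x, y, z, hxy, hzx.symm, hyz, rfl⟩]
  have : t ∈ G.graph.neighborSet v := ht
  rw [← hs] at this
  simpa using this

theorem eq_next_or (hv : v ∉ G.leaves) (hx : G.graph.Adj v x) (ht : G.graph.Adj v t) :
    t = x ∨ t = G.next v x ∨ t = G.next v (G.next v x) :=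
  eq_or_eq_or_eq_of_adj hv hx (adj_next hx) (adj_next (adj_next hx)) (next_ne hv hx).symm
    (next_ne hv (adj_next hx)).symm (next_next_ne hv hx) ht

theorem step_self : G.step v v = v := treeStep_self G.isTree v

theorem adj_step (h : u ≠ v) : G.graph.Adj v (G.step v u) := adj_treeStep G.isTree h

theorem step_of_adj (h : G.graph.Adj v x) : G.step v x = x := treeStep_of_adj G.isTree h

theorem step_eq_iff (h : G.graph.Adj v x) (u : V) : G.step v u = x ↔ G.step x u ≠ v :=
  treeStep_eq_iff G.isTree h u

theorem step_eq_of_ne (h : G.step v a ≠ G.step v b) (ha : a ≠ v) : G.step a b = G.step a v :=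
  treeStep_eq_of_ne G.isTree h ha

theorem ne_of_mem_leaves (hv : v ∉ G.leaves) (ha : a ∈ G.leaves) : a ≠ v := by
  rintro rfl; exact hv ha

/-- There are leaves in all directions. -/
theorem exists_leaf (h : G.graph.Adj v x) : ∃ i ∈ G.leaves, G.step v i = x := by
  have := G.finite
  have key : ∀ n v x, (branch G.isTree v x).ncard ≤ n → G.graph.Adj v x →
      ∃ i ∈ G.leaves, G.step v i = x := by
    intro n
    induction n with
    | zero =>
      intro v x hn h
      have h0 := (Set.ncard_eq_zero (Set.toFinite _)).1 (Nat.le_zero.1 hn)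
      have : x ∈ branch G.isTree v x := step_of_adj h
      rw [h0] at this
      exact this.elim
    | succ n ih =>
      intro v x hn h
      by_cases hx : x ∈ G.leaves
      · exact ⟨x, hx, step_of_adj h⟩
      · have hz := adj_next h.symm
        have hzv := next_ne hx h.symm
        have := Set.ncard_lt_ncard (branch_ssubset G.isTree h hz hzv) (Set.toFinite _)
        obtain ⟨i, hi, e⟩ := ih x _ (by omega) hz
        exact ⟨i, hi, (step_eq_iff h i).2 (by rw [e]; exact hzv)⟩
  exact key _ v x le_rfl h

theorem eq_of_splits (h : Splits (G.step v) i j k) (h' : Splits (G.step u) i j k) :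
    v = u := by
  by_contra hne
  have key : ∀ {i}, G.step v i ≠ G.step v u → G.step u i = G.step u v := by
    intro i hi
    exact step_eq_of_ne hi.symm (Ne.symm hne)
  by_cases h1 : G.step v i = G.step v u
  · have h2 : G.step v j ≠ G.step v u := fun e => h.1 (h1.trans e.symm)
    have h3 : G.step v k ≠ G.step v u := fun e => h.2.2 (e.trans h1.symm)
    exact h'.2.1 ((key h2).trans (key h3).symm)
  · by_cases h2 : G.step v j = G.step v u
    · have h3 : G.step v k ≠ G.step v u := fun e => h.2.1 (h2.trans e.symm)
      exact h'.2.2 ((key h3).trans (key h1).symm)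
    · exact h'.1 ((key h1).trans (key h2).symm)

/-- Three leaves have a branching point: it is where the paths from `k` to `i` and `j` part. -/
theorem exists_splits (hi : i ∈ G.leaves) (hk : k ∈ G.leaves) (hij : i ≠ j)
    (hjk : j ≠ k) (hki : k ≠ i) : ∃ v, v ∉ G.leaves ∧ Splits (G.step v) i j k := by
  have := G.finite
  have key : ∀ n v x, (branch G.isTree v x).ncard ≤ n → G.graph.Adj v x → G.step v i = x →
      G.step v j = x → G.step v k ≠ x → ∃ v, v ∉ G.leaves ∧ Splits (G.step v) i j k := by
    intro n
    induction n with
    | zero =>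
      intro v x hn h
      have h0 := (Set.ncard_eq_zero (Set.toFinite _)).1 (Nat.le_zero.1 hn)
      have : x ∈ branch G.isTree v x := step_of_adj h
      rw [h0] at this
      exact this.elim
    | succ n ih =>
      intro v x hn h h1 h2 h3
      have h1' := (step_eq_iff h i).1 h1
      have h2' := (step_eq_iff h j).1 h2
      have h3' : G.step x k = v := by
        by_contra e
        exact h3 ((step_eq_iff h k).2 e)
      have hx : x ∉ G.leaves := by
        intro hx
        have : ∀ {u}, G.step x u ≠ v → u = x := by
          intro u hu
          by_contra hne
          exact hu (eq_of_adj_of_mem_leaves hx (adj_step hne) h.symm)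
        exact hij ((this h1').trans (this h2').symm)
      by_cases he : G.step x i = G.step x j
      · have hix : i ≠ x := ne_of_mem_leaves hx hi
        have := Set.ncard_lt_ncard (branch_ssubset G.isTree h (adj_step hix) h1') (Set.toFinite _)
        exact ih x (G.step x i) (by unfold step; unfold step at this; omega) (adj_step hix) rfl
          he.symm (by rw [h3']; exact h1'.symm)
      · exact ⟨x, hx, he, by rw [h3']; exact h2', by rw [h3']; exact h1'.symm⟩
  have ha := adj_step (G := G) (v := k) (u := i) hki.symm
  exact key _ k _ le_rfl ha rfl (eq_of_adj_of_mem_leaves hk (adj_step hjk) ha)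
    (by rw [step_self]; exact ha.ne)

theorem hasDisjointPaths_iff (ha : a ≠ v) (hb : b ≠ v) (hc : c ≠ v) :
    G.HasDisjointPaths v a b c ↔ Splits (G.step v) a b c := by
  constructor
  · rintro ⟨p, q, r, hp, hq, hr, h1, h2, h3⟩
    have key : ∀ {a b} {p : G.graph.Walk v a} {q : G.graph.Walk v b}, p.IsPath → q.IsPath →
        a ≠ v → (∀ x, x ∈ p.support → x ∈ q.support → x = v) → G.step v a ≠ G.step v b := by
      intro a b p q hp hq ha h e
      have hs : p.snd = q.snd := by
        rw [← treeStep_eq_snd G.isTree hp, ← treeStep_eq_snd G.isTree hq]; exact e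
      have := h p.snd (p.getVert_mem_support 1) (by rw [hs]; exact q.getVert_mem_support 1)
      exact (p.adj_snd (SimpleGraph.Walk.not_nil_of_ne ha.symm)).ne this.symm
    exact ⟨key hp hq ha h1, key hq hr hb h2, key hr hp hc h3⟩
  · intro h
    obtain ⟨p, hp, -⟩ := G.isTree.existsUnique_path v a
    obtain ⟨q, hq, -⟩ := G.isTree.existsUnique_path v b
    obtain ⟨r, hr, -⟩ := G.isTree.existsUnique_path v c
    have key : ∀ {a b} {p : G.graph.Walk v a} {q : G.graph.Walk v b}, p.IsPath → q.IsPath →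
        G.step v a ≠ G.step v b → (∀ x, x ∈ p.support → x ∈ q.support → x = v) := by
      intro a b p q hp hq hne x hx hx'
      by_contra hxv
      exact hne ((treeStep_of_mem_support G.isTree hp hx hxv).symm.trans
        (treeStep_of_mem_support G.isTree hq hx' hxv))
    exact ⟨p, q, r, hp, hq, hr, key hp hq h.1, key hq hr h.2.1, key hr hp h.2.2⟩

/-- The cyclic order of the leaves in terms of directions. -/
theorem leafOrder_iff (ha : a ∈ G.leaves) (hb : b ∈ G.leaves) (hc : c ∈ G.leaves) :
    G.LeafOrder a b c ↔ ∃ v x, v ∉ G.leaves ∧ G.graph.Adj v x ∧ G.step v a = x ∧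
      G.step v b = G.next v x ∧ G.step v c = G.next v (G.next v x) := by
  constructor
  · rintro ⟨v, p, q, r, x, hd, h1, h2, h3⟩
    have hx : G.graph.Adj v x := x.2
    have e1 : G.next v x = G.rot v x := next_of_adj hx
    have e2 : G.next v (G.next v x) = G.rot v (G.rot v x) := by
      rw [e1, next_of_adj (G.rot v x).2]
    refine ⟨v, x, fun hv => ?_, hx, ?_, ?_, ?_⟩
    · have hs : p.snd = q.snd := by rw [h1, h2, ← e1, next_of_mem_leaves hv hx]
      have := hd.2.2.2.1 p.snd (p.getVert_mem_support 1) (by rw [hs]; exact q.getVert_mem_support 1)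
      rw [h1] at this
      exact hx.ne this.symm
    · rw [← h1]; exact treeStep_eq_snd G.isTree hd.1
    · rw [e1, ← h2]; exact treeStep_eq_snd G.isTree hd.2.1
    · rw [e2, ← h3]; exact treeStep_eq_snd G.isTree hd.2.2.1
  · rintro ⟨v, x, hv, hx, h1, h2, h3⟩
    have hs : Splits (G.step v) a b c := by
      refine ⟨?_, ?_, ?_⟩
      · rw [h1, h2]; exact (next_ne hv hx).symm
      · rw [h2, h3]; exact (next_ne hv (adj_next hx)).symm
      · rw [h1, h3]; exact next_next_ne hv hx
    obtain ⟨p, q, r, hd⟩ := (hasDisjointPaths_iff (ne_of_mem_leaves hv ha)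
      (ne_of_mem_leaves hv hb) (ne_of_mem_leaves hv hc)).2 hs
    have e1 : G.next v x = G.rot v ⟨x, hx⟩ := next_of_adj hx
    refine ⟨v, p, q, r, ⟨x, hx⟩, hd, ?_, ?_, ?_⟩
    · exact (treeStep_eq_snd G.isTree hd.1).symm.trans h1
    · rw [← e1, ← h2]; exact (treeStep_eq_snd G.isTree hd.2.1).symm
    · rw [← next_of_adj (G.rot v ⟨x, hx⟩).2, ← e1, ← h3]
      exact (treeStep_eq_snd G.isTree hd.2.2.1).symm

theorem splits_of_next (hv : v ∉ G.leaves) (hx : G.graph.Adj v x) (h1 : G.step v a = x)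
    (h2 : G.step v b = G.next v x) (h3 : G.step v c = G.next v (G.next v x)) :
    Splits (G.step v) a b c := by
  refine ⟨?_, ?_, ?_⟩
  · rw [h1, h2]; exact (next_ne hv hx).symm
  · rw [h2, h3]; exact (next_ne hv (adj_next hx)).symm
  · rw [h1, h3]; exact next_next_ne hv hx

/-- At the vertex that separates `i`, `j`, `k`, the order of the leaves is the order of their
directions. -/
theorem leafOrder_iff_of_splits (hv : v ∉ G.leaves) (hi : i ∈ G.leaves) (hj : j ∈ G.leaves)
    (hk : k ∈ G.leaves) (h : Splits (G.step v) i j k) :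
    G.LeafOrder i j k ↔ G.step v j = G.next v (G.step v i) := by
  rw [leafOrder_iff hi hj hk]
  constructor
  · rintro ⟨u, x, hu, hx, h1, h2, h3⟩
    obtain rfl := eq_of_splits (splits_of_next hu hx h1 h2 h3) h
    rw [h1, h2]
  · intro e
    have hx := adj_step (G := G) (ne_of_mem_leaves hv hi)
    refine ⟨v, _, hv, hx, rfl, e, ?_⟩
    rcases eq_next_or hv hx (adj_step (ne_of_mem_leaves hv hk)) with e' | e' | e'
    · exact absurd e' h.2.2
    · exact absurd (e.trans e'.symm) h.2.1
    · exact e'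

/-- The branching vertices of a 3-tree sort its leaves by their directions. -/
theorem tripodSystem (G : ThreeTree V) : TripodSystem G.leaves G.LeafOrder G.step where
  cyc := by
    intro i j k hi hj hk h
    rw [leafOrder_iff hi hj hk] at h
    obtain ⟨v, x, hv, hx, h1, h2, h3⟩ := h
    exact (leafOrder_iff hj hk hi).2 ⟨v, _, hv, adj_next hx, h2, h3,
      by rw [h1, next_next_next hv hx]⟩
  asymm := by
    intro i j k hi hj hk h h'
    obtain ⟨v, x, hv, hx, h1, h2, h3⟩ := (leafOrder_iff hi hj hk).1 h
    have s := splits_of_next hv hx h1 h2 h3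
    have s' : Splits (G.step v) k j i := s.swap.rot.rot
    have := (leafOrder_iff_of_splits hv hk hj hi s').1 h'
    rw [h2, h3, next_next_next hv hx] at this
    exact next_ne hv hx this
  total := by
    intro i j k hi hj hk h1 h2 h3
    obtain ⟨v, hv, s⟩ := exists_splits hi hk h1 h2 h3
    rw [leafOrder_iff_of_splits hv hi hj hk s,
      leafOrder_iff_of_splits hv hk hj hi (s.swap.rot.rot : Splits (G.step v) k j i)]
    have hx := adj_step (G := G) (ne_of_mem_leaves hv hi)
    rcases eq_next_or hv hx (adj_step (ne_of_mem_leaves hv hj)) with e' | e' | e'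
    · exact absurd e'.symm s.1
    · exact Or.inl e'
    · rcases eq_next_or hv hx (adj_step (ne_of_mem_leaves hv hk)) with e | e | e
      · exact absurd e s.2.2
      · rw [← e] at e'; exact Or.inr e'
      · exact absurd (e'.trans e.symm) s.2.1
  three := by
    intro w i j k l hw hi hj hk hl s
    exact eq_or_eq_or_eq_of_adj hw (adj_step (ne_of_mem_leaves hw hi))
      (adj_step (ne_of_mem_leaves hw hj)) (adj_step (ne_of_mem_leaves hw hk)) s.1 s.2.1 s.2.2
      (adj_step (ne_of_mem_leaves hw hl))
  ex hi _ hk := exists_splits hi hk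
  un _ _ _ _ _ s s' := eq_of_splits s s'
  planar := by
    intro w i j k l hw hi hj hk hl s e h
    rw [leafOrder_iff_of_splits hw hi hj hk s] at h
    rwa [leafOrder_iff_of_splits hw hi hj hl (s.congr e)]
  surj := by
    intro w hw
    obtain ⟨x, hx⟩ : (G.graph.neighborSet w).Nonempty := by
      apply Set.nonempty_of_ncard_ne_zero
      rw [ncard_of_notMem hw]
      norm_num
    obtain ⟨i, hi, ei⟩ := exists_leaf hx
    obtain ⟨j, hj, ej⟩ := exists_leaf (adj_next hx)
    obtain ⟨k, hk, ek⟩ := exists_leaf (adj_next (adj_next hx))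
    exact ⟨i, hi, j, hj, k, hk, splits_of_next hw hx ei ej ek⟩

end ThreeTree

namespace ThreeTree

/-! ### A 3-tree is determined by its leaves -/

variable {V W : Type*} {G : ThreeTree V} {H : ThreeTree W} {u v x i j k : V}

theorem step_eq_step_iff (hv : v ∉ G.leaves) (hi : i ∈ G.leaves) (hj : j ∈ G.leaves) :
    G.step v i = G.step v j ↔ ∀ k ∈ G.leaves, ¬ Splits (G.step v) i j k := by
  refine ⟨fun e k _ s => s.1 e, fun h => ?_⟩
  by_contra hne
  have hx := adj_step (G := G) (ne_of_mem_leaves hv hi)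
  rcases eq_next_or hv hx (adj_step (ne_of_mem_leaves hv hj)) with e | e | e
  · exact hne e.symm
  · obtain ⟨k, hk, ek⟩ := exists_leaf (adj_next (adj_next hx))
    exact h k hk (splits_of_next hv hx rfl e ek)
  · obtain ⟨k, hk, ek⟩ := exists_leaf (adj_next hx)
    exact h k hk (splits_of_next hv hx rfl ek e).swap.rot.rot.swap.rot.swap

/-- A branching vertex is adjacent to the leaves that are alone in their direction. -/
theorem adj_leaf_iff (hv : v ∉ G.leaves) (hi : i ∈ G.leaves) :
    G.graph.Adj v i ↔ ∀ j ∈ G.leaves, G.step v j = G.step v i → j = i := by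
  constructor
  · intro h j _ e
    by_contra hne
    rw [step_of_adj h] at e
    exact (step_eq_iff h j).1 e (eq_of_adj_of_mem_leaves hi (adj_step hne) h.symm)
  · intro h
    by_contra hadj
    set x := G.step v i with hx
    have hvx : G.graph.Adj v x := adj_step (ne_of_mem_leaves hv hi)
    have hxi : i ≠ x := by rintro e; rw [← e] at hvx; exact hadj hvx
    have h1 : G.step x i ≠ v := (step_eq_iff hvx i).1 hx.symm
    by_cases hxl : x ∈ G.leaves
    · exact h1 (eq_of_adj_of_mem_leaves hxl (adj_step hxi) hvx.symm)
    · obtain ⟨z, hz, hzv, hzi⟩ : ∃ z, G.graph.Adj x z ∧ z ≠ v ∧ z ≠ G.step x i := by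
        have hxv := hvx.symm
        by_cases e : G.next x v = G.step x i
        · exact ⟨_, adj_next (adj_next hxv), next_next_ne hxl hxv,
            by rw [← e]; exact next_ne hxl (adj_next hxv)⟩
        · exact ⟨_, adj_next hxv, next_ne hxl hxv, e⟩
      obtain ⟨j, hj, ej⟩ := exists_leaf hz
      have := h j hj ((step_eq_iff hvx j).2 (by rw [ej]; exact hzv))
      rw [this] at ej
      exact hzi ej.symm

/-- Two branching vertices are adjacent if and only if a class of leaves of the one is the
complement of a class of the other. -/
theorem adj_iff_of_notMem (hv : v ∉ G.leaves) :
    G.graph.Adj v u ↔ v ≠ u ∧ ∃ i ∈ G.leaves, ∃ j ∈ G.leaves, ∀ k ∈ G.leaves,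
      (G.step v k = G.step v i ↔ G.step u k ≠ G.step u j) := by
  constructor
  · intro h
    obtain ⟨i, hi, ei⟩ := exists_leaf h
    obtain ⟨j, hj, ej⟩ := exists_leaf h.symm
    refine ⟨h.ne, i, hi, j, hj, fun k _ => ?_⟩
    rw [ei, ej]
    exact step_eq_iff h k
  · rintro ⟨hne, i, hi, j, hj, h⟩
    have hi1 : G.step u i ≠ G.step u j := (h i hi).1 rfl
    have hj1 : G.step v j ≠ G.step v i := fun e => (h j hj).1 e rfl
    set x := G.step v i with hx
    have hvx : G.graph.Adj v x := adj_step (ne_of_mem_leaves hv hi)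
    -- a leaf in a third direction at `v`
    obtain ⟨l, hl, hli, hlj⟩ : ∃ l ∈ G.leaves, G.step v l ≠ x ∧ G.step v l ≠ G.step v j := by
      by_cases e : G.next v x = G.step v j
      · obtain ⟨l, hl, el⟩ := exists_leaf (adj_next (adj_next hvx))
        exact ⟨l, hl, by rw [el]; exact next_next_ne hv hvx,
          by rw [el, ← e]; exact next_ne hv (adj_next hvx)⟩
      · obtain ⟨l, hl, el⟩ := exists_leaf (adj_next hvx)
        exact ⟨l, hl, by rw [el]; exact next_ne hv hvx, by rwa [el]⟩
    have hl1 : G.step u l = G.step u j := by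
      by_contra e
      exact hli ((h l hl).2 e)
    have hux : G.step v u = x := by
      by_contra hne2
      have e1 : G.step u i = G.step u v := step_eq_of_ne hne2 hne.symm
      rcases eq_or_ne (G.step v u) (G.step v l) with e | e
      · have e2 : G.step u j = G.step u v :=
          step_eq_of_ne (by rw [e]; exact hlj) hne.symm
        exact hi1 (e1.trans e2.symm)
      · have e2 : G.step u l = G.step u v := step_eq_of_ne e hne.symm
        exact hi1 (e1.trans (e2.symm.trans hl1))
    have hju : G.step u j = G.step u v := step_eq_of_ne (by rw [hux]; exact hj1.symm) hne.symm
    by_contra hadj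
    have hxu : u ≠ x := by rintro e; rw [← e] at hvx; exact hadj hvx
    have h1 : G.step x u ≠ v := (step_eq_iff hvx u).1 hux
    have hxl : x ∉ G.leaves := fun hxl =>
      h1 (eq_of_adj_of_mem_leaves hxl (adj_step hxu) hvx.symm)
    obtain ⟨z, hz, hzv, hzu⟩ : ∃ z, G.graph.Adj x z ∧ z ≠ v ∧ z ≠ G.step x u := by
      have hxv := hvx.symm
      by_cases e : G.next x v = G.step x u
      · exact ⟨_, adj_next (adj_next hxv), next_next_ne hxl hxv,
          by rw [← e]; exact next_ne hxl (adj_next hxv)⟩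
      · exact ⟨_, adj_next hxv, next_ne hxl hxv, e⟩
    obtain ⟨k, hk, ek⟩ := exists_leaf hz
    have hk1 : G.step v k = x := (step_eq_iff hvx k).2 (by rw [ek]; exact hzv)
    have hk2 : G.step u k = G.step u x := step_eq_of_ne (by rw [ek]; exact hzu.symm) hxu
    have hk3 : G.step u v = G.step u x :=
      step_eq_of_ne (by rw [step_of_adj hvx.symm]; exact h1) hxu
    exact (h k hk).1 hk1 (by rw [hk2, hju, hk3])

theorem not_adj_leaves (h3 : ∃ w, w ∉ G.leaves) (hi : i ∈ G.leaves) (hj : j ∈ G.leaves) :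
    ¬ G.graph.Adj i j := by
  intro h
  obtain ⟨w, hw⟩ := h3
  have h1 : G.step i w = j :=
    eq_of_adj_of_mem_leaves hi (adj_step (ne_of_mem_leaves hw hi).symm) h
  exact (step_eq_iff h w).1 h1
    (eq_of_adj_of_mem_leaves hj (adj_step (ne_of_mem_leaves hw hj).symm) h.symm)

theorem step_map (f : G.graph ≃g H.graph) (v u : V) : H.step (f v) (f u) = f (G.step v u) := by
  obtain ⟨p, hp, -⟩ := G.isTree.existsUnique_path v u
  have h1 : G.step v u = p.snd := treeStep_eq_snd G.isTree hp
  have h2 : H.step (f v) (f u) = (p.map f.toHom).snd :=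
    treeStep_eq_snd H.isTree (hp.map f.injective)
  rw [h1, h2]
  simp [SimpleGraph.Walk.snd, SimpleGraph.Walk.getVert_map]

theorem isomorphic_of_next (f : G.graph ≃g H.graph)
    (h : ∀ v x, G.graph.Adj v x → H.next (f v) (f x) = f (G.next v x)) : G.Isomorphic H := by
  refine ⟨f, fun v x => Subtype.ext ?_⟩
  have hx : G.graph.Adj v x := x.2
  have := h v x hx
  rw [next_of_adj hx, next_of_adj (f.map_adj_iff.2 hx)] at this
  exact this

theorem next_reverse (hx : G.graph.Adj v x) : G.reverse.next v (G.next v x) = x := by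
  have h1 : G.reverse.graph.Adj v (G.next v x) := adj_next hx
  rw [next_of_adj h1]
  simp only [next_of_adj hx]
  exact congrArg Subtype.val ((G.rot v).symm_apply_apply ⟨x, hx⟩)

/-- A bijection between two 3-trees that preserves the leaves, the separation of leaves by
branching vertices and, up to reversal, the cyclic order of the leaves is an isomorphism. -/
theorem isomorphic_of_bijection (h3 : ∃ w, w ∉ G.leaves) (F : V ≃ W)
    (hl : ∀ v, F v ∈ H.leaves ↔ v ∈ G.leaves)
    (hM : ∀ v i j k, v ∉ G.leaves → i ∈ G.leaves → j ∈ G.leaves → k ∈ G.leaves →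
      (Splits (H.step (F v)) (F i) (F j) (F k) ↔ Splits (G.step v) i j k))
    (ho : (∀ i j k, i ∈ G.leaves → j ∈ G.leaves → k ∈ G.leaves →
        G.LeafOrder i j k → H.LeafOrder (F i) (F j) (F k)) ∨
      (∀ i j k, i ∈ G.leaves → j ∈ G.leaves → k ∈ G.leaves →
        G.LeafOrder i j k → H.LeafOrder (F k) (F j) (F i))) :
    G.Isomorphic H ∨ G.Isomorphic H.reverse := by
  have hFl : ∀ w ∈ H.leaves, ∃ v ∈ G.leaves, F v = w := fun w hw =>
    ⟨F.symm w, (hl _).1 (by simpa using hw), by simp⟩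
  -- adjacency is determined by the classes of leaves, and these are determined by `Splits`
  have hcls : ∀ {v i j}, v ∉ G.leaves → i ∈ G.leaves → j ∈ G.leaves →
      (H.step (F v) (F i) = H.step (F v) (F j) ↔ G.step v i = G.step v j) := by
    intro v i j hv hi hj
    rw [step_eq_step_iff hv hi hj, step_eq_step_iff (by rwa [hl]) ((hl i).2 hi) ((hl j).2 hj)]
    constructor
    · intro h k hk s
      exact h _ ((hl k).2 hk) ((hM v i j k hv hi hj hk).2 s)
    · rintro h w hw s
      obtain ⟨k, hk, rfl⟩ := hFl w hw
      exact h k hk ((hM v i j k hv hi hj hk).1 s)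
  have h3' : ∃ w, w ∉ H.leaves := by
    obtain ⟨w, hw⟩ := h3
    exact ⟨F w, by rwa [hl]⟩
  have hadj1 : ∀ {v i}, v ∉ G.leaves → i ∈ G.leaves →
      (H.graph.Adj (F v) (F i) ↔ G.graph.Adj v i) := by
    intro v i hv hi
    rw [adj_leaf_iff hv hi, adj_leaf_iff (by rwa [hl]) ((hl i).2 hi)]
    constructor
    · intro h j hj e
      exact F.injective (h _ ((hl j).2 hj) ((hcls hv hj hi).2 e))
    · rintro h w hw e
      obtain ⟨j, hj, rfl⟩ := hFl w hw
      rw [h j hj ((hcls hv hj hi).1 e)]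
  have hadj : ∀ {v u}, H.graph.Adj (F v) (F u) ↔ G.graph.Adj v u := by
    intro v u
    by_cases hv : v ∈ G.leaves <;> by_cases hu : u ∈ G.leaves
    · exact iff_of_false (not_adj_leaves h3' ((hl v).2 hv) ((hl u).2 hu))
        (not_adj_leaves h3 hv hu)
    · rw [SimpleGraph.adj_comm, hadj1 hu hv, SimpleGraph.adj_comm]
    · exact hadj1 hv hu
    · rw [adj_iff_of_notMem hv, adj_iff_of_notMem (by rwa [hl])]
      refine and_congr F.injective.ne_iff ?_
      constructor
      · rintro ⟨i, hi, j, hj, h⟩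
        obtain ⟨i', hi', rfl⟩ := hFl i hi
        obtain ⟨j', hj', rfl⟩ := hFl j hj
        refine ⟨i', hi', j', hj', fun k hk => ?_⟩
        have := h _ ((hl k).2 hk)
        rwa [Ne, hcls hv hk hi', hcls hu hk hj'] at this
      · rintro ⟨i, hi, j, hj, h⟩
        refine ⟨F i, (hl i).2 hi, F j, (hl j).2 hj, fun k hk => ?_⟩
        obtain ⟨k', hk', rfl⟩ := hFl k hk
        rw [Ne, hcls hv hk' hi, hcls hu hk' hj]
        exact h k' hk'
  let f : G.graph ≃g H.graph := ⟨F, hadj⟩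
  have hf : ∀ v, f v = F v := fun _ => rfl
  have hstep : ∀ v u, H.step (F v) (F u) = F (G.step v u) := step_map f
  -- three leaves in the three directions at a branching vertex, in their cyclic order
  have hex : ∀ v x, v ∉ G.leaves → G.graph.Adj v x → ∃ a ∈ G.leaves, ∃ b ∈ G.leaves,
      ∃ c ∈ G.leaves, G.step v a = x ∧ G.step v b = G.next v x ∧
        G.step v c = G.next v (G.next v x) ∧ G.LeafOrder a b c ∧ Splits (G.step v) a b c := by
    intro v x hv hx
    obtain ⟨a, ha, ea⟩ := exists_leaf hx
    obtain ⟨b, hb, eb⟩ := exists_leaf (adj_next hx)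
    obtain ⟨c, hc, ec⟩ := exists_leaf (adj_next (adj_next hx))
    exact ⟨a, ha, b, hb, c, hc, ea, eb, ec, (leafOrder_iff ha hb hc).2 ⟨v, x, hv, hx, ea, eb, ec⟩,
      splits_of_next hv hx ea eb ec⟩
  rcases ho with ho | ho
  · left
    refine isomorphic_of_next f fun v x hx => ?_
    rw [hf, hf, hf]
    by_cases hv : v ∈ G.leaves
    · rw [next_of_mem_leaves hv hx, next_of_mem_leaves ((hl v).2 hv) (hadj.2 hx)]
    · obtain ⟨a, ha, b, hb, c, hc, ea, eb, ec, o, s⟩ := hex v x hv hx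
      have := (leafOrder_iff_of_splits (by rwa [hl]) ((hl a).2 ha) ((hl b).2 hb) ((hl c).2 hc)
        ((hM v a b c hv ha hb hc).2 s)).1 (ho a b c ha hb hc o)
      rw [hstep, hstep, ea, eb] at this
      exact this.symm
  · right
    refine isomorphic_of_next (H := H.reverse) f fun v x hx => ?_
    change H.reverse.next (F v) (F x) = F (G.next v x)
    by_cases hv : v ∈ G.leaves
    · have hv' : F v ∈ H.reverse.leaves := (hl v).2 hv
      have hx' : H.reverse.graph.Adj (F v) (F x) := hadj.2 hx
      rw [next_of_mem_leaves hv hx, next_of_mem_leaves hv' hx']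
    · obtain ⟨a, ha, b, hb, c, hc, ea, eb, ec, o, s⟩ := hex v x hv hx
      have s' : Splits (G.step v) c b a := s.swap.rot.rot
      have hv' : F v ∉ H.leaves := by rwa [hl]
      have := (leafOrder_iff_of_splits hv' ((hl c).2 hc) ((hl b).2 hb) ((hl a).2 ha)
        ((hM v c b a hv hc hb ha).2 s')).1 (ho a b c ha hb hc o)
      rw [hstep, hstep, eb, ec] at this
      have h4 : H.next (F v) (F (G.next v x)) = F x := by
        have hy : H.graph.Adj (F v) (F (G.next v (G.next v x))) := hadj.2 (adj_next (adj_next hx))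
        rcases eq_next_or hv' hy (hadj.2 hx) with e | e | e
        · exact absurd (F.injective e).symm (next_next_ne hv hx)
        · exact absurd (F.injective (e.trans this.symm)).symm (next_ne hv hx)
        · rw [this, e]
      rw [← h4, next_reverse (hadj.2 (adj_next hx))]

end ThreeTree

namespace TripodSystem

/-! ### Constructing 3-trees -/

variable {ι ι' κ κ' : Type*} {B : Set ι} {o o' : ι → ι → ι → Prop} {br : ι → ι → κ}
  {br' : ι → ι → κ'} {a₁ a₂ w i j k : ι}

theorem comap (h : TripodSystem B o br) (e : ι' ≃ ι) :
    TripodSystem (e ⁻¹' B) (fun i j k => o (e i) (e j) (e k)) (fun v i => br (e v) (e i)) where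
  cyc := h.cyc
  asymm := h.asymm
  total hi hj hk h1 h2 h3 :=
    h.total hi hj hk (e.injective.ne h1) (e.injective.ne h2) (e.injective.ne h3)
  three := h.three
  ex hi hj hk h1 h2 h3 := by
    obtain ⟨w, hw, s⟩ :=
      h.ex hi hj hk (e.injective.ne h1) (e.injective.ne h2) (e.injective.ne h3)
    refine ⟨e.symm w, by simpa using hw, ?_⟩
    simpa [Splits] using s
  un hw hw' hi hj hk s s' := e.injective (h.un hw hw' hi hj hk s s')
  planar := h.planar
  surj hw := by
    obtain ⟨i, hi, j, hj, k, hk, s⟩ := h.surj hw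
    exact ⟨e.symm i, by simpa using hi, e.symm j, by simpa using hj, e.symm k, by simpa using hk,
      by simpa [Splits] using s⟩

theorem _root_.Neighborly.IsCherry.comap (h : IsCherry B o br a₁ a₂ w) (e : ι' ≃ ι)
    {b₁ b₂ v : ι'} (h1 : e b₁ = a₁) (h2 : e b₂ = a₂) (hv : e v = w) :
    IsCherry (e ⁻¹' B) (fun i j k => o (e i) (e j) (e k)) (fun v i => br (e v) (e i)) b₁ b₂ v := by
  subst h1 h2 hv
  exact ⟨h.mem₁, h.mem₂, fun e' => h.ne (by rw [e']), h.notMem,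
    fun k hk n1 n2 => h.splits _ hk (e.injective.ne n1) (e.injective.ne n2),
    fun k hk n1 n2 => h.order _ hk (e.injective.ne n1) (e.injective.ne n2)⟩

/-- A branching point of a cherry separates three leaves if and only if the cherry is among them. -/
theorem splits_cherry_iff (h : TripodSystem B o br) (hc : IsCherry B o br a₁ a₂ w)
    (hi : i ∈ B) (hj : j ∈ B) (hk : k ∈ B) :
    Splits (br w) i j k ↔ (i ≠ j ∧ j ≠ k ∧ k ≠ i) ∧ (a₁ = i ∨ a₁ = j ∨ a₁ = k) ∧
      (a₂ = i ∨ a₂ = j ∨ a₂ = k) := by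
  constructor
  · intro s
    have key : ∀ {i j}, i ∈ B → j ∈ B → br w i ≠ br w j →
        i = a₁ ∨ i = a₂ ∨ j = a₁ ∨ j = a₂ := by
      intro i j hi hj hne
      by_contra hcon
      push Not at hcon
      exact hne (h.splits_cherry hc hi hj hcon.1 hcon.2.1 hcon.2.2.1 hcon.2.2.2)
    have h1 := key hi hj s.1
    have h2 := key hj hk s.2.1
    have h3 := key hk hi s.2.2
    unfold Splits at s
    grind
  · rintro ⟨⟨n1, n2, n3⟩, h1, h2⟩
    have hs1 := hc.splits i hi
    have hs2 := hc.splits j hj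
    have hs3 := hc.splits k hk
    have := hc.ne
    unfold Splits at *
    grind

/-- Two tripod systems with a common cherry that agree without one of its two leaves are equal. -/
theorem splits_iff_of_cherry (h : TripodSystem B o br) (h' : TripodSystem B o' br')
    (hc : IsCherry B o br a₁ a₂ w) (hc' : IsCherry B o' br' a₁ a₂ w)
    (hM : ∀ v i j k, v ∉ B → v ≠ w → i ∈ B → j ∈ B → k ∈ B → i ≠ a₂ → j ≠ a₂ → k ≠ a₂ →
      (Splits (br v) i j k ↔ Splits (br' v) i j k)) {v : ι}
    (hv : v ∉ B) (hi : i ∈ B) (hj : j ∈ B) (hk : k ∈ B) :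
    Splits (br v) i j k ↔ Splits (br' v) i j k := by
  classical
  by_cases hvw : v = w
  · subst hvw
    rw [h.splits_cherry_iff hc hi hj hk, h'.splits_cherry_iff hc' hi hj hk]
  · let ρ : ι → ι := fun x => if x = a₂ then a₁ else x
    have e1 : ∀ x, br v (ρ x) = br v x := by
      intro x
      by_cases hx : x = a₂
      · simp only [ρ, hx, if_true]; exact h.br_cherry hc hv hvw
      · simp [ρ, hx]
    have e2 : ∀ x, br' v (ρ x) = br' v x := by
      intro x
      by_cases hx : x = a₂
      · simp only [ρ, hx, if_true]; exact h'.br_cherry hc' hv hvw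
      · simp [ρ, hx]
    have hρ : ∀ x ∈ B, ρ x ∈ B ∧ ρ x ≠ a₂ := by
      intro x hx
      by_cases hx2 : x = a₂
      · simp only [ρ, hx2, if_true]; exact ⟨hc.mem₁, hc.ne⟩
      · simp only [ρ, hx2, if_false]; exact ⟨hx, hx2⟩
    have := hM v (ρ i) (ρ j) (ρ k) hv hvw (hρ i hi).1 (hρ j hj).1 (hρ k hk).1 (hρ i hi).2
      (hρ j hj).2 (hρ k hk).2
    unfold Splits at *
    rwa [e1, e1, e1, e2, e2, e2] at this

theorem order_of_cherry (h : TripodSystem B o br) (h' : TripodSystem B o' br')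
    (hc : IsCherry B o br a₁ a₂ w) (hc' : IsCherry B o' br' a₁ a₂ w)
    (ho : ∀ i j k, i ∈ B → j ∈ B → k ∈ B → i ≠ a₂ → j ≠ a₂ → k ≠ a₂ → (o i j k ↔ o' i j k))
    (hi : i ∈ B) (hj : j ∈ B) (hk : k ∈ B) : o i j k ↔ o' i j k := by
  have cyc : ∀ {i j k}, i ∈ B → j ∈ B → k ∈ B → (o i j k ↔ o j k i) := fun hi hj hk =>
    ⟨h.cyc hi hj hk, fun x => h.cyc hk hi hj (h.cyc hj hk hi x)⟩
  have cyc' : ∀ {i j k}, i ∈ B → j ∈ B → k ∈ B → (o' i j k ↔ o' j k i) := fun hi hj hk =>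
    ⟨h'.cyc hi hj hk, fun x => h'.cyc hk hi hj (h'.cyc hj hk hi x)⟩
  have key : ∀ {j k}, j ∈ B → k ∈ B → (o a₂ j k ↔ o' a₂ j k) := by
    intro j k hj hk
    by_cases hd : j ≠ a₂ ∧ k ≠ a₂ ∧ j ≠ k
    · obtain ⟨hj2, hk2, hjk⟩ := hd
      by_cases hj1 : j = a₁
      · subst hj1
        refine iff_of_false (fun x => ?_) (fun x => ?_)
        · exact h.asymm hc.mem₂ hj hk x (h.cyc hj hc.mem₂ hk (hc.order k hk hjk.symm hk2) |>
            h.cyc hc.mem₂ hk hj)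
        · exact h'.asymm hc.mem₂ hj hk x (h'.cyc hj hc.mem₂ hk (hc'.order k hk hjk.symm hk2) |>
            h'.cyc hc.mem₂ hk hj)
      · by_cases hk1 : k = a₁
        · subst hk1
          exact iff_of_true (h.cyc hk hc.mem₂ hj (hc.order j hj hj1 hj2))
            (h'.cyc hk hc.mem₂ hj (hc'.order j hj hj1 hj2))
        · rw [h.order_cherry hc hj hk hj1 hj2 hk1 hk2, h'.order_cherry hc' hj hk hj1 hj2 hk1 hk2]
          exact ho _ _ _ hc.mem₁ hj hk hc.ne hj2 hk2
    · refine iff_of_false (fun x => hd ?_) (fun x => hd ?_)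
      · obtain ⟨n1, n2, n3⟩ := h.ne_of_order hc.mem₂ hj hk x
        exact ⟨n1.symm, n3, n2⟩
      · obtain ⟨n1, n2, n3⟩ := h'.ne_of_order hc.mem₂ hj hk x
        exact ⟨n1.symm, n3, n2⟩
  by_cases hi2 : i = a₂
  · subst hi2; exact key hj hk
  by_cases hj2 : j = a₂
  · subst hj2; rw [cyc hi hj hk, cyc' hi hj hk]; exact key hk hi
  by_cases hk2 : k = a₂
  · subst hk2; rw [cyc hi hj hk, cyc' hi hj hk, cyc hj hk hi, cyc' hj hk hi]; exact key hi hj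
  exact ho i j k hi hj hk hi2 hj2 hk2

end TripodSystem

namespace ThreeTree

variable {V : Type*}

/-- The 3-tree with the given underlying tree in which `nx v x` is the neighbor of `v` that follows
the neighbor `x`. -/
def ofNext [Finite V] (T : SimpleGraph V) (hT : T.IsTree)
    (hdeg : ∀ v, (T.neighborSet v).ncard = 1 ∨ (T.neighborSet v).ncard = 3) (nx : V → V → V)
    (hmem : ∀ v x, T.Adj v x → T.Adj v (nx v x))
    (h3 : ∀ v x, T.Adj v x → nx v (nx v (nx v x)) = x)
    (hcyc : ∀ v x y, T.Adj v x → T.Adj v y → y = x ∨ y = nx v x ∨ y = nx v (nx v x)) :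
    ThreeTree V where
  finite := inferInstance
  graph := T
  isTree := hT
  degree_eq := hdeg
  rot v :=
    { toFun := fun x => ⟨nx v x, hmem v x x.2⟩
      invFun := fun x => ⟨nx v (nx v x), hmem v _ (hmem v x x.2)⟩
      left_inv := fun x => Subtype.ext (h3 v x x.2)
      right_inv := fun x => Subtype.ext (h3 v x x.2) }
  rot_cycle v := by
    refine ⟨Set.bijOn_univ.2 (Equiv.bijective _), fun x _ y _ => ?_⟩
    rcases hcyc v x y x.2 y.2 with e | e | e
    · exact ⟨0, Subtype.ext e.symm⟩
    · exact ⟨1, Subtype.ext e.symm⟩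
    · exact ⟨2, Subtype.ext e.symm⟩

section Expand

variable (G : ThreeTree V) (l : V)

/-- The graph obtained by attaching two new vertices to `l`. -/
def expandGraph : SimpleGraph (V ⊕ Bool) where
  Adj
    | .inl v, .inl u => G.graph.Adj v u
    | .inl v, .inr _ => v = l
    | .inr _, .inl v => v = l
    | .inr _, .inr _ => False
  symm := ⟨by
    rintro (v | b) (u | c) h
    · exact G.graph.symm.symm _ _ h
    · exact h
    · exact h
    · exact h⟩
  loopless := ⟨by
    rintro (v | b) h
    · exact G.graph.loopless.irrefl v h
    · exact h⟩

open Classical in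
/-- The directions in `expandGraph`. -/
noncomputable def expandDir : V ⊕ Bool → V ⊕ Bool → V ⊕ Bool
  | .inl v, .inl u => .inl (G.step v u)
  | .inl v, .inr b => if v = l then .inr b else .inl (G.step v l)
  | .inr _, .inl _ => .inl l
  | .inr b, .inr c => if b = c then .inr b else .inl l

open Classical in
/-- The cyclic orders after two leaves have been attached to the leaf `l`, whose neighbor
is `u`. -/
noncomputable def expandNext (u : V) : V ⊕ Bool → V ⊕ Bool → V ⊕ Bool
  | .inl v, .inl x => if v = l then .inr false else .inl (G.next v x)
  | .inl _, .inr false => .inr true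
  | .inl _, .inr true => .inl u
  | .inr _, y => y

variable {G l}

theorem expandDir_adj (v u : V ⊕ Bool) (h : u ≠ v) :
    (expandGraph G l).Adj v (expandDir G l v u) := by
  rcases v with v | b <;> rcases u with u | c
  · exact adj_step (fun e => h (by rw [e]))
  · by_cases e : v = l
    · simp [expandDir, e, expandGraph]
    · simp only [expandDir, e, if_false]
      exact adj_step (Ne.symm e)
  · exact rfl
  · have : b ≠ c := fun e => h (by rw [e])
    simp [expandDir, this, expandGraph]

theorem expandDir_edge (v x u : V ⊕ Bool) (h : (expandGraph G l).Adj v x) :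
    expandDir G l v u = x ↔ expandDir G l x u ≠ v := by
  rcases v with v | b <;> rcases x with x | c
  · have h' : G.graph.Adj v x := h
    rcases u with u | d
    · simpa [expandDir] using step_eq_iff h' u
    · by_cases e : v = l
      · subst e
        simp [expandDir, h'.ne', step_of_adj h'.symm]
      · by_cases e' : x = l
        · subst e'
          simp [expandDir, e, step_of_adj h']
        · simpa [expandDir, e, e'] using step_eq_iff h' l
  · obtain rfl : v = l := h
    rcases u with u | d
    · simp [expandDir]
    · simp [expandDir]; grind
  · obtain rfl : x = l := h
    rcases u with u | d
    · simp [expandDir]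
    · simp [expandDir]; grind
  · exact h.elim

theorem expandDir_self (v : V ⊕ Bool) : expandDir G l v v = v := by
  rcases v with v | b
  · simp [expandDir, step_self]
  · simp [expandDir]

theorem expandDir_const (v z z' : V ⊕ Bool) (h : (expandGraph G l).Adj z z') (hz : z ≠ v)
    (hz' : z' ≠ v) : expandDir G l v z = expandDir G l v z' := by
  have key : ∀ {v z z'}, G.graph.Adj z z' → z ≠ v → z' ≠ v → G.step v z = G.step v z' := by
    intro v z z' h hz hz'
    by_contra hne
    have h1 := step_eq_of_ne hne hz
    have h2 := step_eq_of_ne (Ne.symm hne) hz'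
    rw [step_of_adj h] at h1
    rw [step_of_adj h.symm] at h2
    exact (step_eq_iff h v).1 h1.symm h2.symm
  rcases v with v | b <;> rcases z with z | c <;> rcases z' with z' | d
  · have : G.step v z = G.step v z' :=
      key h (fun e => hz (by rw [e])) (fun e => hz' (by rw [e]))
    simp [expandDir, this]
  · obtain rfl : z = l := h
    have : v ≠ z := fun e => hz (by rw [e])
    simp [expandDir, this]
  · obtain rfl : z' = l := h
    have : v ≠ z' := fun e => hz' (by rw [e])
    simp [expandDir, this]
  · exact h.elim
  · simp [expandDir]
  · have : b ≠ d := fun e => hz' (by rw [e])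
    simp [expandDir, this]
  · have : b ≠ c := fun e => hz (by rw [e])
    simp [expandDir, this]
  · exact h.elim

theorem expandGraph_isTree : (expandGraph G l).IsTree := by
  have := G.finite
  have : Nonempty (V ⊕ Bool) := ⟨Sum.inr true⟩
  exact isTree_of_directions (expandDir G l) expandDir_adj expandDir_edge expandDir_self
    expandDir_const

theorem neighborSet_expandGraph_inr (b : Bool) :
    (expandGraph G l).neighborSet (.inr b) = {.inl l} := by
  ext (x | c) <;> simp [expandGraph, SimpleGraph.neighborSet]

theorem neighborSet_expandGraph_inl {v : V} (hv : v ≠ l) :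
    (expandGraph G l).neighborSet (.inl v) = Sum.inl '' G.graph.neighborSet v := by
  ext (x | c) <;> simp [expandGraph, SimpleGraph.neighborSet, hv]

theorem neighborSet_expandGraph_self {u : V} (hl : l ∈ G.leaves) (hu : G.graph.Adj l u) :
    (expandGraph G l).neighborSet (.inl l) = {.inl u, .inr false, .inr true} := by
  ext (x | c)
  · simp only [expandGraph, SimpleGraph.neighborSet, Set.mem_ofPred_eq, Set.mem_insert_iff,
      Sum.inl.injEq, Set.mem_singleton_iff, reduceCtorEq, or_false]
    exact ⟨fun h => eq_of_adj_of_mem_leaves hl h hu, fun h => h ▸ hu⟩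
  · simp [expandGraph, SimpleGraph.neighborSet]

variable {u : V}

/-- Two new leaves are attached to a leaf. -/
noncomputable def expand (hl : l ∈ G.leaves) (hu : G.graph.Adj l u) : ThreeTree (V ⊕ Bool) :=
  have := G.finite
  ofNext (expandGraph G l) expandGraph_isTree
    (by
      rintro (v | b)
      · by_cases hv : v = l
        · subst hv
          rw [neighborSet_expandGraph_self hl hu]
          exact Or.inr (Set.ncard_eq_three.2 ⟨_, _, _, by simp, by simp, by simp, rfl⟩)
        · rw [neighborSet_expandGraph_inl hv, Set.ncard_image_of_injective _ Sum.inl_injective]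
          exact G.degree_eq v
      · rw [neighborSet_expandGraph_inr, Set.ncard_singleton]
        exact Or.inl rfl)
    (expandNext G l u)
    (by
      rintro (v | b) (x | c) h
      · by_cases hv : v = l
        · simp [expandNext, hv, expandGraph]
        · simp only [expandNext, hv, if_false]
          exact adj_next h
      · obtain rfl : v = l := h
        cases c
        · rfl
        · exact hu
      · exact h
      · exact h)
    (by
      rintro (v | b) (x | c) h
      · by_cases hv : v = l
        · subst hv
          have : x = u := eq_of_adj_of_mem_leaves hl h hu
          simp [expandNext, this]
        · have h' : G.graph.Adj v x := h
          simp only [expandNext, hv, if_false, Sum.inl.injEq]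
          by_cases hvl : v ∈ G.leaves
          · rw [next_of_mem_leaves hvl h', next_of_mem_leaves hvl h', next_of_mem_leaves hvl h']
          · exact next_next_next hvl h'
      · obtain rfl : v = l := h
        cases c <;> simp [expandNext]
      · rfl
      · rfl)
    (by
      rintro (v | b) x y hx hy
      · by_cases hv : v = l
        · subst hv
          have hx' : x ∈ (expandGraph G v).neighborSet (.inl v) := hx
          have hy' : y ∈ (expandGraph G v).neighborSet (.inl v) := hy
          rw [neighborSet_expandGraph_self hl hu] at hx' hy'
          rcases hx' with rfl | rfl | rfl <;> rcases hy' with rfl | rfl | rfl <;>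
            simp [expandNext]
        · have hx' : x ∈ (expandGraph G l).neighborSet (.inl v) := hx
          have hy' : y ∈ (expandGraph G l).neighborSet (.inl v) := hy
          rw [neighborSet_expandGraph_inl hv] at hx' hy'
          obtain ⟨x, hx, rfl⟩ := hx'
          obtain ⟨y, hy, rfl⟩ := hy'
          simp only [expandNext, hv, if_false, Sum.inl.injEq]
          by_cases hvl : v ∈ G.leaves
          · exact Or.inl (eq_of_adj_of_mem_leaves hvl hy hx)
          · exact eq_next_or hvl hx hy
      · have hx' : x ∈ (expandGraph G l).neighborSet (.inr b) := hx
        have hy' : y ∈ (expandGraph G l).neighborSet (.inr b) := hy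
        rw [neighborSet_expandGraph_inr] at hx' hy'
        exact Or.inl (hy'.trans hx'.symm))

variable {hl : l ∈ G.leaves} {hu : G.graph.Adj l u}

theorem expand_step (v x : V ⊕ Bool) : (expand hl hu).step v x = expandDir G l v x := by
  by_cases h : x = v
  · rw [h, step_self, expandDir_self]
  · have := (expand hl hu).finite
    exact (eq_treeStep (expand hl hu).isTree (expandDir G l) expandDir_adj
      (fun v x u h => (expandDir_edge v x u h).1) h).symm

theorem expand_next {v x : V ⊕ Bool} (h : (expandGraph G l).Adj v x) :
    (expand hl hu).next v x = expandNext G l u v x := by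
  exact next_of_adj (G := expand hl hu) h

theorem inr_mem_leaves_expand (b : Bool) : (.inr b : V ⊕ Bool) ∈ (expand hl hu).leaves := by
  change ((expandGraph G l).neighborSet (.inr b)).ncard = 1
  rw [neighborSet_expandGraph_inr, Set.ncard_singleton]

theorem inl_mem_leaves_expand {v : V} :
    (.inl v : V ⊕ Bool) ∈ (expand hl hu).leaves ↔ v ∈ G.leaves ∧ v ≠ l := by
  change ((expandGraph G l).neighborSet (.inl v)).ncard = 1 ↔ _
  by_cases hv : v = l
  · subst hv
    rw [neighborSet_expandGraph_self hl hu, Set.ncard_eq_three.2 ⟨_, _, _, by simp, by simp,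
      by simp, rfl⟩]
    simp
  · rw [neighborSet_expandGraph_inl hv, Set.ncard_image_of_injective _ Sum.inl_injective]
    simp [leaves, hv]

theorem isCherry_expand :
    IsCherry (expand hl hu).leaves (expand hl hu).LeafOrder (expand hl hu).step
      (.inr false) (.inr true) (.inl l) := by
  have hl' : Sum.inl l ∉ (expand hl hu).leaves := by
    rw [inl_mem_leaves_expand]
    exact fun h => h.2 rfl
  have hs : ∀ k ∈ (expand hl hu).leaves, k ≠ .inr false → k ≠ .inr true →
      Splits ((expand hl hu).step (.inl l)) (.inr false) (.inr true) k := by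
    rintro (k | b) hk h1 h2
    · simp [Splits, expand_step, expandDir]
    · cases b <;> simp_all
  refine ⟨inr_mem_leaves_expand _, inr_mem_leaves_expand _, by simp, hl', hs, ?_⟩
  intro k hk h1 h2
  rw [leafOrder_iff_of_splits hl' (inr_mem_leaves_expand _) (inr_mem_leaves_expand _) hk
    (hs k hk h1 h2), expand_step, expand_step]
  rw [expand_next (by simp [expandDir, expandGraph])]
  simp [expandDir, expandNext]

/-- The projection that shrinks the two new leaves to the old one. -/
def shrink (l : V) : V ⊕ Bool → V := Sum.elim id fun _ => l

theorem expand_step_inl {v : V} (hv : v ≠ l) (x : V ⊕ Bool) :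
    (expand hl hu).step (.inl v) x = .inl (G.step v (shrink l x)) := by
  rw [expand_step]
  rcases x with x | b <;> simp [expandDir, shrink, hv]

theorem shrink_mem_leaves {x : V ⊕ Bool} (hl : l ∈ G.leaves) (hu : G.graph.Adj l u)
    (hx : x ∈ (expand hl hu).leaves) : shrink l x ∈ G.leaves := by
  rcases x with x | b
  · exact (inl_mem_leaves_expand.1 hx).1
  · exact hl

theorem shrink_injOn {x y : V ⊕ Bool} (hl : l ∈ G.leaves) (hu : G.graph.Adj l u)
    (hx : x ∈ (expand hl hu).leaves) (hy : y ∈ (expand hl hu).leaves) (hx' : x ≠ .inr true)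
    (hy' : y ≠ .inr true) (h : shrink l x = shrink l y) : x = y := by
  rcases x with x | b <;> rcases y with y | c
  · exact congrArg Sum.inl h
  · exact absurd h (inl_mem_leaves_expand.1 hx).2
  · exact absurd h.symm (inl_mem_leaves_expand.1 hy).2
  · cases b <;> cases c <;> simp_all

theorem leafOrder_expand {i j k : V ⊕ Bool} (hi : i ∈ (expand hl hu).leaves)
    (hj : j ∈ (expand hl hu).leaves) (hk : k ∈ (expand hl hu).leaves) (hi' : i ≠ .inr true)
    (hj' : j ≠ .inr true) (hk' : k ≠ .inr true) :
    (expand hl hu).LeafOrder i j k ↔ G.LeafOrder (shrink l i) (shrink l j) (shrink l k) := by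
  have mi := shrink_mem_leaves hl hu hi
  have mj := shrink_mem_leaves hl hu hj
  have mk := shrink_mem_leaves hl hu hk
  by_cases hd : i ≠ j ∧ j ≠ k ∧ k ≠ i
  · obtain ⟨h1, h2, h3⟩ := hd
    obtain ⟨v, hv, s⟩ := G.tripodSystem.ex mi mj mk
      (fun e => h1 (shrink_injOn hl hu hi hj hi' hj' e))
      (fun e => h2 (shrink_injOn hl hu hj hk hj' hk' e))
      (fun e => h3 (shrink_injOn hl hu hk hi hk' hi' e))
    have hvl : v ≠ l := by rintro rfl; exact hv hl
    have s' : Splits ((expand hl hu).step (.inl v)) i j k := by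
      simpa [Splits, expand_step_inl hvl] using s
    have hv' : Sum.inl v ∉ (expand hl hu).leaves := fun h => hv (inl_mem_leaves_expand.1 h).1
    rw [leafOrder_iff_of_splits hv mi mj mk s, leafOrder_iff_of_splits hv' hi hj hk s',
      expand_step_inl hvl, expand_step_inl hvl]
    have hadj := adj_step (G := G) (ne_of_mem_leaves hv mi)
    rw [expand_next (show (expandGraph G l).Adj (.inl v) (.inl _) from hadj)]
    simp [expandNext, hvl]
  · refine iff_of_false (fun h => hd ?_) (fun h => hd ?_)
    · exact (expand hl hu).tripodSystem.ne_of_order hi hj hk h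
    · obtain ⟨n1, n2, n3⟩ := G.tripodSystem.ne_of_order mi mj mk h
      exact ⟨fun e => n1 (by rw [e]), fun e => n2 (by rw [e]), fun e => n3 (by rw [e])⟩

end Expand

/-- The 3-tree with a single edge. -/
def edge : ThreeTree Bool :=
  ofNext ⊤
    (isTree_of_directions (fun _ u => u) (fun v u h => by simpa using h.symm)
      (fun v x u h => by
        have : v ≠ x := by simpa using h
        cases v <;> cases x <;> cases u <;> simp_all)
      (fun _ => rfl)
      (fun v z z' h h1 h2 => by
        cases v <;> cases z <;> cases z' <;> simp_all))
    (fun v => by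
      left
      have : (⊤ : SimpleGraph Bool).neighborSet v = {!v} := by
        ext x
        cases v <;> cases x <;> simp
      rw [this, Set.ncard_singleton])
    (fun _ x => x) (fun _ _ h => h) (fun _ _ _ => rfl)
    (fun v x y h1 h2 => by
      cases v <;> cases x <;> cases y <;> simp_all)

theorem leaves_edge (v : Bool) : v ∈ edge.leaves := by
  change ((⊤ : SimpleGraph Bool).neighborSet v).ncard = 1
  have : (⊤ : SimpleGraph Bool).neighborSet v = {!v} := by
    ext x
    cases v <;> cases x <;> simp
  rw [this, Set.ncard_singleton]

/-- `e` identifies the leaves of the 3-tree `G`, their cyclic order and their separation by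
branching vertices with a tripod system. -/
structure Realizes {V ι κ : Type*} (G : ThreeTree V) (B : Set ι) (o : ι → ι → ι → Prop)
    (br : ι → ι → κ) (e : V ≃ ι) : Prop where
  leaves : ∀ v, e v ∈ B ↔ v ∈ G.leaves
  splits : ∀ v i j k, v ∉ G.leaves → i ∈ G.leaves → j ∈ G.leaves → k ∈ G.leaves →
    (Splits (G.step v) i j k ↔ Splits (br (e v)) (e i) (e j) (e k))
  order : ∀ i j k, i ∈ G.leaves → j ∈ G.leaves → k ∈ G.leaves →
    (G.LeafOrder i j k ↔ o (e i) (e j) (e k))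

/-- Every finite tripod system comes from a 3-tree, which is built by attaching one cherry after
another. -/
theorem exists_realizes {ι κ : Type*} [Finite ι] {B : Set ι} {o : ι → ι → ι → Prop}
    {br : ι → ι → κ} (h : TripodSystem B o br) (hB : 2 ≤ B.ncard) :
    ∃ (V : Type) (G : ThreeTree V) (e : V ≃ ι), G.Realizes B o br e := by
  classical
  refine TripodSystem.cherry_induction (P := fun ι B o br =>
    ∃ (V : Type) (G : ThreeTree V) (e : V ≃ ι), G.Realizes B o br e) ?_ ?_ h hB
  · intro ι B o br _ h hB
    have hmem : ∀ i, i ∈ B := fun i => h.eq_empty_of_ncard_two (Set.toFinite _) hB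
    obtain ⟨x, y, hxy, hB'⟩ := Set.ncard_eq_two.1 hB
    have hcov : ∀ i, i = x ∨ i = y := fun i => by
      have := hmem i
      rw [hB'] at this
      simpa using this
    let e : Bool ≃ ι := Equiv.ofBijective (fun b => if b then x else y) (by
      constructor
      · intro a b hab
        cases a <;> cases b <;> simp_all
      · intro i
        rcases hcov i with rfl | rfl
        · exact ⟨true, by simp⟩
        · exact ⟨false, by simp⟩)
    refine ⟨Bool, edge, e, fun v => iff_of_true (hmem _) (leaves_edge v),
      fun v _ _ _ hv => absurd (leaves_edge v) hv, fun i j k hi hj hk => ?_⟩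
    refine iff_of_false (fun ho => ?_) (fun ho => ?_)
    · obtain ⟨n1, n2, n3⟩ := edge.tripodSystem.ne_of_order hi hj hk ho
      cases i <;> cases j <;> cases k <;> simp_all
    · obtain ⟨n1, n2, n3⟩ := h.ne_of_order (hmem _) (hmem _) (hmem _) ho
      cases i <;> cases j <;> cases k <;> simp_all
  · rintro ι B o br a₁ a₂ w _ h hB hc ⟨V, G, e, hG⟩
    have hw1 : a₁ ≠ w := by rintro rfl; exact hc.notMem hc.mem₁
    have hw2 : a₂ ≠ w := by rintro rfl; exact hc.notMem hc.mem₂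
    obtain ⟨l, hel⟩ : ∃ l, e l = ⟨a₁, hc.ne, hw1⟩ := ⟨e.symm ⟨a₁, hc.ne, hw1⟩, by simp⟩
    have hl : l ∈ G.leaves := by
      rw [← hG.leaves, hel]
      exact hc.mem₁
    obtain ⟨u, hu⟩ : (G.graph.neighborSet l).Nonempty := by
      apply Set.nonempty_of_ncard_ne_zero
      rw [show (G.graph.neighborSet l).ncard = 1 from hl]
      norm_num
    have hu : G.graph.Adj l u := hu
    -- the new leaves are `a₁`, `a₂`, and the old leaf `a₁` becomes `w`
    let g : V ⊕ Bool → ι := Sum.elim (fun v => if v = l then w else (e v).1)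
      (fun b => if b then a₂ else a₁)
    have gl : g (.inl l) = w := by simp [g]
    have gv : ∀ v, v ≠ l → g (.inl v) = (e v).1 := fun v hv => by simp [g, hv]
    have g1 : g (.inr false) = a₁ := rfl
    have g2 : g (.inr true) = a₂ := rfl
    have ev1 : ∀ v, v ≠ l → (e v).1 ≠ a₁ := fun v hv e' =>
      hv (e.injective (Subtype.ext (by rw [e', hel])))
    have hg : Function.Bijective g := by
      constructor
      · have hlv : ∀ v, v ≠ l → g (.inl v) ≠ w ∧ g (.inl v) ≠ a₁ ∧ g (.inl v) ≠ a₂ :=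
          fun v hv => by rw [gv v hv]; exact ⟨(e v).2.2, ev1 v hv, (e v).2.1⟩
        rintro (v | b) (v' | b') hvv
        · by_cases h1 : v = l <;> by_cases h2 : v' = l
          · rw [h1, h2]
          · rw [h1, gl] at hvv; exact absurd hvv.symm (hlv v' h2).1
          · rw [h2, gl] at hvv; exact absurd hvv (hlv v h1).1
          · rw [gv v h1, gv v' h2] at hvv; rw [e.injective (Subtype.ext hvv)]
        · by_cases h1 : v = l
          · rw [h1, gl] at hvv
            cases b'
            · exact absurd hvv hw1.symm
            · exact absurd hvv hw2.symm
          · have := hlv v h1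
            cases b' <;> simp_all
        · by_cases h1 : v' = l
          · rw [h1, gl] at hvv
            cases b
            · exact absurd hvv hw1
            · exact absurd hvv hw2
          · have := hlv v' h1
            cases b <;> simp_all
        · have := hc.ne
          cases b <;> cases b' <;> simp_all
      · intro i
        by_cases h1 : i = a₁
        · exact ⟨.inr false, h1.symm⟩
        by_cases h2 : i = a₂
        · exact ⟨.inr true, h2.symm⟩
        by_cases h3 : i = w
        · exact ⟨.inl l, by rw [gl, h3]⟩
        refine ⟨.inl (e.symm ⟨i, h2, h3⟩), ?_⟩
        rw [gv]
        · simp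
        · intro e'
          rw [← e', Equiv.apply_symm_apply] at hel
          exact h1 (congrArg Subtype.val hel)
    let E : V ⊕ Bool ≃ ι := Equiv.ofBijective g hg
    have hE : ∀ x, E x = g x := fun _ => rfl
    have hleaves : ∀ v, E v ∈ B ↔ v ∈ (expand hl hu).leaves := by
      rintro (v | b)
      · rw [inl_mem_leaves_expand, hE]
        by_cases hv : v = l
        · subst hv; rw [gl]; simp [hc.notMem]
        · rw [gv v hv]; simpa [hv] using hG.leaves v
      · refine iff_of_true ?_ (inr_mem_leaves_expand b)
        cases b
        · exact hc.mem₁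
        · exact hc.mem₂
    have hpre : E ⁻¹' B = (expand hl hu).leaves := Set.ext hleaves
    have hT := h.comap E
    have hcT := hc.comap E (b₁ := .inr false) (b₂ := .inr true) (v := .inl l) g1 g2 gl
    rw [hpre] at hT hcT
    have hshr : ∀ i ∈ (expand hl hu).leaves, i ≠ .inr true → E i = (e (shrink l i)).1 := by
      rintro (v | b) hi hi2
      · exact gv v (inl_mem_leaves_expand.1 hi).2
      · cases b
        · change a₁ = (e l).1
          rw [hel]
        · exact absurd rfl hi2
    refine ⟨V ⊕ Bool, expand hl hu, E, hleaves, fun v i j k hv hi hj hk => ?_,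
      fun i j k hi hj hk => ?_⟩
    · refine (expand hl hu).tripodSystem.splits_iff_of_cherry hT isCherry_expand hcT ?_ hv hi hj hk
      rintro (v | b) i j k hv hvl hi hj hk hi2 hj2 hk2
      · have hv' : v ≠ l := fun e' => hvl (by rw [e'])
        have hvG : v ∉ G.leaves := fun h' => hv (inl_mem_leaves_expand.2 ⟨h', hv'⟩)
        have := hG.splits v _ _ _ hvG (shrink_mem_leaves hl hu hi) (shrink_mem_leaves hl hu hj)
          (shrink_mem_leaves hl hu hk)
        have e1 : E (.inl v) = (e v).1 := gv v hv'
        simp only [Splits, expand_step_inl hv', e1, hshr i hi hi2, hshr j hj hj2,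
          hshr k hk hk2, ne_eq, Sum.inl.injEq] at this ⊢
        exact this
      · exact absurd (inr_mem_leaves_expand b) hv
    · refine (expand hl hu).tripodSystem.order_of_cherry hT isCherry_expand hcT ?_ hi hj hk
      intro i j k hi hj hk hi2 hj2 hk2
      rw [leafOrder_expand hi hj hk hi2 hj2 hk2, hG.order _ _ _ (shrink_mem_leaves hl hu hi)
        (shrink_mem_leaves hl hu hj) (shrink_mem_leaves hl hu hk), hshr i hi hi2, hshr j hj hj2,
        hshr k hk hk2]

end ThreeTree

/-! ### Oriented areas in the plane -/

/-- Twice the oriented area of a triangle. -/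
def area (p q r : E 2) : ℝ := (q 0 - p 0) * (r 1 - p 1) - (q 1 - p 1) * (r 0 - p 0)

/-- `w` lies inside the triangle `p`, `q`, `r`: the three triangles with vertex `w` over the edges
have the same orientation. -/
def InTri (p q r w : E 2) : Prop :=
  (0 < area p q w ∧ 0 < area q r w ∧ 0 < area r p w) ∨
  (area p q w < 0 ∧ area q r w < 0 ∧ area r p w < 0)

section Area

variable (p q r s t w x : E 2)

theorem area_rot : area p q r = area q r p := by unfold area; ring

theorem area_swap : area q p r = -area p q r := by unfold area; ring

theorem area_swap' : area p r q = -area p q r := by unfold area; ring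

@[simp] theorem area_self_left : area p p q = 0 := by unfold area; ring

@[simp] theorem area_self_right : area p q q = 0 := by unfold area; ring

@[simp] theorem area_self_outer : area p q p = 0 := by unfold area; ring

theorem area_add : area p q w + area q r w + area r p w = area p q r := by unfold area; ring

/-- Barycentric coordinates are proportional to areas. -/
theorem area_bary : area q r w * area s t p + area r p w * area s t q + area p q w * area s t r =
    area p q r * area s t w := by unfold area; ring

/-- The Plücker relation for the four directions from `s`. -/
theorem area_plucker : area s p q * area s t r - area s p r * area s t q + area s q r * area s t p
    = 0 := by unfold area; ring

end Area

namespace InTri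

variable {p q r s t w : E 2}

theorem rot (h : InTri p q r w) : InTri q r p w := by
  unfold InTri at *; tauto

theorem swap (h : InTri p q r w) : InTri q p r w := by
  unfold InTri at *
  rw [area_swap p q, area_swap r p, area_swap q r]
  rcases h with ⟨h1, h2, h3⟩ | ⟨h1, h2, h3⟩
  · right; refine ⟨?_, ?_, ?_⟩ <;> linarith
  · left; refine ⟨?_, ?_, ?_⟩ <;> linarith

theorem swap' (h : InTri p q r w) : InTri p r q w := h.rot.rot.swap

theorem area_ne (h : InTri p q r w) : area p q r ≠ 0 := by
  have := area_add p q r w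
  rcases h with ⟨h1, h2, h3⟩ | ⟨h1, h2, h3⟩
  · intro e; linarith
  · intro e; linarith

theorem pos_iff (h : InTri p q r w) : 0 < area p q w ↔ 0 < area p q r := by
  have := area_add p q r w
  rcases h with ⟨h1, h2, h3⟩ | ⟨h1, h2, h3⟩
  · exact iff_of_true h1 (by linarith)
  · exact iff_of_false (by linarith) (by linarith)

theorem neg_iff (h : InTri p q r w) : area p q w < 0 ↔ area p q r < 0 := by
  have := area_add p q r w
  rcases h with ⟨h1, h2, h3⟩ | ⟨h1, h2, h3⟩
  · exact iff_of_false (by linarith) (by linarith)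
  · exact iff_of_true h1 (by linarith)

theorem pos (h : InTri p q r w) (hp : 0 ≤ area s t p) (hq : 0 ≤ area s t q)
    (hr : 0 ≤ area s t r) (hs : 0 < area s t p ∨ 0 < area s t q ∨ 0 < area s t r) :
    0 < area s t w := by
  have e := area_bary p q r s t w
  have e2 := area_add p q r w
  rcases h with ⟨h1, h2, h3⟩ | ⟨h1, h2, h3⟩
  · have h4 : 0 < area p q r := by linarith
    have a1 := mul_nonneg h2.le hp
    have a2 := mul_nonneg h3.le hq
    have a3 := mul_nonneg h1.le hr
    have : 0 < area p q r * area s t w := by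
      rw [← e]
      rcases hs with hs | hs | hs
      · have := mul_pos h2 hs; linarith
      · have := mul_pos h3 hs; linarith
      · have := mul_pos h1 hs; linarith
    exact (pos_iff_pos_of_mul_pos this).1 h4
  · have h4 : area p q r < 0 := by linarith
    have a1 := mul_nonpos_of_nonpos_of_nonneg h2.le hp
    have a2 := mul_nonpos_of_nonpos_of_nonneg h3.le hq
    have a3 := mul_nonpos_of_nonpos_of_nonneg h1.le hr
    have : area p q r * area s t w < 0 := by
      rw [← e]
      rcases hs with hs | hs | hs
      · have := mul_neg_of_neg_of_pos h2 hs; linarith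
      · have := mul_neg_of_neg_of_pos h3 hs; linarith
      · have := mul_neg_of_neg_of_pos h1 hs; linarith
    exact pos_of_mul_neg_right this h4.le

theorem neg (h : InTri p q r w) (hp : area s t p ≤ 0) (hq : area s t q ≤ 0)
    (hr : area s t r ≤ 0) (hs : area s t p < 0 ∨ area s t q < 0 ∨ area s t r < 0) :
    area s t w < 0 := by
  have : 0 < area t s w := by
    refine h.pos ?_ ?_ ?_ ?_ <;> simp only [area_swap s t] <;> simpa
  rw [area_swap] at this
  linarith

end InTri

/-- The points of `B` are called black, the other ones white. Every black point is a strict vertex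
of the convex hull of all points (the line through `pt a` and `q` supports it), no line through two
black points contains a third point, and every triangle of black points contains a white point. -/
structure IsPreTripodDiagram {ι : Type*} (pt : ι → E 2) (B : Set ι) : Prop where
  exposed : ∀ a ∈ B, ∃ q, ∀ x, x ≠ a → 0 < area (pt a) q (pt x)
  nz : ∀ {i j x}, i ∈ B → j ∈ B → i ≠ j → x ≠ i → x ≠ j → area (pt i) (pt j) (pt x) ≠ 0
  ex : ∀ {i j k}, i ∈ B → j ∈ B → k ∈ B → i ≠ j → j ≠ k → k ≠ i →
    ∃ w, w ∉ B ∧ InTri (pt i) (pt j) (pt k) (pt w)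

/-- The affine structure shared by `T`-diagrams and the diagrams constructed from 3-trees: every
triangle of black points contains exactly one white point, and every white point lies in such a
triangle. -/
structure IsTripodDiagram {ι : Type*} (pt : ι → E 2) (B : Set ι) : Prop extends
    IsPreTripodDiagram pt B where
  un : ∀ {w w' i j k}, w ∉ B → w' ∉ B → i ∈ B → j ∈ B → k ∈ B →
    InTri (pt i) (pt j) (pt k) (pt w) → InTri (pt i) (pt j) (pt k) (pt w') → w = w'
  surj : ∀ {w}, w ∉ B → ∃ i ∈ B, ∃ j ∈ B, ∃ k ∈ B, InTri (pt i) (pt j) (pt k) (pt w)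

theorem not_inTri_of_exposed {a q p₁ p₂ p₃ : E 2} (h₁ : 0 < area a q p₁) (h₂ : 0 < area a q p₂)
    (h₃ : 0 < area a q p₃) : ¬ InTri p₁ p₂ p₃ a := by
  intro h
  have := h.pos h₁.le h₂.le h₃.le (Or.inl h₁)
  simp at this

theorem InTri.ne {ι : Type*} {pt : ι → E 2} {i j k : ι} {w : E 2}
    (h : InTri (pt i) (pt j) (pt k) w) : i ≠ j ∧ j ≠ k ∧ k ≠ i := by
  have := h.area_ne
  refine ⟨?_, ?_, ?_⟩ <;> rintro rfl <;> simp at this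

/-! ### Sorting the leaves by the triangles that contain a point -/

/-- A symmetric ternary relation in which a member of a related triple can always be replaced by
any given element in exactly one position, and such replacements at two positions are compatible,
is the relation of lying in different classes of a partition into three classes. -/
theorem splits_iff_of_exchange {ι : Type*} {B : Set ι} {M : ι → ι → ι → Prop}
    (rot : ∀ {i j k}, M i j k → M j k i) (swap : ∀ {i j k}, M i j k → M j i k)
    (four : ∀ {i j k l}, i ∈ B → j ∈ B → k ∈ B → l ∈ B → M i j k →
      (M l j k ∧ ¬ M i l k ∧ ¬ M i j l) ∨ (¬ M l j k ∧ M i l k ∧ ¬ M i j l) ∨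
      (¬ M l j k ∧ ¬ M i l k ∧ M i j l))
    (coh : ∀ {i j k l p}, i ∈ B → j ∈ B → k ∈ B → l ∈ B → p ∈ B → M i j k → M i j l → M p j k →
      M p j l)
    {i j k : ι} (hi : i ∈ B) (hj : j ∈ B) (hk : k ∈ B) (h : M i j k) {c : ι → ι}
    (hc : ∀ l ∈ B, (M l j k ∧ c l = i) ∨ (M i l k ∧ c l = j) ∨ (M i j l ∧ c l = k))
    (hd : i ≠ j ∧ j ≠ k ∧ k ≠ i)
    {p q r : ι} (hp : p ∈ B) (hq : q ∈ B) (hr : r ∈ B) : Splits c p q r ↔ M p q r := by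
  have key : ∀ {i j k p q r}, i ∈ B → j ∈ B → k ∈ B → p ∈ B → q ∈ B → r ∈ B → M i j k → M p j k →
      M q j k → ¬ M p q r := by
    intro i j k p q r hi hj hk hp hq hr h h1 h2 h3
    have n1 : ¬ M p q k := fun x => by
      rcases four hp hj hk hq h1 with a | a | a
      · exact a.2.1 x
      · exact a.1 h2
      · exact a.1 h2
    rcases four hi hj hk hr h with a | a | a
    · -- all three in the class of `i`
      have n2 : ∀ {p q}, p ∈ B → q ∈ B → M p j k → M q j k → ¬ M p j q := by
        intro p q hp hq h1 h2 x
        rcases four hp hj hk hq h1 with a | a | a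
        · exact a.2.2 x
        · exact a.1 h2
        · exact a.1 h2
      rcases four hp hq hr hj h3 with b | b | b
      · exact n2 hr hq a.1 h2 (rot (rot b.1))
      · exact n2 hp hr h1 a.1 b.2.1
      · exact n2 hq hp h2 h1 (rot b.2.2)
    · -- `M i r k`
      have e : ∀ {p}, p ∈ B → M p j k → M p r k := by
        intro p hp h1
        have := coh hi hk hj hr hp (swap (rot (rot h))) (swap (rot (rot a.2.1)))
          (swap (rot (rot h1)))
        exact swap (rot (rot this))
      rcases four hp hr hk hq (e hp h1) with b | b | b
      · exact b.2.2 (rot (swap h3))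
      · exact b.1 (e hq h2)
      · exact b.1 (e hq h2)
    · have e1 := coh hi hj hk hr hp h a.2.2 h1
      have e2 := coh hi hj hk hr hq h a.2.2 h2
      rcases four hp hj hr hq e1 with b | b | b
      · exact b.2.1 h3
      · exact b.1 e2
      · exact b.1 e2
  have key2 : ∀ {p q r}, p ∈ B → q ∈ B → r ∈ B → c p = c q → ¬ M p q r := by
    intro p q r hp hq hr e h3
    rcases hc p hp with ⟨a, a'⟩ | ⟨a, a'⟩ | ⟨a, a'⟩ <;>
      rcases hc q hq with ⟨b, b'⟩ | ⟨b, b'⟩ | ⟨b, b'⟩ <;> rw [a', b'] at e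
    · exact key hi hj hk hp hq hr h a b h3
    · exact hd.1 e
    · exact hd.2.2 e.symm
    · exact hd.1 e.symm
    · exact key hj hi hk hp hq hr (swap h) (swap a) (swap b) h3
    · exact hd.2.1 e
    · exact hd.2.2 e
    · exact hd.2.1 e.symm
    · exact key hk hi hj hp hq hr (rot (rot h)) (rot (rot a)) (rot (rot b)) h3
  have key3 : ∀ {p q r}, p ∈ B → q ∈ B → r ∈ B → M p j k → M i q k → M i j r → M p q r := by
    intro p q r hp hq hr a b d
    -- replace one position after the other
    have e1 : M p j r := coh hi hj hk hr hp h d a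
    have e2 : M i q r := by
      have := coh hj hi hk hr hq (swap h) (swap d) (swap b)
      exact swap this
    have := coh hi hr hj hq hp (swap (rot (rot d))) (swap (rot (rot e2))) (swap (rot (rot e1)))
    exact swap (rot (rot this))
  constructor
  · intro s
    rcases hc p hp with ⟨a, a'⟩ | ⟨a, a'⟩ | ⟨a, a'⟩ <;>
      rcases hc q hq with ⟨b, b'⟩ | ⟨b, b'⟩ | ⟨b, b'⟩ <;>
      rcases hc r hr with ⟨d, d'⟩ | ⟨d, d'⟩ | ⟨d, d'⟩ <;> unfold Splits at s <;>
      rw [a', b', d'] at s <;> try exact absurd rfl s.1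
    all_goals try exact absurd rfl s.2.1
    all_goals try exact absurd rfl s.2.2
    · exact key3 hp hq hr a b d
    · exact rot (swap (key3 hp hr hq a d b))
    · exact swap (key3 hq hp hr b a d)
    · exact rot (key3 hr hp hq d a b)
    · exact rot (rot (key3 hq hr hp b d a))
    · exact rot (rot (swap (key3 hr hq hp d b a)))
  · intro m
    exact ⟨fun e => key2 hp hq hr e m, fun e => key2 hq hr hp e (rot m),
      fun e => key2 hr hp hq e (rot (rot m))⟩

/-! ### Tripod diagrams as tripod systems -/

/-- A point inside two triangles `ijk`, `ijl` of a pentagon, and so on around the pentagon, cannot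
coexist with a point in the five complementary triangles: the former would be in the central
pentagon and the latter in all five ears, or vice versa. -/
theorem no_pentagram_of_pos {i j k l p w v : E 2} (w1 : InTri i j k w) (w2 : InTri p l k w)
    (v1 : InTri i k l v) (v2 : InTri i k p v) (v3 : InTri l j k v) (v4 : InTri l j p v)
    (nj : ¬ InTri i k l j) (np : ¬ InTri i k l p) (zj : area l i j ≠ 0)
    (h : 0 < area i k l) : False := by
  have a1 := v1.pos_iff.2 h
  have a2 := v2.pos_iff.1 a1
  have a3 : 0 < area i k w := w2.pos a2.le h.le (by simp) (Or.inl a2)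
  have a4 : 0 < area i k j := by
    have := w1.rot.rot.neg_iff.1 (by rw [area_swap]; linarith)
    rw [area_swap] at this
    linarith
  have h' : 0 < area k l i := by rwa [← area_rot i k l]
  have b1 := v1.rot.pos_iff.2 h'
  have b2 := v3.rot.rot.pos_iff.1 b1
  have b3 : 0 < area k l w := w1.pos h'.le b2.le (by simp) (Or.inl h')
  have b4 := w2.rot.swap.pos_iff.1 b3
  have c1 : area l i j < 0 := lt_of_le_of_ne (not_lt.1 fun c => nj (Or.inl ⟨a4, b2, c⟩)) zj
  have c2 : area l i p ≤ 0 := not_lt.1 fun c => np (Or.inl ⟨a2, b4, c⟩)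
  have c3 : area l i v < 0 := v4.neg (by simp) c1.le c2 (Or.inr (Or.inl c1))
  have c4 := v1.rot.rot.pos_iff.2 (by rwa [← area_rot k l i])
  linarith

/-- Reflection in a line. -/
noncomputable def reflect (x : E 2) : E 2 := !₂[x 0, -x 1]

theorem area_reflect (p q r : E 2) : area (reflect p) (reflect q) (reflect r) = -area p q r := by
  simp [area, reflect]; ring

theorem inTri_reflect {p q r w : E 2} :
    InTri (reflect p) (reflect q) (reflect r) (reflect w) ↔ InTri p q r w := by
  simp only [InTri, area_reflect, Left.neg_pos_iff, Left.neg_neg_iff]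
  exact or_comm

theorem no_pentagram {i j k l p w v : E 2} (w1 : InTri i j k w) (w2 : InTri p l k w)
    (v1 : InTri i k l v) (v2 : InTri i k p v) (v3 : InTri l j k v) (v4 : InTri l j p v)
    (nj : ¬ InTri i k l j) (np : ¬ InTri i k l p) (zj : area l i j ≠ 0) : False := by
  rcases lt_or_gt_of_ne v1.area_ne with h | h
  · refine no_pentagram_of_pos (i := reflect i) (j := reflect j) (k := reflect k) (l := reflect l)
      (p := reflect p) (w := reflect w) (v := reflect v) (inTri_reflect.2 w1) (inTri_reflect.2 w2)
      (inTri_reflect.2 v1) (inTri_reflect.2 v2) (inTri_reflect.2 v3) (inTri_reflect.2 v4)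
      (fun x => nj (inTri_reflect.1 x)) (fun x => np (inTri_reflect.1 x)) ?_ ?_
    · rw [area_reflect]; exact neg_ne_zero.2 zj
    · rw [area_reflect]; linarith
  · exact no_pentagram_of_pos w1 w2 v1 v2 v3 v4 nj np zj h

/-- If `w` lies inside a triangle and in general position with respect to a fourth point, exactly
one vertex of the triangle can be replaced by the fourth point. -/
theorem inTri_exchange {i j k l w : E 2} (h : InTri i j k w) (hi : area l w i ≠ 0)
    (hj : area l w j ≠ 0) (hk : area l w k ≠ 0) :
    (InTri l j k w ∧ ¬ InTri i l k w ∧ ¬ InTri i j l w) ∨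
    (¬ InTri l j k w ∧ InTri i l k w ∧ ¬ InTri i j l w) ∨
    (¬ InTri l j k w ∧ ¬ InTri i l k w ∧ InTri i j l w) := by
  have e := area_bary i j k l w w
  rw [area_self_right, mul_zero] at e
  have e1 : area l j w = -area l w j := area_swap' _ _ _
  have e2 : area k l w = area l w k := area_rot _ _ _
  have e3 : area i l w = area l w i := area_rot _ _ _
  have e4 : area l k w = -area l w k := area_swap' _ _ _
  have e5 : area j l w = area l w j := area_rot _ _ _
  have e6 : area l i w = -area l w i := area_swap' _ _ _
  simp only [InTri, e1, e2, e3, e4, e5, e6] at h ⊢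
  rcases h with ⟨h1, h2, h3⟩ | ⟨h1, h2, h3⟩ <;> rcases lt_or_gt_of_ne hi with yi | yi <;>
    rcases lt_or_gt_of_ne hj with yj | yj <;> rcases lt_or_gt_of_ne hk with yk | yk
  all_goals first
    | (exfalso
       have := mul_pos_of_neg_of_neg h2 yi
       have := mul_pos_of_neg_of_neg h3 yj
       have := mul_pos_of_neg_of_neg h1 yk
       linarith)
    | (exfalso
       have := mul_pos h2 yi
       have := mul_pos h3 yj
       have := mul_pos h1 yk
       linarith)
    | (exfalso
       have := mul_neg_of_pos_of_neg h2 yi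
       have := mul_neg_of_pos_of_neg h3 yj
       have := mul_neg_of_pos_of_neg h1 yk
       linarith)
    | (exfalso
       have := mul_neg_of_neg_of_pos h2 yi
       have := mul_neg_of_neg_of_pos h3 yj
       have := mul_neg_of_neg_of_pos h1 yk
       linarith)
    | skip
  all_goals
    simp only [Left.neg_pos_iff, Left.neg_neg_iff, h1, h2, h3, yi, yj, yk, h1.not_gt, h2.not_gt,
      h3.not_gt, yi.not_gt, yj.not_gt, yk.not_gt, and_true, and_false, or_true, or_false,
      not_true_eq_false, not_false_eq_true, and_self]

namespace IsTripodDiagram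

variable {ι : Type*} {pt : ι → E 2} {B : Set ι} {a i j k l p q r x w v w' : ι}

theorem ne_white (hi : i ∈ B) (hw : w ∉ B) : w ≠ i := by rintro rfl; exact hw hi

theorem not_inTri (h : IsTripodDiagram pt B) (ha : a ∈ B) (hi : i ≠ a) (hj : j ≠ a) (hk : k ≠ a) :
    ¬ InTri (pt i) (pt j) (pt k) (pt a) := by
  obtain ⟨q, hq⟩ := h.exposed a ha
  exact not_inTri_of_exposed (hq i hi) (hq j hj) (hq k hk)

/-- A black point `l` can replace exactly one vertex of a black triangle that contains `w`. -/
theorem four (h : IsTripodDiagram pt B) (hw : w ∉ B) (hi : i ∈ B) (hj : j ∈ B) (hk : k ∈ B)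
    (hl : l ∈ B) (hM : InTri (pt i) (pt j) (pt k) (pt w)) :
    (InTri (pt l) (pt j) (pt k) (pt w) ∧ ¬ InTri (pt i) (pt l) (pt k) (pt w) ∧
      ¬ InTri (pt i) (pt j) (pt l) (pt w)) ∨
    (¬ InTri (pt l) (pt j) (pt k) (pt w) ∧ InTri (pt i) (pt l) (pt k) (pt w) ∧
      ¬ InTri (pt i) (pt j) (pt l) (pt w)) ∨
    (¬ InTri (pt l) (pt j) (pt k) (pt w) ∧ ¬ InTri (pt i) (pt l) (pt k) (pt w) ∧
      InTri (pt i) (pt j) (pt l) (pt w)) := by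
  by_cases h1 : l = i
  · subst h1
    exact Or.inl ⟨hM, fun x => x.ne.1 rfl, fun x => x.ne.2.2 rfl⟩
  by_cases h2 : l = j
  · subst h2
    exact Or.inr (Or.inl ⟨fun x => x.ne.1 rfl, hM, fun x => x.ne.2.1 rfl⟩)
  by_cases h3 : l = k
  · subst h3
    exact Or.inr (Or.inr ⟨fun x => x.ne.2.2 rfl, fun x => x.ne.2.1 rfl, hM⟩)
  have key : ∀ {i}, i ∈ B → l ≠ i → area (pt l) (pt w) (pt i) ≠ 0 := by
    intro i hi hne
    rw [← area_rot]
    exact h.nz hi hl hne.symm (ne_white hi hw) (ne_white hl hw)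
  exact inTri_exchange hM (key hi h1) (key hj h2) (key hk h3)

/-- If `l` can replace `k`, and `p` can replace `i`, then both can be replaced at the same time.
Otherwise, the triangles that contain `w` and those that contain the white point `v` of the triangle
`ijp` form two complementary pentagrams. -/
theorem coherent (h : IsTripodDiagram pt B) (hw : w ∉ B) (hi : i ∈ B) (hj : j ∈ B) (hk : k ∈ B)
    (hl : l ∈ B) (hp : p ∈ B) (h1 : InTri (pt i) (pt j) (pt k) (pt w))
    (h2 : InTri (pt i) (pt j) (pt l) (pt w)) (h3 : InTri (pt p) (pt j) (pt k) (pt w)) :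
    InTri (pt p) (pt j) (pt l) (pt w) := by
  by_contra hcon
  have n1 := h1.ne
  have n2 := h2.ne
  have n3 := h3.ne
  have npi : p ≠ i := by rintro rfl; exact hcon h2
  have nkl : k ≠ l := by rintro rfl; exact hcon h3
  have m1 : ¬ InTri (pt i) (pt j) (pt p) (pt w) := by
    rcases h.four hw hi hj hk hp h1 with b | b | b
    exacts [b.2.2, absurd h3 b.1, absurd h3 b.1]
  have npl : p ≠ l := by rintro rfl; exact m1 h2
  have m2 : ¬ InTri (pt l) (pt j) (pt k) (pt w) := by
    rcases h.four hw hi hj hk hl h1 with b | b | b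
    exacts [absurd h2 b.2.2, absurd h2 b.2.2, b.1]
  have h4 : InTri (pt i) (pt p) (pt l) (pt w) := by
    rcases h.four hw hi hj hl hp h2 with b | b | b
    exacts [absurd b.1 hcon, b.2.1, absurd b.2.2 m1]
  have h5 : InTri (pt p) (pt l) (pt k) (pt w) := by
    rcases h.four hw hp hj hk hl h3 with b | b | b
    exacts [absurd b.1 m2, b.2.1, absurd b.2.2 hcon]
  obtain ⟨v, hv, v1⟩ := h.ex hi hj hp n1.1 n3.1.symm npi
  have hvw : v ≠ w := by rintro rfl; exact m1 v1
  have un : ∀ {x y z}, x ∈ B → y ∈ B → z ∈ B → InTri (pt x) (pt y) (pt z) (pt w) →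
      ¬ InTri (pt x) (pt y) (pt z) (pt v) := fun hx hy hz a b => hvw (h.un hv hw hx hy hz b a)
  have v2 : InTri (pt i) (pt k) (pt p) (pt v) := by
    rcases h.four hv hi hj hp hk v1 with b | b | b
    exacts [absurd b.1 (un hk hj hp h3.rot.swap), b.2.1, absurd b.2.2 (un hi hj hk h1)]
  have v3 : InTri (pt l) (pt j) (pt p) (pt v) := by
    rcases h.four hv hi hj hp hl v1 with b | b | b
    exacts [b.1, absurd b.2.1 (un hi hl hp h4.swap'), absurd b.2.2 (un hi hj hl h2)]
  have v4 : InTri (pt i) (pt k) (pt l) (pt v) := by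
    rcases h.four hv hi hk hp hl v2 with b | b | b
    exacts [absurd b.1 (un hl hk hp h5.rot), absurd b.2.1 (un hi hl hp h4.swap'), b.2.2]
  have v5 : InTri (pt l) (pt j) (pt k) (pt v) := by
    rcases h.four hv hl hj hp hk v3 with b | b | b
    exacts [absurd b.1 (un hk hj hp h3.rot.swap), absurd b.2.1 (un hl hk hp h5.rot), b.2.2]
  exact no_pentagram h1 h5 v4 v2 v5 v3
    (h.not_inTri hj n1.1 n1.2.1.symm n2.2.1.symm)
    (h.not_inTri hp npi.symm n3.2.2 npl.symm)
    (h.nz hl hi n2.2.2 n2.2.1 n1.1.symm)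

/-- The classes into which the white points of a tripod diagram sort the black points. -/
theorem exists_tripodSystem (h : IsTripodDiagram pt B) : ∃ br : ι → ι → ι,
    TripodSystem B (fun i j k => 0 < area (pt i) (pt j) (pt k)) br ∧
    ∀ w i j k, w ∉ B → i ∈ B → j ∈ B → k ∈ B →
      (Splits (br w) i j k ↔ InTri (pt i) (pt j) (pt k) (pt w)) := by
  classical
  have hex : ∀ w, ∃ c : ι → ι, w ∉ B → (∃ i j k, ∀ l ∈ B, c l = i ∨ c l = j ∨ c l = k) ∧
      ∀ i j k, i ∈ B → j ∈ B → k ∈ B →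
        (Splits c i j k ↔ InTri (pt i) (pt j) (pt k) (pt w)) := by
    intro w
    by_cases hw : w ∈ B
    · exact ⟨id, fun hw' => absurd hw hw'⟩
    obtain ⟨i, hi, j, hj, k, hk, hM⟩ := h.surj hw
    let c : ι → ι := fun l => if InTri (pt l) (pt j) (pt k) (pt w) then i else
      if InTri (pt i) (pt l) (pt k) (pt w) then j else k
    have hc : ∀ l ∈ B, (InTri (pt l) (pt j) (pt k) (pt w) ∧ c l = i) ∨
        (InTri (pt i) (pt l) (pt k) (pt w) ∧ c l = j) ∨
        (InTri (pt i) (pt j) (pt l) (pt w) ∧ c l = k) := by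
      intro l hl
      rcases h.four hw hi hj hk hl hM with ⟨a, b, d⟩ | ⟨a, b, d⟩ | ⟨a, b, d⟩ <;> simp [c, a, b, d]
    refine ⟨c, fun _ => ⟨⟨i, j, k, fun l hl => ?_⟩, fun p q r hp hq hr => ?_⟩⟩
    · rcases hc l hl with e | e | e
      · exact Or.inl e.2
      · exact Or.inr (Or.inl e.2)
      · exact Or.inr (Or.inr e.2)
    · exact splits_iff_of_exchange (M := fun i j k => InTri (pt i) (pt j) (pt k) (pt w))
        InTri.rot InTri.swap (fun hi hj hk hl => h.four hw hi hj hk hl)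
        (fun hi hj hk hl hp => h.coherent hw hi hj hk hl hp) hi hj hk hM hc hM.ne hp hq hr
  choose br hbr using hex
  have hs : ∀ {w i j k}, w ∉ B → i ∈ B → j ∈ B → k ∈ B →
      (Splits (br w) i j k ↔ InTri (pt i) (pt j) (pt k) (pt w)) :=
    fun hw hi hj hk => (hbr _ hw).2 _ _ _ hi hj hk
  refine ⟨br, ⟨?_, ?_, ?_, ?_, ?_, ?_, ?_, ?_⟩, fun w i j k hw hi hj hk => hs hw hi hj hk⟩
  · intro i j k _ _ _ ho
    rwa [← area_rot]
  · intro i j k _ _ _ ho ho'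
    have e' : area (pt i) (pt j) (pt k) = - area (pt j) (pt i) (pt k) := area_swap _ _ _
    have e3 : area (pt k) (pt j) (pt i) = area (pt j) (pt i) (pt k) := area_rot _ _ _
    linarith
  · intro i j k hi hj hk h1 h2 h3
    have e' : area (pt i) (pt j) (pt k) = - area (pt j) (pt i) (pt k) := area_swap _ _ _
    have e3 : area (pt k) (pt j) (pt i) = area (pt j) (pt i) (pt k) := area_rot _ _ _
    rcases lt_or_gt_of_ne (h.nz hi hj h1 h3 h2.symm) with e | e
    · right; linarith
    · left; exact e
  · intro w i j k l hw hi hj hk hl s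
    obtain ⟨i', j', k', hc⟩ := (hbr w hw).1
    have c1 := hc i hi
    have c2 := hc j hj
    have c3 := hc k hk
    have c4 := hc l hl
    unfold Splits at s
    grind
  · intro i j k hi hj hk h1 h2 h3
    obtain ⟨w, hw, hM⟩ := h.ex hi hj hk h1 h2 h3
    exact ⟨w, hw, (hs hw hi hj hk).2 hM⟩
  · intro w w' i j k hw hw' hi hj hk s s'
    exact h.un hw hw' hi hj hk ((hs hw hi hj hk).1 s) ((hs hw' hi hj hk).1 s')
  · intro w i j k l hw hi hj hk hl s e ho
    have s' := s.congr e
    exact ((hs hw hi hj hl).1 s').pos_iff.1 (((hs hw hi hj hk).1 s).pos_iff.2 ho)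
  · intro w hw
    obtain ⟨i, hi, j, hj, k, hk, hM⟩ := h.surj hw
    exact ⟨i, hi, j, hj, k, hk, (hs hw hi hj hk).2 hM⟩

end IsTripodDiagram

/-! ### Cofaces of a planar diagram -/

/-- `T` is the support of an affine dependency of the points that is positive at the black points
of `T` and negative at the white ones. By Gale duality, these are the complements of the vertex sets
of faces. -/
def IsCoface {ι : Type*} [Fintype ι] (pt : ι → E 2) (B T : Set ι) : Prop :=
  ∃ μ : ι → ℝ, (∀ i ∈ T, i ∈ B → 0 < μ i) ∧ (∀ i ∈ T, i ∉ B → μ i < 0) ∧ (∀ i ∉ T, μ i = 0) ∧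
    ∑ i, μ i = 0 ∧ ∑ i, μ i • pt i = 0

section Coface

variable {ι : Type*} [Fintype ι] {pt : ι → E 2} {B : Set ι}

/-- If every element of `T` lies in a coface contained in `T`, then `T` is a coface. -/
theorem IsCoface.of_forall_exists {T : Set ι} (h : ∀ i ∈ T, ∃ S ⊆ T, i ∈ S ∧ IsCoface pt B S) :
    IsCoface pt B T := by
  classical
  choose! S hST hiS hS using h
  choose! μ h1 h2 h3 h4 h5 using hS
  have nonneg : ∀ i ∈ T, ∀ j ∈ B, 0 ≤ μ i j := fun i hi j hj => by
    by_cases hj' : j ∈ S i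
    · exact (h1 i hi j hj' hj).le
    · exact (h3 i hi j hj').ge
  have nonpos : ∀ i ∈ T, ∀ j ∉ B, μ i j ≤ 0 := fun i hi j hj => by
    by_cases hj' : j ∈ S i
    · exact (h2 i hi j hj' hj).le
    · exact (h3 i hi j hj').le
  refine ⟨fun j => ∑ i ∈ Finset.univ.filter (· ∈ T), μ i j, ?_, ?_, ?_, ?_, ?_⟩
  · intro j hj hjB
    exact Finset.sum_pos' (fun i hi => nonneg i (by simpa using hi) j hjB)
      ⟨j, by simpa using hj, h1 j hj j (hiS j hj) hjB⟩
  · intro j hj hjB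
    have := Finset.sum_pos' (s := Finset.univ.filter (· ∈ T)) (f := fun i => -μ i j)
      (fun i hi => neg_nonneg.2 (nonpos i (by simpa using hi) j hjB))
      ⟨j, by simpa using hj, neg_pos.2 (h2 j hj j (hiS j hj) hjB)⟩
    rw [Finset.sum_neg_distrib] at this
    linarith
  · intro j hj
    refine Finset.sum_eq_zero fun i hi => ?_
    have hi : i ∈ T := by simpa using hi
    exact h3 i hi j fun hj' => hj (hST i hi hj')
  · rw [Finset.sum_comm]
    exact Finset.sum_eq_zero fun i hi => h4 i (by simpa using hi)
  · simp_rw [Finset.sum_smul]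
    rw [Finset.sum_comm]
    exact Finset.sum_eq_zero fun i hi => h5 i (by simpa using hi)

theorem sum_mul_area {μ : ι → ℝ} (h : ∑ i, μ i = 0) (h' : ∑ i, μ i • pt i = 0) (s t : E 2) :
    ∑ i, μ i * area s t (pt i) = 0 := by
  have h0 : ∑ i, μ i * pt i 0 = 0 := by
    have := congrArg (fun x : E 2 => x 0) h'
    simpa using this
  have h1 : ∑ i, μ i * pt i 1 = 0 := by
    have := congrArg (fun x : E 2 => x 1) h'
    simpa using this
  have : ∀ i, μ i * area s t (pt i) = (t 0 - s 0) * (μ i * pt i 1) - (t 1 - s 1) * (μ i * pt i 0)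
      + ((t 1 - s 1) * s 0 - (t 0 - s 0) * s 1) * μ i := by
    intro i; unfold area; ring
  simp_rw [this]
  rw [Finset.sum_add_distrib, Finset.sum_sub_distrib, ← Finset.mul_sum, ← Finset.mul_sum,
    ← Finset.mul_sum, h, h0, h1]
  ring

open Classical in
/-- The unique affine dependency of four points. -/
theorem isCoface_four {i j k l : ι} {c : ℝ} (hij : i ≠ j) (hik : i ≠ k) (hil : i ≠ l) (hjk : j ≠ k)
    (hjl : j ≠ l) (hkl : k ≠ l)
    (hi : if i ∈ B then 0 < c * area (pt j) (pt k) (pt l) else c * area (pt j) (pt k) (pt l) < 0)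
    (hj : if j ∈ B then 0 < -(c * area (pt i) (pt k) (pt l)) else
      -(c * area (pt i) (pt k) (pt l)) < 0)
    (hk : if k ∈ B then 0 < c * area (pt i) (pt j) (pt l) else c * area (pt i) (pt j) (pt l) < 0)
    (hl : if l ∈ B then 0 < -(c * area (pt i) (pt j) (pt k)) else
      -(c * area (pt i) (pt j) (pt k)) < 0) : IsCoface pt B {i, j, k, l} := by
  set α := c * area (pt j) (pt k) (pt l) with hα
  set β := -(c * area (pt i) (pt k) (pt l)) with hβ
  set γ := c * area (pt i) (pt j) (pt l) with hγ
  set δ := -(c * area (pt i) (pt j) (pt k)) with hδ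
  refine ⟨fun x => (if x = i then α else 0) + (if x = j then β else 0) + (if x = k then γ else 0) +
    (if x = l then δ else 0), ?_, ?_, ?_, ?_, ?_⟩
  · rintro x (rfl | rfl | rfl | rfl) hx
    · simpa [hij, hik, hil, hx] using hi
    · simpa [hij.symm, hjk, hjl, hx] using hj
    · simpa [hik.symm, hjk.symm, hkl, hx] using hk
    · simpa [hil.symm, hjl.symm, hkl.symm, hx] using hl
  · rintro x (rfl | rfl | rfl | rfl) hx
    · simpa [hij, hik, hil, hx] using hi
    · simpa [hij.symm, hjk, hjl, hx] using hj
    · simpa [hik.symm, hjk.symm, hkl, hx] using hk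
    · simpa [hil.symm, hjl.symm, hkl.symm, hx] using hl
  · intro x hx
    simp only [Set.mem_insert_iff, Set.mem_singleton_iff, not_or] at hx
    simp [hx.1, hx.2.1, hx.2.2.1, hx.2.2.2]
  · simp only [Finset.sum_add_distrib, Finset.sum_ite_eq', Finset.mem_univ, if_true]
    rw [hα, hβ, hγ, hδ]
    unfold area
    ring
  · simp only [add_smul, ite_smul, zero_smul, Finset.sum_add_distrib, Finset.sum_ite_eq',
      Finset.mem_univ, if_true]
    rw [hα, hβ, hγ, hδ]
    ext x
    fin_cases x <;> simp [area] <;> ring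

theorem isCoface_of_inTri {i j k w : ι} (hi : i ∈ B) (hj : j ∈ B) (hk : k ∈ B) (hw : w ∉ B)
    (h : InTri (pt i) (pt j) (pt k) (pt w)) : IsCoface pt B {i, j, k, w} := by
  obtain ⟨n1, n2, n3⟩ := h.ne
  have e1 : area (pt k) (pt i) (pt w) = -area (pt i) (pt k) (pt w) := area_swap _ _ _
  have e2 := area_add (pt i) (pt j) (pt k) (pt w)
  rcases h with ⟨h1, h2, h3⟩ | ⟨h1, h2, h3⟩
  · refine isCoface_four (c := 1) n1 n3.symm ?_ n2 ?_ ?_ ?_ ?_ ?_ ?_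
    iterate 3 exact fun e => hw (by rwa [← e])
    all_goals simp only [hi, hj, hk, hw, if_true, if_false]
    all_goals linarith
  · refine isCoface_four (c := -1) n1 n3.symm ?_ n2 ?_ ?_ ?_ ?_ ?_ ?_
    iterate 3 exact fun e => hw (by rwa [← e])
    all_goals simp only [hi, hj, hk, hw, if_true, if_false]
    all_goals linarith

end Coface

namespace IsPreTripodDiagram

variable {ι : Type*} {pt : ι → E 2} {B : Set ι} {a i j : ι}

/-- Seen from a black point, all other points are linearly ordered by their directions. -/
theorem exists_slope (h : IsPreTripodDiagram pt B) (ha : a ∈ B) :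
    ∃ f : ι → ℝ, ∀ k l, k ≠ a → l ≠ a → (0 < area (pt a) (pt k) (pt l) ↔ f k < f l) := by
  obtain ⟨q, hq⟩ := h.exposed a ha
  by_cases ht : ∃ t, t ≠ a
  swap
  · push Not at ht
    exact ⟨0, fun k _ hk => absurd (ht k) hk⟩
  obtain ⟨t, ht⟩ := ht
  refine ⟨fun x => area (pt a) (pt t) (pt x) / area (pt a) q (pt x), fun k l hk hl => ?_⟩
  have e := area_plucker q (pt k) (pt l) (pt a) (pt t)
  rw [div_lt_div_iff₀ (hq k hk) (hq l hl)]
  have ht' := hq t ht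
  have e2 : area (pt a) (pt t) q = -area (pt a) q (pt t) := area_swap' _ _ _
  rw [e2] at e
  constructor
  · intro h0
    have := mul_pos h0 ht'
    linarith
  · intro h0
    refine pos_of_mul_pos_left (b := area (pt a) q (pt t)) ?_ ht'.le
    linarith

/-- A fan of triangles with apex `a` and other vertices in `S` contains at least `S.card - 1`
white points. -/
theorem card_le_fan [Finite ι] (h : IsPreTripodDiagram pt B) (ha : a ∈ B) (S : Finset ι)
    (hS : ∀ k ∈ S, k ∈ B ∧ k ≠ a) :
    S.card ≤ {w | w ∉ B ∧ ∃ k ∈ S, ∃ l ∈ S, InTri (pt a) (pt k) (pt l) (pt w)}.ncard + 1 := by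
  classical
  obtain ⟨f, hf⟩ := h.exists_slope ha
  induction S using Finset.induction_on_max_value f with
  | empty => simp
  | insert m S hm hmax ih =>
    have hS' : ∀ k ∈ S, k ∈ B ∧ k ≠ a := fun k hk => hS k (Finset.mem_insert_of_mem hk)
    obtain ⟨hmB, hma⟩ := hS m (Finset.mem_insert_self _ _)
    have ih := ih hS'
    rw [Finset.card_insert_of_notMem hm]
    rcases S.eq_empty_or_nonempty with rfl | hne
    · simp
    obtain ⟨n, hn, hnmax⟩ := S.exists_max_image f hne
    obtain ⟨hnB, hna⟩ := hS' n hn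
    have hnm : n ≠ m := by rintro rfl; exact hm hn
    -- the triangle spanned by the two last directions contains a new white point
    obtain ⟨w, hw, hM⟩ := h.ex ha hnB hmB hna.symm hnm hma
    have hpos : 0 < area (pt a) (pt n) (pt w) := by
      rw [hM.pos_iff]
      refine lt_of_le_of_ne ?_ (h.nz ha hnB hna.symm hma hnm.symm).symm
      by_contra hc
      push Not at hc
      have : 0 < area (pt a) (pt m) (pt n) := by rw [area_swap']; linarith
      rw [hf m n hma hna] at this
      exact absurd (hmax n hn) (not_le.2 this)
    have hle : ∀ k ∈ S, area (pt a) (pt n) (pt k) ≤ 0 := by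
      intro k hk
      by_contra hc
      push Not at hc
      rw [hf n k hna (hS' k hk).2] at hc
      exact absurd (hnmax k hk) (not_le.2 hc)
    have hlt : ∀ k ∈ S, k ≠ n → area (pt a) (pt n) (pt k) < 0 := fun k hk hkn =>
      lt_of_le_of_ne (hle k hk) (h.nz ha hnB hna.symm (hS' k hk).2 hkn)
    have hsub : insert w {w | w ∉ B ∧ ∃ k ∈ S, ∃ l ∈ S, InTri (pt a) (pt k) (pt l) (pt w)} ⊆
        {w | w ∉ B ∧ ∃ k ∈ insert m S, ∃ l ∈ insert m S, InTri (pt a) (pt k) (pt l) (pt w)} := by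
      rintro v (rfl | ⟨hv, k, hk, l, hl, hM'⟩)
      · exact ⟨hw, n, by simp [hn], m, by simp, hM⟩
      · exact ⟨hv, k, by simp [hk], l, by simp [hl], hM'⟩
    have hnot : w ∉ {w | w ∉ B ∧ ∃ k ∈ S, ∃ l ∈ S, InTri (pt a) (pt k) (pt l) (pt w)} := by
      rintro ⟨-, k, hk, l, hl, hM'⟩
      refine absurd hpos (not_lt.2 (hM'.neg (by simp) (hle k hk) (hle l hl) ?_).le)
      by_cases hkn : k = n
      · exact Or.inr (Or.inr (hlt l hl fun e => hM'.ne.2.1 (hkn.trans e.symm)))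
      · exact Or.inr (Or.inl (hlt k hk hkn))
    have := Set.ncard_le_ncard hsub (Set.toFinite _)
    rw [Set.ncard_insert_of_notMem hnot (Set.toFinite _)] at this
    omega

end IsPreTripodDiagram

namespace IsTripodDiagram

variable {ι : Type*} {pt : ι → E 2} {B : Set ι} {a i j k l p q r x y z w v w' : ι}

/-- If `y` and `z` are on different sides of the line through the black points `i`, `j`, then the
segments `ij` and `yz` cross. -/
theorem crossing (h : IsTripodDiagram pt B) (hi : i ∈ B) (hj : j ∈ B)
    (hy : 0 < area (pt i) (pt j) (pt y)) (hz : area (pt i) (pt j) (pt z) < 0) :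
    0 < area (pt i) (pt z) (pt y) ∧ 0 < area (pt j) (pt y) (pt z) := by
  have hij : i ≠ j := by rintro rfl; simp at hy
  have hyi : y ≠ i := by rintro rfl; simp at hy
  have hyj : y ≠ j := by rintro rfl; simp at hy
  have hzi : z ≠ i := by rintro rfl; simp at hz
  have hzj : z ≠ j := by rintro rfl; simp at hz
  constructor
  · obtain ⟨f, hf⟩ := h.exists_slope hi
    rw [hf z y hzi hyi]
    rw [hf j y hij.symm hyi] at hy
    refine lt_trans ((hf z j hzi hij.symm).1 ?_) hy
    rw [area_swap']
    linarith
  · obtain ⟨f, hf⟩ := h.exists_slope hj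
    rw [hf y z hyj hzj]
    refine lt_trans ((hf y i hyj hij).1 ?_) ((hf i z hij hzj).1 ?_)
    · rwa [← area_rot]
    · rw [area_swap]; linarith

/-- Every white point lies in a black triangle with a given vertex. -/
theorem exists_inTri_mem (h : IsTripodDiagram pt B) (hi : i ∈ B) (hw : w ∉ B) :
    ∃ y ∈ B, ∃ z ∈ B, InTri (pt i) (pt y) (pt z) (pt w) := by
  obtain ⟨p, hp, q, hq, r, hr, hM⟩ := h.surj hw
  rcases h.four hw hp hq hr hi hM with b | b | b
  · exact ⟨q, hq, r, hr, b.1⟩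
  · exact ⟨r, hr, p, hp, b.2.1.rot⟩
  · exact ⟨p, hp, q, hq, b.2.2.rot.rot⟩

/-- The side of a black line on which a white point lies is determined by the black triangles that
contain the point. -/
theorem area_pos_iff (h : IsTripodDiagram pt B) (hi : i ∈ B) (hj : j ∈ B) (hij : i ≠ j)
    (hw : w ∉ B) : 0 < area (pt i) (pt j) (pt w) ↔
      ∃ p ∈ B, ∃ q ∈ B, ∃ r ∈ B, InTri (pt p) (pt q) (pt r) (pt w) ∧
        ∀ x, x = p ∨ x = q ∨ x = r → x = i ∨ x = j ∨ 0 < area (pt i) (pt j) (pt x) := by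
  have key : ∀ {i j}, (∃ p ∈ B, ∃ q ∈ B, ∃ r ∈ B, InTri (pt p) (pt q) (pt r) (pt w) ∧
        ∀ x, x = p ∨ x = q ∨ x = r → x = i ∨ x = j ∨ 0 < area (pt i) (pt j) (pt x)) →
      0 < area (pt i) (pt j) (pt w) := by
    rintro i j ⟨p, hp, q, hq, r, hr, hM, hs⟩
    have nn : ∀ x, x = p ∨ x = q ∨ x = r → 0 ≤ area (pt i) (pt j) (pt x) := by
      intro x hx
      rcases hs x hx with rfl | rfl | h'
      · simp
      · simp
      · exact h'.le
    refine hM.pos (nn p (by simp)) (nn q (by simp)) (nn r (by simp)) ?_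
    obtain ⟨n1, n2, n3⟩ := hM.ne
    have h1 := hs p (by simp)
    have h2 := hs q (by simp)
    have h3 := hs r (by simp)
    grind
  refine ⟨fun hpos => ?_, key⟩
  suffices hs : ∃ p ∈ B, ∃ q ∈ B, ∃ r ∈ B, InTri (pt p) (pt q) (pt r) (pt w) ∧
      ((∀ x, x = p ∨ x = q ∨ x = r → x = i ∨ x = j ∨ 0 < area (pt i) (pt j) (pt x)) ∨
       (∀ x, x = p ∨ x = q ∨ x = r → x = j ∨ x = i ∨ 0 < area (pt j) (pt i) (pt x))) by
    obtain ⟨p, hp, q, hq, r, hr, hM, hs | hs⟩ := hs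
    · exact ⟨p, hp, q, hq, r, hr, hM, hs⟩
    · have := key ⟨p, hp, q, hq, r, hr, hM, hs⟩
      rw [area_swap] at this
      linarith
  have third : ∀ k ∈ B, InTri (pt i) (pt j) (pt k) (pt w) →
      ∃ p ∈ B, ∃ q ∈ B, ∃ r ∈ B, InTri (pt p) (pt q) (pt r) (pt w) ∧
      ((∀ x, x = p ∨ x = q ∨ x = r → x = i ∨ x = j ∨ 0 < area (pt i) (pt j) (pt x)) ∨
       (∀ x, x = p ∨ x = q ∨ x = r → x = j ∨ x = i ∨ 0 < area (pt j) (pt i) (pt x))) := by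
    intro k hk hM
    refine ⟨i, hi, j, hj, k, hk, hM, ?_⟩
    rcases lt_or_gt_of_ne hM.area_ne with hk | hk
    · right
      rintro x (rfl | rfl | rfl)
      · simp
      · simp
      · right; right; rw [area_swap]; linarith
    · left
      rintro x (rfl | rfl | rfl)
      · simp
      · simp
      · right; right; exact hk
  obtain ⟨y, hy, z, hz, hM⟩ := h.exists_inTri_mem hi hw
  obtain ⟨n1, n2, n3⟩ := hM.ne
  rcases h.four hw hi hy hz hj hM with b | b | b
  · -- the triangles `iyz` and `jyz` both contain `w`, so `yz` does not separate `i` from `j`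
    have hyj := b.1.ne.1
    have hzj := b.1.ne.2.2
    have same : 0 < area (pt y) (pt z) (pt i) ↔ 0 < area (pt y) (pt z) (pt j) :=
      hM.rot.pos_iff.symm.trans b.1.rot.pos_iff
    rcases lt_or_gt_of_ne (h.nz hi hj hij n1.symm hyj.symm) with sy | sy <;>
      rcases lt_or_gt_of_ne (h.nz hi hj hij n3 hzj) with sz | sz
    · refine ⟨i, hi, y, hy, z, hz, hM, Or.inr ?_⟩
      rintro x (rfl | rfl | rfl)
      · simp
      · right; right; rw [area_swap]; linarith
      · right; right; rw [area_swap]; linarith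
    · obtain ⟨c1, c2⟩ := h.crossing hi hj sz sy
      rw [area_rot] at c1
      rw [same, ← area_rot, area_swap'] at c1
      linarith
    · obtain ⟨c1, c2⟩ := h.crossing hi hj sy sz
      rw [area_rot] at c2
      rw [← same, ← area_rot, area_swap'] at c2
      linarith
    · refine ⟨i, hi, y, hy, z, hz, hM, Or.inl ?_⟩
      rintro x (rfl | rfl | rfl)
      · simp
      · right; right; exact sy
      · right; right; exact sz
  · exact third z hz b.2.1
  · exact third y hy b.2.2.swap'

variable [Fintype ι]

theorem isCoface_of_separated (h : IsTripodDiagram pt B) (hi : i ∈ B) (hj : j ∈ B) (hw : w ∉ B)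
    (hw' : w' ∉ B) (h1 : 0 < area (pt i) (pt j) (pt w)) (h2 : area (pt i) (pt j) (pt w') < 0) :
    IsCoface pt B {i, j, w, w'} := by
  obtain ⟨c1, c2⟩ := h.crossing hi hj h1 h2
  have e : area (pt i) (pt w) (pt w') = - area (pt i) (pt w') (pt w) := area_swap' _ _ _
  have hij : i ≠ j := by rintro rfl; simp at h1
  have hww : w ≠ w' := by rintro rfl; linarith
  refine isCoface_four (c := 1) hij ?_ ?_ ?_ ?_ hww ?_ ?_ ?_ ?_
  iterate 4 exact (ne_white (by assumption) (by assumption)).symm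
  all_goals simp only [hi, hj, hw, hw', if_true, if_false]
  all_goals linarith

/-- Two white points on different sides of a black line form a coface with the two points on the
line. -/
theorem isCoface_of_mul_neg (h : IsTripodDiagram pt B) (hi : i ∈ B) (hj : j ∈ B) (hw : w ∉ B)
    (hw' : w' ∉ B) (hs : area (pt i) (pt j) (pt w) * area (pt i) (pt j) (pt w') < 0) :
    IsCoface pt B {i, j, w, w'} := by
  rcases mul_neg_iff.1 hs with ⟨h1, h2⟩ | ⟨h1, h2⟩
  · exact h.isCoface_of_separated hi hj hw hw' h1 h2
  · rw [show ({i, j, w, w'} : Set ι) = {i, j, w', w} by rw [Set.pair_comm w w']]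
    exact h.isCoface_of_separated hi hj hw' hw h2 h1

open Classical in
/-- In a set `T` with more points than there are black ones, every black point `a` is the apex of a
triangle whose white point belongs to `T`, since the fan of triangles at `a` contains too many white
points to avoid `T`. A white point of `T` is either in such a triangle, or separated from the white
point of the triangle by one of its edges; in both cases it lies in a coface with four points. -/
theorem isCoface_of_ncard_lt (h : IsTripodDiagram pt B) (hB : Bᶜ.ncard + 2 = B.ncard) {T : Set ι}
    (hT : B.ncard < T.ncard) : IsCoface pt B T := by
  have hTc : (T ∩ B).ncard + (T \ B).ncard = T.ncard :=
    Set.ncard_inter_add_ncard_sdiff_eq_ncard T B (Set.toFinite _)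
  have hTW : (T \ B).ncard ≤ Bᶜ.ncard := Set.ncard_le_ncard (fun x hx => hx.2) (Set.toFinite _)
  have fan : ∀ a ∈ T, a ∈ B → ∃ w ∈ T, w ∉ B ∧ ∃ k ∈ T, k ∈ B ∧ ∃ l ∈ T, l ∈ B ∧
      InTri (pt a) (pt k) (pt l) (pt w) := by
    intro a haT ha
    have hf := h.card_le_fan ha ((T ∩ B).toFinset.erase a)
      (fun k hk => by simp at hk; exact ⟨hk.2.2, hk.1⟩)
    rw [Finset.card_erase_of_mem (by simp [ha, haT]), ← Set.ncard_eq_toFinset_card'] at hf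
    set F := {w | w ∉ B ∧ ∃ k ∈ (T ∩ B).toFinset.erase a, ∃ l ∈ (T ∩ B).toFinset.erase a,
      InTri (pt a) (pt k) (pt l) (pt w)} with hF
    have hU : (F ∪ (T \ B)).ncard ≤ Bᶜ.ncard := by
      refine Set.ncard_le_ncard ?_ (Set.toFinite _)
      rintro x (hx | hx)
      · exact hx.1
      · exact hx.2
    have hI := Set.ncard_union_add_ncard_inter F (T \ B) (Set.toFinite _) (Set.toFinite _)
    have : (F ∩ (T \ B)).ncard ≠ 0 := by omega
    obtain ⟨w, ⟨hw, k, hk, l, hl, hM⟩, hwT⟩ := Set.nonempty_of_ncard_ne_zero this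
    simp at hk hl
    exact ⟨w, hwT.1, hw, k, hk.2.1, hk.2.2, l, hl.2.1, hl.2.2, hM⟩
  refine IsCoface.of_forall_exists fun x hx => ?_
  by_cases hxB : x ∈ B
  · obtain ⟨w, hwT, hw, k, hkT, hk, l, hlT, hl, hM⟩ := fan x hx hxB
    refine ⟨{x, k, l, w}, ?_, by simp, isCoface_of_inTri hxB hk hl hw hM⟩
    rintro y (rfl | rfl | rfl | rfl) <;> assumption
  · have : (T ∩ B).ncard ≠ 0 := by omega
    obtain ⟨a, haT, ha⟩ := Set.nonempty_of_ncard_ne_zero this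
    obtain ⟨w, hwT, hw, k, hkT, hk, l, hlT, hl, hM⟩ := fan a haT ha
    obtain ⟨n1, n2, n3⟩ := hM.ne
    by_cases hxM : InTri (pt a) (pt k) (pt l) (pt x)
    · refine ⟨{a, k, l, x}, ?_, by simp, isCoface_of_inTri ha hk hl hxB hxM⟩
      rintro y (rfl | rfl | rfl | rfl) <;> assumption
    -- an edge of the triangle that contains `w` separates `x` from `w`
    have hn : ∀ {i j}, i ∈ B → j ∈ B → i ≠ j → area (pt i) (pt j) (pt x) ≠ 0 :=
      fun hi hj hij => h.nz hi hj hij (ne_white hi hxB) (ne_white hj hxB)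
    have sep : ∀ {i j}, i ∈ T → j ∈ T → i ∈ B → j ∈ B →
        area (pt i) (pt j) (pt x) * area (pt i) (pt j) (pt w) < 0 →
        ∃ S ⊆ T, x ∈ S ∧ IsCoface pt B S := by
      intro i j hiT hjT hi hj hs
      refine ⟨{i, j, x, w}, ?_, by simp, h.isCoface_of_mul_neg hi hj hxB hw hs⟩
      rintro y (rfl | rfl | rfl | rfl) <;> assumption
    by_contra hcon
    have hs : ∀ {i j}, i ∈ T → j ∈ T → i ∈ B → j ∈ B → i ≠ j → area (pt i) (pt j) (pt w) ≠ 0 →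
        0 < area (pt i) (pt j) (pt x) * area (pt i) (pt j) (pt w) :=
      fun hiT hjT hi hj hij hne => lt_of_le_of_ne
        (not_lt.1 fun c => hcon (sep hiT hjT hi hj c)) (mul_ne_zero (hn hi hj hij) hne).symm
    have s1 := hs haT hkT ha hk n1 (h.nz ha hk n1 (ne_white ha hw) (ne_white hk hw))
    have s2 := hs hkT hlT hk hl n2 (h.nz hk hl n2 (ne_white hk hw) (ne_white hl hw))
    have s3 := hs hlT haT hl ha n3 (h.nz hl ha n3 (ne_white hl hw) (ne_white ha hw))
    apply hxM
    rcases hM with ⟨h1, h2, h3⟩ | ⟨h1, h2, h3⟩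
    · exact Or.inl ⟨pos_of_mul_pos_left s1 h1.le, pos_of_mul_pos_left s2 h2.le,
        pos_of_mul_pos_left s3 h3.le⟩
    · exact Or.inr ⟨neg_of_mul_pos_left s1 h1.le, neg_of_mul_pos_left s2 h2.le,
        neg_of_mul_pos_left s3 h3.le⟩

end IsTripodDiagram

/-! ### Minimal cofaces -/

section Minimal

variable {ι : Type*} [Fintype ι] {pt : ι → E 2} {B T : Set ι} {i : ι}

open Classical in
/-- A Carathéodory type reduction: more than four points have an affine dependency that vanishes at
a given point, and adding a multiple of it to a dependency removes one of the other points. -/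
theorem IsCoface.exists_ssubset (hT : IsCoface pt B T) (hi : i ∈ T) (hc : 4 < T.ncard) :
    ∃ S ⊂ T, i ∈ S ∧ IsCoface pt B S := by
  obtain ⟨μ, h1, h2, h3, h4, h5⟩ := hT
  let L : (T → ℝ) →ₗ[ℝ] (E 2 × ℝ × ℝ) :=
    { toFun := fun ν => (∑ x, ν x • pt x, ∑ x, ν x, ν ⟨i, hi⟩)
      map_add' := fun a b => by simp [add_smul, Finset.sum_add_distrib]
      map_smul' := fun c a => by simp [mul_smul, Finset.smul_sum, Finset.mul_sum] }
  have hker : LinearMap.ker L ≠ ⊥ := by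
    refine LinearMap.ker_ne_bot_of_finrank_lt ?_
    have : Module.finrank ℝ (T → ℝ) = T.ncard := by
      rw [Module.finrank_fintype_fun_eq_card, ← Nat.card_eq_fintype_card, Nat.card_coe_set_eq]
    rw [this]
    simp
    exact hc
  obtain ⟨ν₀, hν₀, hne⟩ := Submodule.exists_mem_ne_zero_of_ne_bot hker
  rw [LinearMap.mem_ker] at hν₀
  simp only [L, LinearMap.coe_mk, AddHom.coe_mk, Prod.mk_eq_zero] at hν₀
  have ext : ∃ ν : ι → ℝ, (∀ x ∉ T, ν x = 0) ∧ ∑ x, ν x = 0 ∧ ∑ x, ν x • pt x = 0 ∧ ν i = 0 ∧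
      ∃ x ∈ T, ν x ≠ 0 := by
    refine ⟨fun x => if hx : x ∈ T then ν₀ ⟨x, hx⟩ else 0, fun x hx => by simp [hx], ?_, ?_, ?_, ?_⟩
    · refine Eq.trans ?_ hν₀.2.1
      exact (Fintype.sum_of_injective Subtype.val Subtype.val_injective _ _
        (fun x hx => by simp at hx; simp [hx]) (fun x => by simp)).symm
    · refine Eq.trans ?_ hν₀.1
      exact (Fintype.sum_of_injective Subtype.val Subtype.val_injective _ _
        (fun x hx => by simp at hx; simp [hx]) (fun x => by simp)).symm
    · simpa [hi] using hν₀.2.2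
    · obtain ⟨x, hx⟩ := Function.ne_iff.1 hne
      exact ⟨x, x.2, by simpa using hx⟩
  -- the colours as signs
  let σ : ι → ℝ := fun x => if x ∈ B then 1 else -1
  have hσ : ∀ x ∈ T, 0 < σ x * μ x := by
    intro x hx
    by_cases hB : x ∈ B
    · simpa [σ, hB] using h1 x hx hB
    · simpa [σ, hB] using h2 x hx hB
  have hσ0 : ∀ x, σ x ≠ 0 := fun x => by by_cases hB : x ∈ B <;> simp [σ, hB]
  obtain ⟨ν, n1, n2, n3, n4, x, hx, hxν⟩ : ∃ ν : ι → ℝ, (∀ x ∉ T, ν x = 0) ∧ ∑ x, ν x = 0 ∧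
      ∑ x, ν x • pt x = 0 ∧ ν i = 0 ∧ ∃ x ∈ T, σ x * ν x < 0 := by
    obtain ⟨ν, n1, n2, n3, n4, x, hx, hxν⟩ := ext
    rcases lt_or_gt_of_ne (mul_ne_zero (hσ0 x) hxν) with h | h
    · exact ⟨ν, n1, n2, n3, n4, x, hx, h⟩
    · refine ⟨-ν, fun x hx => by simp [n1 x hx], by simp [n2], by simp [n3], by simp [n4], x, hx,
        by simpa using h⟩
  -- the largest multiple of `ν` that can be added to `μ` without a change of sign
  obtain ⟨z, hz, hzmin⟩ := (Finset.univ.filter fun x => x ∈ T ∧ σ x * ν x < 0).exists_min_image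
    (fun x => (σ x * μ x) / -(σ x * ν x)) ⟨x, by simp [hx, hxν]⟩
  simp only [Finset.mem_filter, Finset.mem_univ, true_and] at hz hzmin
  set t := (σ z * μ z) / -(σ z * ν z) with ht
  have ht0 : 0 < t := div_pos (hσ z hz.1) (by linarith [hz.2])
  have hnn : ∀ y ∈ T, 0 ≤ σ y * (μ y + t * ν y) := by
    intro y hy
    rcases lt_or_ge (σ y * ν y) 0 with h | h
    · have := hzmin y ⟨hy, h⟩
      rw [le_div_iff₀ (by linarith)] at this
      linarith
    · have := mul_nonneg ht0.le h
      have := hσ y hy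
      linarith
  have hz0 : μ z + t * ν z = 0 := by
    have e : σ z * (μ z + t * ν z) = 0 := by
      have : t * -(σ z * ν z) = σ z * μ z := div_mul_cancel₀ _ (by linarith [hz.2])
      linarith
    exact (mul_eq_zero.1 e).resolve_left (hσ0 z)
  refine ⟨{y | y ∈ T ∧ μ y + t * ν y ≠ 0}, ⟨fun y hy => hy.1, fun h => (h hz.1).2 hz0⟩, ?_,
    fun y => μ y + t * ν y, ?_, ?_, ?_, ?_, ?_⟩
  · refine ⟨hi, ?_⟩
    rw [n4, mul_zero, add_zero]
    exact fun e => absurd (hσ i hi) (by simp [e])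
  · rintro y ⟨hy, hy0⟩ hB
    have := hnn y hy
    simp only [σ, hB, if_true, one_mul] at this
    exact lt_of_le_of_ne this hy0.symm
  · rintro y ⟨hy, hy0⟩ hB
    have := hnn y hy
    simp only [σ, hB, if_false] at this
    exact lt_of_le_of_ne (by linarith) hy0
  · intro y hy
    by_cases hyT : y ∈ T
    · by_contra h0
      exact hy ⟨hyT, h0⟩
    · simp [h3 y hyT, n1 y hyT]
  · rw [Finset.sum_add_distrib, ← Finset.mul_sum, h4, n2]
    simp
  · simp_rw [add_smul, mul_smul]
    rw [Finset.sum_add_distrib, ← Finset.smul_sum, h5, n3]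
    simp

/-- Every element of a coface lies in a coface with at most four elements. -/
theorem IsCoface.exists_ncard_le (hT : IsCoface pt B T) (hi : i ∈ T) :
    ∃ S ⊆ T, i ∈ S ∧ IsCoface pt B S ∧ S.ncard ≤ 4 := by
  induction hn : T.ncard using Nat.strong_induction_on generalizing T with
  | _ n ih =>
    by_cases hc : T.ncard ≤ 4
    · exact ⟨T, subset_rfl, hi, hT, hc⟩
    obtain ⟨S, hS, hiS, hc'⟩ := hT.exists_ssubset hi (not_le.1 hc)
    obtain ⟨R, hR, h⟩ := ih _ (hn ▸ Set.ncard_lt_ncard hS (Set.toFinite _)) hc' hiS rfl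
    exact ⟨R, hR.trans hS.subset, h⟩

theorem IsCoface.exists_notMem (hT : IsCoface pt B T) (hne : T.Nonempty) : ∃ w ∈ T, w ∉ B := by
  obtain ⟨μ, h1, h2, h3, h4, h5⟩ := hT
  by_contra hcon
  push Not at hcon
  obtain ⟨i, hi⟩ := hne
  have := Finset.sum_pos' (s := Finset.univ) (f := μ) (fun j _ => by
    by_cases hj : j ∈ T
    · exact (h1 j hj (hcon j hj)).le
    · exact (h3 j hj).ge) ⟨i, Finset.mem_univ _, h1 i hi (hcon i hi)⟩
  linarith

theorem IsCoface.exists_mem (hT : IsCoface pt B T) (hne : T.Nonempty) : ∃ a ∈ T, a ∈ B := by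
  obtain ⟨μ, h1, h2, h3, h4, h5⟩ := hT
  by_contra hcon
  push Not at hcon
  obtain ⟨i, hi⟩ := hne
  have := Finset.sum_pos' (s := Finset.univ) (f := fun x => -μ x) (fun j _ => by
    by_cases hj : j ∈ T
    · exact neg_nonneg.2 (h2 j hj (hcon j hj)).le
    · simp [h3 j hj]) ⟨i, Finset.mem_univ _, neg_pos.2 (h2 i hi (hcon i hi))⟩
  rw [Finset.sum_neg_distrib] at this
  linarith

end Minimal

namespace IsTripodDiagram

variable {ι : Type*} [Fintype ι] {pt : ι → E 2} {B T : Set ι} {a i j k l p q r x y z w v w' : ι}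

theorem exists_mem_ne (h : IsTripodDiagram pt B) (hT : IsCoface pt B T) (ha : a ∈ B) (haT : a ∈ T) :
    ∃ b ∈ T, b ∈ B ∧ b ≠ a := by
  obtain ⟨w, hw, hwB⟩ := hT.exists_notMem ⟨a, haT⟩
  obtain ⟨μ, h1, h2, h3, h4, h5⟩ := hT
  by_contra hcon
  push Not at hcon
  obtain ⟨q, hq⟩ := h.exposed a ha
  have e := sum_mul_area h4 h5 (pt a) q
  have hneg : ∀ y, μ y * area (pt a) q (pt y) ≤ 0 := by
    intro y
    by_cases hya : y = a
    · subst hya; simp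
    refine mul_nonpos_of_nonpos_of_nonneg ?_ (hq y hya).le
    by_cases hy : y ∈ T
    · exact (h2 y hy fun hyB => hya (hcon y hy hyB)).le
    · exact (h3 y hy).le
  have := (Finset.sum_eq_zero_iff_of_nonpos fun y _ => hneg y).1 e w (Finset.mem_univ _)
  rcases mul_eq_zero.1 this with h' | h'
  · exact absurd (h2 w hw hwB) (by simp [h'])
  · exact absurd (hq w (ne_white ha hwB)) (by simp [h'])

open Classical in
theorem sum_four {M : Type*} [AddCommMonoid M] {f : ι → M} (hij : i ≠ j) (hik : i ≠ k)
    (hil : i ≠ l) (hjk : j ≠ k) (hjl : j ≠ l) (hkl : k ≠ l)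
    (h : ∀ x ∉ ({i, j, k, l} : Set ι), f x = 0) : ∑ x, f x = f i + f j + f k + f l := by
  rw [← Finset.sum_subset (Finset.subset_univ {i, j, k, l})
    (fun x _ hx => h x (by simpa using hx))]
  rw [Finset.sum_insert (by simp [*]), Finset.sum_insert (by simp [*]),
    Finset.sum_insert (by simp [*]), Finset.sum_singleton]
  simp only [add_assoc]

theorem inTri_of_isCoface (h : IsTripodDiagram pt B) (hi : i ∈ B) (hj : j ∈ B) (hk : k ∈ B)
    (hw : w ∉ B) (hij : i ≠ j) (hjk : j ≠ k) (hki : k ≠ i) (hT : IsCoface pt B {i, j, k, w}) :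
    InTri (pt i) (pt j) (pt k) (pt w) := by
  obtain ⟨μ, h1, h2, h3, h4, h5⟩ := hT
  have e := fun s t => (sum_four hij hki.symm (ne_white hi hw).symm hjk (ne_white hj hw).symm
    (ne_white hk hw).symm (f := fun x => μ x * area s t (pt x))
    (fun x hx => by simp [h3 x hx])).symm.trans (sum_mul_area h4 h5 s t)
  have m1 := h1 i (by simp) hi
  have m2 := h1 j (by simp) hj
  have m3 := h1 k (by simp) hk
  have m4 := h2 w (by simp) hw
  have key : ∀ {α β x y : ℝ}, 0 < α → β < 0 → α * x + β * y = 0 → (0 < x → 0 < y) ∧ (x < 0 → y < 0)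
      := by
    intro α β x y hα hβ e
    constructor
    · intro hx
      by_contra hy
      have := mul_pos hα hx
      have := mul_nonneg_of_nonpos_of_nonpos hβ.le (not_lt.1 hy)
      linarith
    · intro hx
      by_contra hy
      have := mul_neg_of_pos_of_neg hα hx
      have := mul_nonpos_of_nonpos_of_nonneg hβ.le (not_lt.1 hy)
      linarith
  have e1 := key m3 m4 (by simpa using e (pt i) (pt j))
  have e2 := key m1 m4 (by simpa using e (pt j) (pt k))
  have e3 := key m2 m4 (by simpa using e (pt k) (pt i))
  rw [← area_rot] at e2
  rw [area_rot] at e3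
  rcases lt_or_gt_of_ne (h.nz hi hj hij hki hjk.symm) with hs | hs
  · exact Or.inr ⟨e1.2 hs, e2.2 hs, e3.2 hs⟩
  · exact Or.inl ⟨e1.1 hs, e2.1 hs, e3.1 hs⟩

theorem mul_neg_of_isCoface (h : IsTripodDiagram pt B) (hi : i ∈ B) (hj : j ∈ B) (hw : w ∉ B)
    (hw' : w' ∉ B) (hij : i ≠ j) (hww : w ≠ w') (hT : IsCoface pt B {i, j, w, w'}) :
    area (pt i) (pt j) (pt w) * area (pt i) (pt j) (pt w') < 0 := by
  obtain ⟨μ, h1, h2, h3, h4, h5⟩ := hT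
  have e := (sum_four hij (ne_white hi hw).symm (ne_white hi hw').symm (ne_white hj hw).symm
    (ne_white hj hw').symm hww (f := fun x => μ x * area (pt i) (pt j) (pt x))
    (fun x hx => by simp [h3 x hx])).symm.trans (sum_mul_area h4 h5 (pt i) (pt j))
  have m3 := h2 w (by simp) hw
  have m4 := h2 w' (by simp) hw'
  have n := h.nz hi hj hij (ne_white hi hw) (ne_white hj hw)
  have n' := h.nz hi hj hij (ne_white hi hw') (ne_white hj hw')
  simp at e
  rcases lt_or_gt_of_ne n with s | s <;> rcases lt_or_gt_of_ne n' with s' | s'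
  · have := mul_pos_of_neg_of_neg m3 s
    have := mul_pos_of_neg_of_neg m4 s'
    linarith
  · exact mul_neg_of_neg_of_pos s s'
  · exact mul_neg_of_pos_of_neg s s'
  · have := mul_neg_of_neg_of_pos m3 s
    have := mul_neg_of_neg_of_pos m4 s'
    linarith

/-- A nonempty coface with at most four points is either a black triangle with a white point inside
or a black segment separating two white points. -/
theorem exists_of_isCoface (h : IsTripodDiagram pt B) (hT : IsCoface pt B T) (hne : T.Nonempty)
    (h4 : T.ncard ≤ 4) :
    (∃ i j k w, i ∈ B ∧ j ∈ B ∧ k ∈ B ∧ w ∉ B ∧ T = {i, j, k, w} ∧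
      InTri (pt i) (pt j) (pt k) (pt w)) ∨
    (∃ i j w w', i ∈ B ∧ j ∈ B ∧ w ∉ B ∧ w' ∉ B ∧ T = {i, j, w, w'} ∧
      area (pt i) (pt j) (pt w) * area (pt i) (pt j) (pt w') < 0) := by
  obtain ⟨i, hiT, hi⟩ := hT.exists_mem hne
  obtain ⟨j, hjT, hj, hji⟩ := h.exists_mem_ne hT hi hiT
  obtain ⟨w, hwT, hw⟩ := hT.exists_notMem hne
  have hwi := ne_white hi hw
  have hwj := ne_white hj hw
  have hcard : ({i, j, w} : Set ι).ncard = 3 := by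
    rw [Set.ncard_eq_three]
    exact ⟨i, j, w, hji.symm, hwi.symm, hwj.symm, rfl⟩
  obtain ⟨x, hxT, hx⟩ : ∃ x ∈ T, x ∉ ({i, j, w} : Set ι) := by
    by_contra hcon
    push Not at hcon
    obtain ⟨μ, h1, h2, h3, h4, h5⟩ := hT
    have e := sum_mul_area h4 h5 (pt i) (pt j)
    rw [Finset.sum_eq_single w] at e
    · rcases mul_eq_zero.1 e with h' | h'
      · exact absurd (h2 w hwT hw) (by simp [h'])
      · exact h.nz hi hj hji.symm hwi hwj h'
    · intro y _ hyw
      by_cases hy : y ∈ T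
      · rcases hcon y hy with rfl | rfl | rfl
        · simp
        · simp
        · exact absurd rfl hyw
      · rw [h3 y hy, zero_mul]
    · simp
  have hTe : T = insert x {i, j, w} := by
    symm
    refine Set.eq_of_subset_of_ncard_le ?_ ?_ (Set.toFinite _)
    · rintro y (rfl | rfl | rfl | rfl) <;> assumption
    · rw [Set.ncard_insert_of_notMem hx, hcard]
      exact h4
  simp only [Set.mem_insert_iff, Set.mem_singleton_iff, not_or] at hx
  by_cases hxB : x ∈ B
  · have e : T = {i, j, x, w} := by rw [hTe]; ext y; simp; tauto
    exact Or.inl ⟨i, j, x, w, hi, hj, hxB, hw, e,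
      h.inTri_of_isCoface hi hj hxB hw hji.symm (Ne.symm hx.2.1) hx.1 (e ▸ hT)⟩
  · have e : T = {i, j, w, x} := by rw [hTe]; ext y; simp; tauto
    exact Or.inr ⟨i, j, w, x, hi, hj, hw, hxB, e,
      h.mul_neg_of_isCoface hi hj hw hxB hji.symm (Ne.symm hx.2.2) (e ▸ hT)⟩

variable {ι' : Type*} [Fintype ι'] {pt' : ι' → E 2} {B' : Set ι'} {e : ι ≃ ι'}

/-- A bijection between tripod diagrams that preserves colours, the triangles containing a point,
and the orientation of black triangles up to a global sign preserves cofaces. -/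
theorem isCoface_image (h : IsTripodDiagram pt B) (h' : IsTripodDiagram pt' B')
    (hB : ∀ i, e i ∈ B' ↔ i ∈ B)
    (hM : ∀ {i j k w}, i ∈ B → j ∈ B → k ∈ B → w ∉ B → InTri (pt i) (pt j) (pt k) (pt w) →
      InTri (pt' (e i)) (pt' (e j)) (pt' (e k)) (pt' (e w)))
    (ho : (∀ {i j k}, i ∈ B → j ∈ B → k ∈ B → 0 < area (pt i) (pt j) (pt k) →
        0 < area (pt' (e i)) (pt' (e j)) (pt' (e k))) ∨
      (∀ {i j k}, i ∈ B → j ∈ B → k ∈ B → 0 < area (pt i) (pt j) (pt k) →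
        area (pt' (e i)) (pt' (e j)) (pt' (e k)) < 0)) (hT : IsCoface pt B T) :
    IsCoface pt' B' (e '' T) := by
  -- the side on which a white point lies of a black line is preserved, up to a global sign
  have hside : (∀ {i j w}, i ∈ B → j ∈ B → w ∉ B → 0 < area (pt i) (pt j) (pt w) →
        0 < area (pt' (e i)) (pt' (e j)) (pt' (e w))) ∨
      (∀ {i j w}, i ∈ B → j ∈ B → w ∉ B → 0 < area (pt i) (pt j) (pt w) →
        area (pt' (e i)) (pt' (e j)) (pt' (e w)) < 0) := by
    refine ho.imp (fun ho i j w hi hj hw hpos => ?_) (fun ho i j w hi hj hw hpos => ?_)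
    · have hij : i ≠ j := by rintro rfl; simp at hpos
      obtain ⟨p, hp, q, hq, r, hr, hM', hs⟩ := (h.area_pos_iff hi hj hij hw).1 hpos
      refine (h'.area_pos_iff ((hB i).2 hi) ((hB j).2 hj) (e.injective.ne hij)
        (mt (hB w).1 hw)).2 ⟨e p, (hB p).2 hp, e q, (hB q).2 hq, e r, (hB r).2 hr,
          hM hp hq hr hw hM', ?_⟩
      have : ∀ x ∈ B, (x = p ∨ x = q ∨ x = r) → e x = e i ∨ e x = e j ∨
          0 < area (pt' (e i)) (pt' (e j)) (pt' (e x)) := fun x hx hx' =>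
        (hs x hx').imp (congrArg e) (Or.imp (congrArg e) (ho hi hj hx))
      rintro x (rfl | rfl | rfl)
      · exact this _ hp (by simp)
      · exact this _ hq (by simp)
      · exact this _ hr (by simp)
    · have hij : i ≠ j := by rintro rfl; simp at hpos
      obtain ⟨p, hp, q, hq, r, hr, hM', hs⟩ := (h.area_pos_iff hi hj hij hw).1 hpos
      rw [area_swap, neg_lt_zero]
      refine (h'.area_pos_iff ((hB j).2 hj) ((hB i).2 hi) (e.injective.ne hij.symm)
        (mt (hB w).1 hw)).2 ⟨e p, (hB p).2 hp, e q, (hB q).2 hq, e r, (hB r).2 hr,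
          hM hp hq hr hw hM', ?_⟩
      have : ∀ x ∈ B, (x = p ∨ x = q ∨ x = r) → e x = e j ∨ e x = e i ∨
          0 < area (pt' (e j)) (pt' (e i)) (pt' (e x)) := fun x hx hx' => by
        rcases hs x hx' with rfl | rfl | h1
        · simp
        · simp
        · have := ho hi hj hx h1
          rw [area_swap, neg_lt_zero] at this
          exact Or.inr (Or.inr this)
      rintro x (rfl | rfl | rfl)
      · exact this _ hp (by simp)
      · exact this _ hq (by simp)
      · exact this _ hr (by simp)
  refine IsCoface.of_forall_exists ?_
  rintro _ ⟨x, hx, rfl⟩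
  -- it suffices to consider cofaces with at most four elements, of which there are two kinds
  obtain ⟨S, hS, hxS, hc, hcard⟩ := hT.exists_ncard_le hx
  refine ⟨e '' S, Set.image_mono hS, Set.mem_image_of_mem e hxS, ?_⟩
  rcases h.exists_of_isCoface hc ⟨x, hxS⟩ hcard with
    ⟨i, j, k, w, hi, hj, hk, hw, rfl, hM'⟩ | ⟨i, j, w, w', hi, hj, hw, hw', rfl, hs⟩
  · simp only [Set.image_insert_eq, Set.image_singleton]
    exact isCoface_of_inTri ((hB i).2 hi) ((hB j).2 hj) ((hB k).2 hk) (mt (hB w).1 hw)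
      (hM hi hj hk hw hM')
  · simp only [Set.image_insert_eq, Set.image_singleton]
    refine h'.isCoface_of_mul_neg ((hB i).2 hi) ((hB j).2 hj) (mt (hB w).1 hw)
      (mt (hB w').1 hw') ?_
    have key : ∀ {w w'}, w ∉ B → w' ∉ B → 0 < area (pt i) (pt j) (pt w) →
        area (pt i) (pt j) (pt w') < 0 →
        area (pt' (e i)) (pt' (e j)) (pt' (e w)) *
          area (pt' (e i)) (pt' (e j)) (pt' (e w')) < 0 := by
      intro w w' hw hw' s s'
      have s' : 0 < area (pt j) (pt i) (pt w') := by rw [area_swap]; linarith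
      rcases hside with hside | hside
      · have := hside hj hi hw' s'
        rw [area_swap, neg_pos] at this
        exact mul_neg_of_pos_of_neg (hside hi hj hw s) this
      · have := hside hj hi hw' s'
        rw [area_swap, neg_lt_zero] at this
        exact mul_neg_of_neg_of_pos (hside hi hj hw s) this
    rcases mul_neg_iff.1 hs with ⟨s, s'⟩ | ⟨s, s'⟩
    · exact key hw hw' s s'
    · rw [mul_comm]
      exact key hw' hw s' s

end IsTripodDiagram

/-! ### Splitting a point of a planar diagram -/

section Splitting

open Filter Topology

theorem eventually_pos {f : ℝ → ℝ} (g : ℝ → ℝ) (hg : Continuous g) (h0 : 0 < g 0)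
    (hf : ∀ ε, f ε = g ε) : ∀ᶠ ε in 𝓝[>] (0 : ℝ), 0 < f ε := by
  have : ∀ᶠ ε in 𝓝[>] (0 : ℝ), 0 < g ε :=
    ((hg.tendsto 0).eventually (lt_mem_nhds h0)).filter_mono nhdsWithin_le_nhds
  filter_upwards [this] with ε h
  rwa [hf]

theorem eventually_pos_of_eq_mul {f : ℝ → ℝ} (g : ℝ → ℝ) (hg : Continuous g) (h0 : 0 < g 0)
    (hf : ∀ ε, f ε = ε * g ε) : ∀ᶠ ε in 𝓝[>] (0 : ℝ), 0 < f ε := by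
  filter_upwards [eventually_pos g hg h0 fun _ => rfl, self_mem_nhdsWithin] with ε h hε
  rw [hf]
  exact mul_pos hε h

/-- Let the points `a₁`, `a₂`, `w` coincide at a place that is strictly supported by a line with
direction `u`. They can be moved apart, the first two in the direction `u`, and the third to the
inner side of their midpoint, such that nondegenerate triangles keep their orientation, exposed
points stay exposed, and moreover `a₁` and `a₂` are exposed and so is `w` if one of them is
ignored. -/
theorem exists_splitting {ι : Type*} [Finite ι] {pt₀ : ι → E 2} {a₁ a₂ w z : ι} {u : E 2}
    (ha : a₁ ≠ a₂) (hw₁ : w ≠ a₁) (hw₂ : w ≠ a₂)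
    (hz : z ≠ a₁ ∧ z ≠ a₂ ∧ z ≠ w) (e₂ : pt₀ a₂ = pt₀ a₁) (e₃ : pt₀ w = pt₀ a₁)
    (hu : ∀ x, x ≠ a₁ → x ≠ a₂ → x ≠ w → 0 < area (pt₀ a₁) (pt₀ a₁ + u) (pt₀ x)) :
    ∃ pt : ι → E 2, (∀ x, x ≠ a₂ → x ≠ w → pt x = pt₀ x) ∧
      (∀ x y z, 0 < area (pt₀ x) (pt₀ y) (pt₀ z) → 0 < area (pt x) (pt y) (pt z)) ∧
      (∀ x, x ≠ a₁ → x ≠ a₂ → x ≠ w → 0 < area (pt a₁) (pt a₂) (pt x) ∧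
        0 < area (pt a₁) (pt w) (pt x) ∧ 0 < area (pt w) (pt a₂) (pt x)) ∧
      0 < area (pt a₁) (pt a₂) (pt w) ∧
      (∃ q, ∀ x, x ≠ a₁ → 0 < area (pt a₁) q (pt x)) ∧
      (∃ q, ∀ x, x ≠ a₁ → x ≠ w → 0 < area (pt w) q (pt x)) ∧
      (∃ q, ∀ x, x ≠ a₂ → 0 < area (pt a₂) q (pt x)) ∧
      (∃ q, ∀ x, x ≠ a₂ → x ≠ w → 0 < area (pt w) q (pt x)) ∧
      (∀ a, (∃ q, ∀ x, x ≠ a → 0 < area (pt₀ a) q (pt₀ x)) →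
        ∃ q, ∀ x, x ≠ a → 0 < area (pt a) q (pt x)) := by
  classical
  set A := pt₀ a₁ with hA
  have hu0 : 0 < u 1 * u 1 + u 0 * u 0 := by
    have := hu z hz.1 hz.2.1 hz.2.2
    rcases eq_or_ne (u 0) 0 with h0 | h0
    · rcases eq_or_ne (u 1) 0 with h1 | h1
      · simp [area, h0, h1] at this
      · have := mul_self_pos.2 h1
        have := mul_self_nonneg (u 0)
        linarith
    · have := mul_self_pos.2 h0
      have := mul_self_nonneg (u 1)
      linarith
  -- two directions, slightly turned against `u`
  let r : E 2 := !₂[u 1, -u 0]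
  have r0 : r 0 = u 1 := rfl
  have r1 : r 1 = -u 0 := rfl
  obtain ⟨s, hs0, hs⟩ : ∃ s : ℝ, 0 < s ∧ ∀ x, x ≠ a₁ → x ≠ a₂ → x ≠ w →
      0 < area A (A + (u + s • r)) (pt₀ x) ∧ 0 < area A (A + (u - s • r)) (pt₀ x) := by
    have : ∀ᶠ s in 𝓝[>] (0 : ℝ), ∀ x, x ≠ a₁ → x ≠ a₂ → x ≠ w →
        0 < area A (A + (u + s • r)) (pt₀ x) ∧ 0 < area A (A + (u - s • r)) (pt₀ x) := by
      rw [eventually_all]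
      intro x
      by_cases hx : x ≠ a₁ ∧ x ≠ a₂ ∧ x ≠ w
      · have h := hu x hx.1 hx.2.1 hx.2.2
        have h1 : ∀ᶠ s in 𝓝[>] (0 : ℝ), 0 < area A (A + (u + s • r)) (pt₀ x) := by
          refine eventually_pos (fun s => (u 0 + s * r 0) * (pt₀ x 1 - A 1) -
            (u 1 + s * r 1) * (pt₀ x 0 - A 0)) (by fun_prop) ?_ (fun s => by simp [area])
          simpa [area] using h
        have h2 : ∀ᶠ s in 𝓝[>] (0 : ℝ), 0 < area A (A + (u - s • r)) (pt₀ x) := by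
          refine eventually_pos (fun s => (u 0 - s * r 0) * (pt₀ x 1 - A 1) -
            (u 1 - s * r 1) * (pt₀ x 0 - A 0)) (by fun_prop) ?_ (fun s => by simp [area])
          simpa [area] using h
        filter_upwards [h1, h2] with s h1 h2 _ _ _ using ⟨h1, h2⟩
      · exact Eventually.of_forall fun s h1 h2 h3 => absurd ⟨h1, h2, h3⟩ hx
    obtain ⟨s, h, hs⟩ := (this.and self_mem_nhdsWithin).exists
    exact ⟨s, hs, h⟩
  set v := pt₀ z - A with hv
  have hsr : 0 < s * (r 0 * u 1 - r 1 * u 0) := by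
    rw [r0, r1]
    exact mul_pos hs0 (by linarith)
  -- the offset of `w` from the midpoint is of second order, so that the directions from `w` to `a₁`
  -- and `a₂` are nearly those of the supporting line
  let pt : ℝ → ι → E 2 := fun ε x => if x = a₂ then A + ε • u else
    if x = w then A + ((ε / 2) • u + ε ^ 2 • v) else pt₀ x
  have p1 : ∀ ε, pt ε a₁ = A := fun ε => by simp [pt, ha, hw₁.symm, hA]
  have p2 : ∀ ε, pt ε a₂ = A + ε • u := fun ε => by simp [pt]
  have p3 : ∀ ε, pt ε w = A + ((ε / 2) • u + ε ^ 2 • v) := fun ε => by simp [pt, hw₂]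
  have p4 : ∀ ε x, x ≠ a₂ → x ≠ w → pt ε x = pt₀ x := fun ε x h2 h3 => by simp [pt, h2, h3]
  have hc : ∀ x, Continuous fun ε => pt ε x := by
    intro x
    by_cases h2 : x = a₂
    · subst h2
      simp_rw [p2]
      fun_prop
    by_cases h3 : x = w
    · subst h3
      simp_rw [p3]
      fun_prop
    · simp_rw [p4 _ x h2 h3]
      fun_prop
  have h0 : ∀ x, pt 0 x = pt₀ x := by
    intro x
    by_cases h2 : x = a₂
    · subst h2
      rw [p2, e₂]; simp
    by_cases h3 : x = w
    · subst h3
      rw [p3, e₃]; simp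
    · exact p4 0 x h2 h3
  have harea : ∀ {f g k : ℝ → E 2}, Continuous f → Continuous g → Continuous k →
      Continuous fun ε => area (f ε) (g ε) (k ε) := by
    intro f g k hf hg hk
    unfold area
    fun_prop
  have E0 : ∀ᶠ ε in 𝓝[>] (0 : ℝ), ∀ x y z, 0 < area (pt₀ x) (pt₀ y) (pt₀ z) →
      0 < area (pt ε x) (pt ε y) (pt ε z) := by
    simp_rw [eventually_all]
    intro x y z h
    exact eventually_pos _ (harea (hc x) (hc y) (hc z)) (by simpa [h0] using h) fun _ => rfl
  have E1 : ∀ᶠ ε in 𝓝[>] (0 : ℝ), ∀ x, x ≠ a₁ → x ≠ a₂ → x ≠ w →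
      0 < area (pt ε a₁) (pt ε a₂) (pt ε x) ∧
        0 < area (pt ε a₁) (pt ε w) (pt ε x) ∧ 0 < area (pt ε w) (pt ε a₂) (pt ε x) := by
    simp_rw [eventually_all]
    intro x h1 h2 h3
    have h := hu x h1 h2 h3
    simp only [p1, p2, p3, p4 _ x h2 h3]
    refine Eventually.and ?_ (Eventually.and ?_ ?_)
    · refine eventually_pos_of_eq_mul (fun ε => area A (A + u) (pt₀ x)) (by fun_prop) h fun ε => ?_
      simp [area]; ring
    · refine eventually_pos_of_eq_mul (fun ε => (u 0 / 2 + ε * v 0) * (pt₀ x 1 - A 1) -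
        (u 1 / 2 + ε * v 1) * (pt₀ x 0 - A 0)) (by fun_prop) ?_ fun ε => ?_
      · simp [area] at h ⊢
        linarith
      · simp only [area, PiLp.add_apply, PiLp.smul_apply, smul_eq_mul]; ring
    · refine eventually_pos_of_eq_mul (fun ε => (u 0 / 2 - ε * v 0) *
        (pt₀ x 1 - A 1 - (ε / 2 * u 1 + ε ^ 2 * v 1)) -
        (u 1 / 2 - ε * v 1) * (pt₀ x 0 - A 0 - (ε / 2 * u 0 + ε ^ 2 * v 0)))
        (by fun_prop) ?_ fun ε => ?_
      · simp [area] at h ⊢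
        linarith
      · simp only [area, PiLp.add_apply, PiLp.smul_apply, smul_eq_mul]; ring
  have E2 : ∀ᶠ ε in 𝓝[>] (0 : ℝ), 0 < area (pt ε a₁) (pt ε a₂) (pt ε w) := by
    have h := hu z hz.1 hz.2.1 hz.2.2
    filter_upwards [self_mem_nhdsWithin] with ε hε
    have : area (pt ε a₁) (pt ε a₂) (pt ε w) = ε ^ 3 * area A (A + u) (pt₀ z) := by
      rw [p1, p2, p3]
      simp only [area, hv, PiLp.add_apply, PiLp.smul_apply, PiLp.sub_apply, smul_eq_mul]
      ring
    rw [this]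
    exact mul_pos (pow_pos hε 3) h
  have E3 : ∀ᶠ ε in 𝓝[>] (0 : ℝ), ∀ x, x ≠ a₁ →
      0 < area (pt ε a₁) (pt ε a₁ + (u + s • r)) (pt ε x) := by
    rw [eventually_all]
    intro x
    by_cases h1 : x = a₁
    · exact Eventually.of_forall fun ε h => absurd h1 h
    by_cases h2 : x = a₂
    · subst h2
      simp only [p1, p2]
      refine (eventually_pos_of_eq_mul (fun ε => s * (r 0 * u 1 - r 1 * u 0)) (by fun_prop)
        hsr fun ε => ?_).mono fun ε h _ => h
      simp only [area, PiLp.add_apply, PiLp.smul_apply, smul_eq_mul]; ring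
    by_cases h3 : x = w
    · subst h3
      simp only [p1, p3]
      refine (eventually_pos_of_eq_mul (fun ε => s * (r 0 * u 1 - r 1 * u 0) / 2 +
        ε * ((u 0 + s * r 0) * v 1 - (u 1 + s * r 1) * v 0)) (by fun_prop) (by linarith)
        fun ε => ?_).mono fun ε h _ => h
      simp only [area, PiLp.add_apply, PiLp.smul_apply, smul_eq_mul]; ring
    · simp only [p1, p4 _ x h2 h3]
      exact Eventually.of_forall fun ε _ => (hs x h1 h2 h3).1
  have E4 : ∀ᶠ ε in 𝓝[>] (0 : ℝ), ∀ x, x ≠ a₁ → x ≠ w →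
      0 < area (pt ε w) (pt ε w + (u + s • r)) (pt ε x) := by
    rw [eventually_all]
    intro x
    by_cases h1 : x = a₁
    · exact Eventually.of_forall fun ε h => absurd h1 h
    by_cases h3 : x = w
    · exact Eventually.of_forall fun ε _ h => absurd h3 h
    by_cases h2 : x = a₂
    · subst h2
      simp only [p3, p2]
      refine (eventually_pos_of_eq_mul (fun ε => s * (r 0 * u 1 - r 1 * u 0) / 2 -
        ε * ((u 0 + s * r 0) * v 1 - (u 1 + s * r 1) * v 0)) (by fun_prop) (by linarith)
        fun ε => ?_).mono fun ε h _ _ => h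
      simp only [area, PiLp.add_apply, PiLp.smul_apply, smul_eq_mul]; ring
    · refine (eventually_pos _ (harea (hc w) (by fun_prop) (hc x)) ?_
        fun _ => rfl).mono fun ε h _ _ => h
      simpa [h0, e₃] using (hs x h1 h2 h3).1
  have E5 : ∀ᶠ ε in 𝓝[>] (0 : ℝ), ∀ x, x ≠ a₂ →
      0 < area (pt ε a₂) (pt ε a₂ + (u - s • r)) (pt ε x) := by
    rw [eventually_all]
    intro x
    by_cases h2 : x = a₂
    · exact Eventually.of_forall fun ε h => absurd h2 h
    by_cases h1 : x = a₁
    · subst h1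
      simp only [p1, p2]
      refine (eventually_pos_of_eq_mul (fun ε => s * (r 0 * u 1 - r 1 * u 0)) (by fun_prop)
        hsr fun ε => ?_).mono fun ε h _ => h
      simp only [area, PiLp.add_apply, PiLp.smul_apply, PiLp.sub_apply, smul_eq_mul]; ring
    by_cases h3 : x = w
    · subst h3
      simp only [p2, p3]
      refine (eventually_pos_of_eq_mul (fun ε => s * (r 0 * u 1 - r 1 * u 0) / 2 +
        ε * ((u 0 - s * r 0) * v 1 - (u 1 - s * r 1) * v 0)) (by fun_prop) (by linarith)
        fun ε => ?_).mono fun ε h _ => h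
      simp only [area, PiLp.add_apply, PiLp.smul_apply, PiLp.sub_apply, smul_eq_mul]; ring
    · refine (eventually_pos _ (harea (hc a₂) (by fun_prop) (hc x)) ?_
        fun _ => rfl).mono fun ε h _ => h
      simpa [h0, e₂] using (hs x h1 h2 h3).2
  have E6 : ∀ᶠ ε in 𝓝[>] (0 : ℝ), ∀ x, x ≠ a₂ → x ≠ w →
      0 < area (pt ε w) (pt ε w + (u - s • r)) (pt ε x) := by
    rw [eventually_all]
    intro x
    by_cases h2 : x = a₂
    · exact Eventually.of_forall fun ε h => absurd h2 h
    by_cases h3 : x = w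
    · exact Eventually.of_forall fun ε _ h => absurd h3 h
    by_cases h1 : x = a₁
    · subst h1
      simp only [p3, p1]
      refine (eventually_pos_of_eq_mul (fun ε => s * (r 0 * u 1 - r 1 * u 0) / 2 -
        ε * ((u 0 - s * r 0) * v 1 - (u 1 - s * r 1) * v 0)) (by fun_prop) (by linarith)
        fun ε => ?_).mono fun ε h _ _ => h
      simp only [area, PiLp.add_apply, PiLp.smul_apply, PiLp.sub_apply, smul_eq_mul]; ring
    · refine (eventually_pos _ (harea (hc w) (by fun_prop) (hc x)) ?_
        fun _ => rfl).mono fun ε h _ _ => h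
      simpa [h0, e₃] using (hs x h1 h2 h3).2
  have E7 : ∀ᶠ ε in 𝓝[>] (0 : ℝ), ∀ a, (∃ q, ∀ x, x ≠ a → 0 < area (pt₀ a) q (pt₀ x)) →
        ∃ q, ∀ x, x ≠ a → 0 < area (pt ε a) q (pt ε x) := by
    simp_rw [eventually_all]
    rintro a ⟨q, hq⟩
    have : ∀ᶠ ε in 𝓝[>] (0 : ℝ), ∀ x, x ≠ a → 0 < area (pt ε a) q (pt ε x) := by
      simp_rw [eventually_all]
      intro x hx
      exact eventually_pos _ (harea (hc a) (by fun_prop) (hc x))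
        (by simpa [h0] using hq x hx) fun _ => rfl
    exact this.mono fun ε h => ⟨q, h⟩
  obtain ⟨ε, f0, f1, f2, f3, f4, f5, f6, f7⟩ :=
    (E0.and (E1.and (E2.and (E3.and (E4.and (E5.and (E6.and E7))))))).exists
  exact ⟨pt ε, fun x => p4 ε x, f0, f1, f2, ⟨_, f3⟩, ⟨_, f4⟩, ⟨_, f5⟩, ⟨_, f6⟩, f7⟩

end Splitting

/-! ### Realizing a tripod system in the plane -/

/-- The points `pt` realize a tripod system in the plane: the order of the leaves is their
orientation, they are strict vertices of the convex hull of all points, no branching point is on a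
line through two leaves, and the branching point of three leaves is the one in their triangle. -/
structure IsPlanarRealization {ι κ : Type*} (pt : ι → E 2) (B : Set ι) (o : ι → ι → ι → Prop)
    (br : ι → ι → κ) : Prop where
  order : ∀ i j k, i ∈ B → j ∈ B → k ∈ B → o i j k → 0 < area (pt i) (pt j) (pt k)
  splits : ∀ w i j k, w ∉ B → i ∈ B → j ∈ B → k ∈ B →
    (Splits (br w) i j k ↔ InTri (pt i) (pt j) (pt k) (pt w))
  nz : ∀ i j w, i ∈ B → j ∈ B → w ∉ B → i ≠ j → area (pt i) (pt j) (pt w) ≠ 0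
  exposed : ∀ a ∈ B, ∃ q, ∀ x, x ≠ a → 0 < area (pt a) q (pt x)

theorem InTri.congr {p q r w p' q' r' w' : E 2}
    (h₁ : 0 < area p q w → 0 < area p' q' w') (h₁' : area p q w < 0 → area p' q' w' < 0)
    (h₂ : 0 < area q r w → 0 < area q' r' w') (h₂' : area q r w < 0 → area q' r' w' < 0)
    (h₃ : 0 < area r p w → 0 < area r' p' w') (h₃' : area r p w < 0 → area r' p' w' < 0)
    (h : InTri p q r w) : InTri p' q' r' w' :=
  h.imp (fun h => ⟨h₁ h.1, h₂ h.2.1, h₃ h.2.2⟩) (fun h => ⟨h₁' h.1, h₂' h.2.1, h₃' h.2.2⟩)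

theorem TripodSystem.area_ne_zero {ι κ : Type*} {B : Set ι} {o : ι → ι → ι → Prop}
    {br : ι → ι → κ} {pt : ι → E 2} (h : TripodSystem B o br)
    (hp : ∀ i j k, i ∈ B → j ∈ B → k ∈ B → o i j k → 0 < area (pt i) (pt j) (pt k))
    {i j k : ι} (hi : i ∈ B) (hj : j ∈ B) (hk : k ∈ B) (hij : i ≠ j) (hjk : j ≠ k) (hki : k ≠ i) :
    area (pt i) (pt j) (pt k) ≠ 0 := by
  rcases h.total hi hj hk hij hjk hki with e | e
  · exact (hp i j k hi hj hk e).ne'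
  · have := hp k j i hk hj hi e
    rw [area_rot, area_swap, neg_pos] at this
    exact this.ne

/-- From a realization without the leaf `a₂` and the branching point `w` of a cherry, one obtains a
realization with them by splitting the point `a₁` into `a₁`, `a₂` and `w`. -/
theorem IsPlanarRealization.of_cherry {ι κ : Type*} [Finite ι] {B : Set ι}
    {o : ι → ι → ι → Prop} {br : ι → ι → κ} {a₁ a₂ w : ι} (h : TripodSystem B o br)
    (hB : 3 ≤ B.ncard) (hc : IsCherry B o br a₁ a₂ w) {pt' : {i : ι // i ≠ a₂ ∧ i ≠ w} → E 2}
    (hp : IsPlanarRealization pt' {i | i.1 ∈ B} (fun i j k => o i.1 j.1 k.1)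
      (fun v i => br v.1 i.1)) : ∃ pt : ι → E 2, IsPlanarRealization pt B o br := by
  classical
  have hw₁ : w ≠ a₁ := by rintro rfl; exact hc.notMem hc.mem₁
  have hw₂ : w ≠ a₂ := by rintro rfl; exact hc.notMem hc.mem₂
  have hBw : ∀ {i}, i ∈ B → i ≠ w := by rintro i hi rfl; exact hc.notMem hi
  let A : {i : ι // i ≠ a₂ ∧ i ≠ w} := ⟨a₁, hc.ne, hw₁.symm⟩
  -- `π` undoes the splitting
  let π : ι → {i : ι // i ≠ a₂ ∧ i ≠ w} := fun x => if hx : x ≠ a₂ ∧ x ≠ w then ⟨x, hx⟩ else A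
  have π1 : ∀ x (hx : x ≠ a₂ ∧ x ≠ w), π x = ⟨x, hx⟩ := fun x hx => by simp [π, hx]
  have πa₁ : π a₁ = A := π1 a₁ _
  have πa₂ : π a₂ = A := by simp [π]
  have πw : π w = A := by simp [π]
  have πB : ∀ {x}, x ∈ B → (π x).1 ∈ B := by
    intro x hx
    by_cases h2 : x = a₂
    · rw [h2, πa₂]; exact hc.mem₁
    · rw [π1 x ⟨h2, hBw hx⟩]; exact hx
  have πne : ∀ {i j}, i ∈ B → j ∈ B → i ≠ j → (i = a₁ → j ≠ a₂) → (i = a₂ → j ≠ a₁) →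
      π i ≠ π j := by
    intro i j hi hj hij h1 h2
    by_cases hi2 : i = a₂
    · rw [hi2, πa₂]
      have hj2 : j ≠ a₂ := fun e => hij (hi2.trans e.symm)
      rw [π1 j ⟨hj2, hBw hj⟩]
      exact fun e => h2 hi2 (congrArg Subtype.val e).symm
    · rw [π1 i ⟨hi2, hBw hi⟩]
      by_cases hj2 : j = a₂
      · rw [hj2, πa₂]
        exact fun e => h1 (congrArg Subtype.val e) hj2
      · rw [π1 j ⟨hj2, hBw hj⟩]
        exact fun e => hij (congrArg Subtype.val e)
  obtain ⟨z, hz, hz'⟩ : ∃ z ∈ B, z ∉ ({a₁, a₂} : Set ι) := by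
    refine Set.exists_mem_notMem_of_ncard_lt_ncard ?_ (Set.toFinite _)
    rw [Set.ncard_pair hc.ne]
    omega
  simp only [Set.mem_insert_iff, Set.mem_singleton_iff, not_or] at hz'
  obtain ⟨q, hq⟩ := hp.exposed A hc.mem₁
  obtain ⟨pt, hold, f0, f1, f2, f3, f4, f5, f6, f7⟩ := exists_splitting (pt₀ := fun x => pt' (π x))
    (u := q - pt' A) hc.ne hw₁ hw₂ ⟨hz'.1, hz'.2, hBw hz⟩ (by rw [πa₁, πa₂]) (by rw [πa₁, πw])
    (fun x h1 h2 h3 => by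
      rw [πa₁, add_sub_cancel, π1 x ⟨h2, h3⟩]
      exact hq _ fun e => h1 (congrArg Subtype.val e))
  have f0' : ∀ x y z, area (pt' (π x)) (pt' (π y)) (pt' (π z)) < 0 →
      area (pt x) (pt y) (pt z) < 0 := by
    intro x y z hs
    have := f0 y x z (by rw [area_swap]; linarith)
    rw [area_swap] at this
    linarith
  have f0n : ∀ x y z, area (pt' (π x)) (pt' (π y)) (pt' (π z)) ≠ 0 →
      area (pt x) (pt y) (pt z) ≠ 0 := fun x y z hs =>
    (lt_or_gt_of_ne hs).elim (fun hs => (f0' x y z hs).ne) (fun hs => (f0 x y z hs).ne')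
  have hR := h.restrict hc
  -- orientation
  have hord₂ : ∀ j k, j ∈ B → k ∈ B → o a₂ j k → 0 < area (pt a₂) (pt j) (pt k) := by
    intro j k hj hk hjk
    obtain ⟨n1, n2, n3⟩ := h.ne_of_order hc.mem₂ hj hk hjk
    have hj1 : j ≠ a₁ := by
      rintro rfl
      exact h.asymm hc.mem₁ hk hc.mem₂ (h.cyc hc.mem₂ hc.mem₁ hk hjk)
        (h.cyc hc.mem₁ hc.mem₂ hk (hc.order k hk n2.symm n3))
    by_cases hk1 : k = a₁
    · subst hk1
      rw [← area_rot]
      exact (f1 j hj1 n1.symm (hBw hj)).1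
    rw [h.order_cherry hc hj hk hj1 n1.symm hk1 n3] at hjk
    refine f0 _ _ _ ?_
    rw [πa₂, π1 j ⟨n1.symm, hBw hj⟩, π1 k ⟨n3, hBw hk⟩]
    exact hp.order _ _ _ hc.mem₁ hj hk hjk
  have hord : ∀ i j k, i ∈ B → j ∈ B → k ∈ B → o i j k → 0 < area (pt i) (pt j) (pt k) := by
    intro i j k hi hj hk ho
    by_cases hi2 : i = a₂
    · subst hi2
      exact hord₂ j k hj hk ho
    by_cases hj2 : j = a₂
    · subst hj2
      rw [area_rot]
      exact hord₂ k i hk hi (h.cyc hi hj hk ho)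
    by_cases hk2 : k = a₂
    · subst hk2
      rw [← area_rot]
      exact hord₂ i j hi hj (h.cyc hj hk hi (h.cyc hi hj hk ho))
    rw [hold i hi2 (hBw hi), hold j hj2 (hBw hj), hold k hk2 (hBw hk), π1 i ⟨hi2, hBw hi⟩,
      π1 j ⟨hj2, hBw hj⟩, π1 k ⟨hk2, hBw hk⟩]
    exact hp.order _ _ _ hi hj hk ho
  -- nondegeneracy
  have hnz₀ : ∀ i j b, i ∈ B → j ∈ B → b ∉ B → b ≠ w → i ≠ j → (i = a₁ → j ≠ a₂) →
      (i = a₂ → j ≠ a₁) → area (pt' (π i)) (pt' (π j)) (pt' (π b)) ≠ 0 := by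
    intro i j b hi hj hb hbw hij h1 h2
    have hb2 : b ≠ a₂ := by rintro rfl; exact hb hc.mem₂
    rw [π1 b ⟨hb2, hbw⟩]
    exact hp.nz _ _ _ (πB hi) (πB hj) hb (πne hi hj hij h1 h2)
  have hnz₁ : ∀ i j b, i ∈ B → j ∈ B → b ∉ B → i ≠ j → i = a₁ →
      area (pt i) (pt j) (pt b) ≠ 0 := by
    rintro i j b hi hj hb hij rfl
    by_cases hj2 : j = a₂
    · subst hj2
      by_cases hbw : b = w
      · subst hbw; exact f2.ne'
      · exact (f1 b (by rintro rfl; exact hb hi) (by rintro rfl; exact hb hj) hbw).1.ne'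
    · by_cases hbw : b = w
      · subst hbw
        have := (f1 j hij.symm hj2 (hBw hj)).2.1
        rw [area_swap'] at this
        exact (neg_pos.1 this).ne
      · exact f0n _ _ _ (hnz₀ i j b hi hj hb hbw hij (fun _ => hj2) (fun e => absurd e hc.ne))
  have hnz₂ : ∀ i j b, i ∈ B → j ∈ B → b ∉ B → i ≠ j → i = a₂ →
      area (pt i) (pt j) (pt b) ≠ 0 := by
    rintro i j b hi hj hb hij rfl
    by_cases hj1 : j = a₁
    · rw [area_swap]
      exact neg_ne_zero.2 (hnz₁ j i b hj hi hb hij.symm hj1)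
    · by_cases hbw : b = w
      · subst hbw
        have := (f1 j hj1 hij.symm (hBw hj)).2.2
        rw [area_rot] at this
        exact this.ne'
      · exact f0n _ _ _ (hnz₀ i j b hi hj hb hbw hij (fun e => absurd e hc.ne.symm) (fun _ => hj1))
  have hnz : ∀ i j b, i ∈ B → j ∈ B → b ∉ B → i ≠ j → area (pt i) (pt j) (pt b) ≠ 0 := by
    intro i j b hi hj hb hij
    by_cases hi1 : i = a₁
    · exact hnz₁ i j b hi hj hb hij hi1
    by_cases hi2 : i = a₂
    · exact hnz₂ i j b hi hj hb hij hi2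
    by_cases hj1 : j = a₁
    · rw [area_swap]
      exact neg_ne_zero.2 (hnz₁ j i b hj hi hb hij.symm hj1)
    by_cases hj2 : j = a₂
    · rw [area_swap]
      exact neg_ne_zero.2 (hnz₂ j i b hj hi hb hij.symm hj2)
    by_cases hbw : b = w
    · subst hbw
      refine f0n _ _ _ ?_
      rw [πw, ← πa₁]
      have := hR.area_ne_zero hp.order (i := π i) (j := π j) (k := π a₁) (πB hi) (πB hj)
        (πB hc.mem₁) (πne hi hj hij (fun e => absurd e hi1) (fun e => absurd e hi2))
        (πne hj hc.mem₁ hj1 (fun e => absurd e hj1) (fun e => absurd e hj2))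
        (πne hc.mem₁ hi (Ne.symm hi1) (fun _ => hi2) (fun e => absurd e hc.ne))
      exact this
    · exact f0n _ _ _ (hnz₀ i j b hi hj hb hbw hij (fun e => absurd e hi1) (fun e => absurd e hi2))
  -- the triangles that contain the new white point
  have hperm : ∀ M : ι → ι → ι → Prop, (∀ i j k, M i j k → M j k i) → (∀ i j k, M i j k → M j i k) →
      (∀ x, x ∈ B → x ≠ a₁ → x ≠ a₂ → M a₁ a₂ x) → ∀ i j k, i ∈ B → j ∈ B → k ∈ B →
      i ≠ j → j ≠ k → k ≠ i → (a₁ = i ∨ a₁ = j ∨ a₁ = k) → (a₂ = i ∨ a₂ = j ∨ a₂ = k) → M i j k := by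
    intro M rot swap hM i j k hi hj hk hij hjk hki m1 m2
    have hne := hc.ne
    rcases m1 with e | e | e <;> rcases m2 with e' | e' | e' <;> subst e
    · exact absurd e'.symm hne
    · subst e'; exact hM k hk hki hjk.symm
    · subst e'; exact rot _ _ _ (swap _ _ _ (hM j hj hij.symm hjk))
    · subst e'; exact swap _ _ _ (hM k hk hjk.symm hki)
    · exact absurd e'.symm hne
    · subst e'; exact rot _ _ _ (rot _ _ _ (hM i hi hij hki.symm))
    · subst e'; exact rot _ _ _ (hM j hj hjk hij.symm)
    · subst e'; exact rot _ _ _ (rot _ _ _ (swap _ _ _ (hM i hi hki.symm hij)))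
    · exact absurd e'.symm hne
  have hspl_w : ∀ i j k, i ∈ B → j ∈ B → k ∈ B →
      (Splits (br w) i j k ↔ InTri (pt i) (pt j) (pt k) (pt w)) := by
    intro i j k hi hj hk
    constructor
    · intro s
      have nij : i ≠ j := fun e => s.1 (by rw [e])
      have njk : j ≠ k := fun e => s.2.1 (by rw [e])
      have nki : k ≠ i := fun e => s.2.2 (by rw [e])
      have hcls : ∀ a ∈ B, ∀ b ∈ B, a ≠ a₁ → a ≠ a₂ → b ≠ a₁ → b ≠ a₂ → br w a = br w b :=
        fun a ha b hb h1 h2 h3 h4 => h.splits_cherry hc ha hb h1 h2 h3 h4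
      have hin : ∀ x y, (∀ a ∈ B, ∀ b ∈ B, a ≠ x → a ≠ y → b ≠ x → b ≠ y → br w a = br w b) →
          x = i ∨ x = j ∨ x = k := by
        intro x y hxy
        by_contra hcon
        push Not at hcon
        by_cases hiy : i = y
        · exact s.2.1 (hxy j hj k hk hcon.2.1.symm (fun e => nij (hiy.trans e.symm))
            hcon.2.2.symm (fun e => nki (e.trans hiy.symm)))
        by_cases hjy : j = y
        · exact s.2.2 (hxy k hk i hi hcon.2.2.symm (fun e => njk (hjy.trans e.symm))
            hcon.1.symm hiy)
        · exact s.1 (hxy i hi j hj hcon.1.symm hiy hcon.2.1.symm hjy)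
      refine hperm (fun i j k => InTri (pt i) (pt j) (pt k) (pt w)) (fun _ _ _ => InTri.rot)
        (fun _ _ _ => InTri.swap) ?_ i j k hi hj hk nij njk nki ?_ ?_
      · intro x hx h1 h2
        have g := f1 x h1 h2 (hBw hx)
        refine Or.inl ⟨f2, ?_, ?_⟩
        · rw [← area_rot]; exact g.2.2
        · rw [area_rot]; exact g.2.1
      · exact hin a₁ a₂ hcls
      · exact hin a₂ a₁ fun a ha b hb h1 h2 h3 h4 => hcls a ha b hb h2 h1 h4 h3
    · intro hM
      obtain ⟨nij, njk, nki⟩ := hM.ne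
      refine hperm (fun i j k => Splits (br w) i j k) (fun _ _ _ => Splits.rot)
        (fun _ _ _ => Splits.swap) hc.splits i j k hi hj hk nij njk nki ?_ ?_
      · by_contra hcon
        push Not at hcon
        obtain ⟨q, hq⟩ := f4
        exact not_inTri_of_exposed (hq i hcon.1.symm (hBw hi)) (hq j hcon.2.1.symm (hBw hj))
          (hq k hcon.2.2.symm (hBw hk)) hM
      · by_contra hcon
        push Not at hcon
        obtain ⟨q, hq⟩ := f6
        exact not_inTri_of_exposed (hq i hcon.1.symm (hBw hi)) (hq j hcon.2.1.symm (hBw hj))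
          (hq k hcon.2.2.symm (hBw hk)) hM
  -- the triangles that contain an old white point
  have hspl₂ : ∀ b j k, b ∉ B → b ≠ w → j ∈ B → k ∈ B → j ≠ a₂ → k ≠ a₂ →
      (Splits (br b) a₂ j k ↔ InTri (pt a₂) (pt j) (pt k) (pt b)) := by
    intro b j k hb hbw hj hk hj2 hk2
    have hb2 : b ≠ a₂ := by rintro rfl; exact hb hc.mem₂
    have hbr := h.br_cherry hc hb hbw
    by_cases hjk : j = k
    · subst hjk
      exact iff_of_false (fun s => s.2.1 rfl) (fun s => s.ne.2.1 rfl)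
    have bad : ∀ k, k ∈ B → k ≠ a₂ → ¬ InTri (pt a₂) (pt a₁) (pt k) (pt b) := by
      intro k hk hk2 hM
      have hk1 := hM.ne.2.1.symm
      have e : area (pt a₁) (pt k) (pt b) = -area (pt k) (pt a₁) (pt b) := area_swap _ _ _
      have hn := hnz₀ k a₁ b hk hc.mem₁ hb hbw hk1 (fun e => absurd e hk1) (fun e => absurd e hk2)
      rcases lt_or_gt_of_ne hn with s | s
      · have s1 := f0' _ _ _ s
        have s2 := f0' k a₂ b (by rw [πa₂, ← πa₁]; exact s)
        rcases hM with ⟨-, h2, h3⟩ | ⟨-, h2, h3⟩ <;> linarith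
      · have s1 := f0 _ _ _ s
        have s2 := f0 k a₂ b (by rw [πa₂, ← πa₁]; exact s)
        rcases hM with ⟨-, h2, h3⟩ | ⟨-, h2, h3⟩ <;> linarith
    by_cases hj1 : j = a₁
    · subst hj1
      exact iff_of_false (fun s => s.1 hbr.symm) (bad k hk hk2)
    by_cases hk1 : k = a₁
    · subst hk1
      exact iff_of_false (fun s => s.2.2 hbr) (fun s => bad j hj hj2 s.swap')
    have e1 := hp.splits ⟨b, hb2, hbw⟩ A ⟨j, hj2, hBw hj⟩ ⟨k, hk2, hBw hk⟩ hb hc.mem₁ hj hk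
    have e2 : Splits (br b) a₂ j k ↔ Splits (fun i => br b i.1) A ⟨j, hj2, hBw hj⟩
        ⟨k, hk2, hBw hk⟩ := by
      simp only [Splits, A, hbr]
    rw [e2, e1, ← πa₂, ← π1 b, ← π1 j, ← π1 k]
    have n1 := hnz₀ a₂ j b hc.mem₂ hj hb hbw hj2.symm (fun e => absurd e hc.ne.symm) (fun _ => hj1)
    have n2 := hnz₀ j k b hj hk hb hbw hjk (fun _ => hk2) (fun _ => hk1)
    have n3 := hnz₀ k a₂ b hk hc.mem₂ hb hbw hk2 (fun e => absurd e hk1) (fun e => absurd e hk2)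
    constructor
    · exact InTri.congr (f0 _ _ _) (f0' _ _ _) (f0 _ _ _) (f0' _ _ _) (f0 _ _ _) (f0' _ _ _)
    · have back : ∀ {x y z}, area (pt' (π x)) (pt' (π y)) (pt' (π z)) ≠ 0 →
          (0 < area (pt x) (pt y) (pt z) → 0 < area (pt' (π x)) (pt' (π y)) (pt' (π z))) ∧
          (area (pt x) (pt y) (pt z) < 0 → area (pt' (π x)) (pt' (π y)) (pt' (π z)) < 0) := by
        intro x y z hn
        rcases lt_or_gt_of_ne hn with s | s
        · exact ⟨fun c => absurd c (f0' _ _ _ s).not_gt, fun _ => s⟩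
        · exact ⟨fun _ => s, fun c => absurd c (f0 _ _ _ s).not_gt⟩
      exact InTri.congr (back n1).1 (back n1).2 (back n2).1 (back n2).2 (back n3).1 (back n3).2
  have rotM : ∀ {b i j k}, InTri (pt i) (pt j) (pt k) (pt b) ↔ InTri (pt j) (pt k) (pt i) (pt b) :=
    ⟨InTri.rot, fun s => s.rot.rot⟩
  have rotS : ∀ {b i j k}, Splits (br b) i j k ↔ Splits (br b) j k i :=
    ⟨Splits.rot, fun s => s.rot.rot⟩
  refine ⟨pt, hord, ?_, hnz, ?_⟩
  · intro b i j k hb hi hj hk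
    by_cases hbw : b = w
    · subst hbw
      exact hspl_w i j k hi hj hk
    by_cases hij : i = j
    · subst hij
      exact iff_of_false (fun s => s.1 rfl) (fun s => s.ne.1 rfl)
    by_cases hjk : j = k
    · subst hjk
      exact iff_of_false (fun s => s.2.1 rfl) (fun s => s.ne.2.1 rfl)
    by_cases hki : k = i
    · subst hki
      exact iff_of_false (fun s => s.2.2 rfl) (fun s => s.ne.2.2 rfl)
    by_cases hi2 : i = a₂
    · subst hi2
      exact hspl₂ b j k hb hbw hj hk (Ne.symm hij) hki
    by_cases hj2 : j = a₂
    · subst hj2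
      rw [rotM, rotS]
      exact hspl₂ b k i hb hbw hk hi (Ne.symm hjk) hij
    by_cases hk2 : k = a₂
    · subst hk2
      rw [← rotM, ← rotS]
      exact hspl₂ b i j hb hbw hi hj hi2 hj2
    have hb2 : b ≠ a₂ := by rintro rfl; exact hb hc.mem₂
    rw [hold i hi2 (hBw hi), hold j hj2 (hBw hj), hold k hk2 (hBw hk), hold b hb2 hbw,
      π1 i ⟨hi2, hBw hi⟩, π1 j ⟨hj2, hBw hj⟩, π1 k ⟨hk2, hBw hk⟩, π1 b ⟨hb2, hbw⟩]
    exact hp.splits ⟨b, hb2, hbw⟩ ⟨i, hi2, hBw hi⟩ ⟨j, hj2, hBw hj⟩ ⟨k, hk2, hBw hk⟩ hb hi hj hk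
  · intro a ha
    by_cases ha1 : a = a₁
    · subst ha1; exact f3
    by_cases ha2 : a = a₂
    · subst ha2; exact f5
    refine f7 a ?_
    obtain ⟨q, hq⟩ := hp.exposed ⟨a, ha2, hBw ha⟩ ha
    refine ⟨q, fun x hx => ?_⟩
    rw [π1 a ⟨ha2, hBw ha⟩]
    refine hq _ fun e => ?_
    by_cases hx' : x ≠ a₂ ∧ x ≠ w
    · rw [π1 x hx'] at e
      exact hx (congrArg Subtype.val e)
    · simp only [π, hx', dif_neg, not_false_eq_true] at e
      exact ha1 (congrArg Subtype.val e).symm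

theorem TripodSystem.exists_planarRealization {κ : Type*} {ι : Type u} [Finite ι] {B : Set ι}
    {o : ι → ι → ι → Prop} {br : ι → ι → κ} (h : TripodSystem B o br) (hB : 2 ≤ B.ncard) :
    ∃ pt : ι → E 2, IsPlanarRealization pt B o br := by
  classical
  refine cherry_induction (P := fun ι B o br => ∃ pt : ι → E 2, IsPlanarRealization pt B o br)
    ?_ ?_ h hB
  · intro ι B o br _ h hB
    have hall : ∀ x, x ∈ B := fun x => h.eq_empty_of_ncard_two (Set.toFinite _) hB
    obtain ⟨i, j, hij, rfl⟩ := Set.ncard_eq_two.1 hB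
    refine ⟨fun x => if x = i then 0 else !₂[1, 0], ?_, ?_, ?_, ?_⟩
    · intro a b c ha hb hc ho
      obtain ⟨n1, n2, n3⟩ := h.ne_of_order ha hb hc ho
      simp only [Set.mem_insert_iff, Set.mem_singleton_iff] at ha hb hc
      grind
    · exact fun w _ _ _ hw => absurd (hall w) hw
    · exact fun _ _ w _ _ hw => absurd (hall w) hw
    · intro a _
      by_cases ha : a = i
      · subst ha
        refine ⟨!₂[0, -1], fun x hx => ?_⟩
        simp [hx, area]
      · refine ⟨!₂[1, 1], fun x hx => ?_⟩
        have hx' : x = i := by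
          have h1 := hall x
          have h2 := hall a
          simp only [Set.mem_insert_iff, Set.mem_singleton_iff] at h1 h2
          grind
        simp [ha, hx', area]
  · rintro ι B o br a₁ a₂ w _ h hB hc ⟨pt', hp⟩
    exact IsPlanarRealization.of_cherry h hB hc hp

/-- Every tripod system is the system of a tripod diagram. -/
theorem TripodSystem.exists_isTripodDiagram {κ : Type*} {ι : Type u} [Finite ι] {B : Set ι}
    {o : ι → ι → ι → Prop} {br : ι → ι → κ} (h : TripodSystem B o br) (hB : 2 ≤ B.ncard) :
    ∃ pt : ι → E 2, IsTripodDiagram pt B ∧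
      (∀ i j k, i ∈ B → j ∈ B → k ∈ B → (o i j k ↔ 0 < area (pt i) (pt j) (pt k))) ∧
      ∀ w i j k, w ∉ B → i ∈ B → j ∈ B → k ∈ B →
        (Splits (br w) i j k ↔ InTri (pt i) (pt j) (pt k) (pt w)) := by
  obtain ⟨pt, hp⟩ := h.exists_planarRealization hB
  refine ⟨pt, ⟨⟨hp.exposed, ?_, ?_⟩, ?_, ?_⟩, ?_, hp.splits⟩
  · intro i j x hi hj hij hxi hxj
    by_cases hx : x ∈ B
    · exact h.area_ne_zero hp.order hi hj hx hij hxj.symm hxi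
    · exact hp.nz i j x hi hj hx hij
  · intro i j k hi hj hk h1 h2 h3
    obtain ⟨w, hw, s⟩ := h.ex hi hj hk h1 h2 h3
    exact ⟨w, hw, (hp.splits w i j k hw hi hj hk).1 s⟩
  · intro w w' i j k hw hw' hi hj hk s s'
    exact h.un hw hw' hi hj hk ((hp.splits w i j k hw hi hj hk).2 s)
      ((hp.splits w' i j k hw' hi hj hk).2 s')
  · intro w hw
    obtain ⟨i, hi, j, hj, k, hk, s⟩ := h.surj hw
    exact ⟨i, hi, j, hj, k, hk, (hp.splits w i j k hw hi hj hk).1 s⟩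
  · intro i j k hi hj hk
    refine ⟨hp.order i j k hi hj hk, fun hpos => ?_⟩
    have n1 : i ≠ j := by rintro rfl; simp at hpos
    have n2 : j ≠ k := by rintro rfl; simp at hpos
    have n3 : k ≠ i := by rintro rfl; simp at hpos
    refine (h.total hi hj hk n1 n2 n3).resolve_right fun e => ?_
    have := hp.order k j i hk hj hi e
    rw [area_rot, area_swap] at this
    linarith

/-! ### Gale duality -/

/-- A function on a configuration `a` that is orthogonal to all affine dependencies is affine. -/
theorem exists_affine_of_forall_dependency {ι : Type*} [Fintype ι] {D : ℕ} (a : ι → E D)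
    {h : ι → ℝ} (hh : ∀ c : ι → ℝ, ∑ i, c i = 0 → ∑ i, c i • a i = 0 → ∑ i, h i * c i = 0) :
    ∃ (l : E D →ₗ[ℝ] ℝ) (m : ℝ), ∀ i, h i = m + l (a i) := by
  classical
  let A : (Module.Dual ℝ (E D) × ℝ) →ₗ[ℝ] (ι → ℝ) :=
    { toFun := fun p i => p.2 + p.1 (a i)
      map_add' := fun p q => by ext i; simp; ring
      map_smul' := fun r p => by ext i; simp [mul_add] }
  by_cases hA : h ∈ LinearMap.range A
  · obtain ⟨⟨l, m⟩, rfl⟩ := hA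
    exact ⟨l, m, fun i => rfl⟩
  obtain ⟨f, hf, hfA⟩ := Submodule.exists_le_ker_of_notMem hA
  exfalso
  have hf' : ∀ x : ι → ℝ, f x = ∑ i, x i * f (Pi.single i 1) := by
    intro x
    conv_lhs => rw [pi_eq_sum_univ' x]
    simp [map_sum]
  have hz : ∀ (l : Module.Dual ℝ (E D)) (m : ℝ), ∑ i, (m + l (a i)) * f (Pi.single i 1) = 0 := by
    intro l m
    have := hfA ⟨(l, m), rfl⟩
    rw [LinearMap.mem_ker, hf'] at this
    exact this
  refine hf ?_
  rw [hf']
  refine hh (fun i => f (Pi.single i 1)) ?_ ?_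
  · simpa using hz 0 1
  · rw [← Module.forall_dual_apply_eq_zero_iff ℝ]
    intro l
    simpa [map_sum, mul_comm] using hz l 0

theorem sum_smul_affine {ι : Type*} [Fintype ι] (φ : E 2 →ᵃ[ℝ] E 3) (μ : ι → ℝ) (x : ι → E 2) :
    ∑ i, μ i • φ (x i) = φ.linear (∑ i, μ i • x i) + (∑ i, μ i) • φ 0 := by
  have : ∀ i, φ (x i) = φ.linear (x i) + φ 0 := fun i => by
    have := congrFun φ.decomp (x i)
    simpa using this
  simp_rw [this, smul_add, Finset.sum_add_distrib, map_sum, map_smul, ← Finset.sum_smul]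

/-- Gale duality: cofaces of a Gale diagram are the complements of the sets of all points on a
supporting hyperplane. -/
theorem PlanarDiagram.IsAffineGaleDiagram.isCoface_iff {ι : Type*} [Fintype ι] {D : ℕ}
    {X : PlanarDiagram ι} {a : ι → E D} (h : X.IsAffineGaleDiagram a) (T : Set ι) :
    IsCoface X.pt X.black T ↔
      ∃ (l : E D →ₗ[ℝ] ℝ) (m : ℝ), (∀ i ∈ T, l (a i) < m) ∧ ∀ i ∉ T, l (a i) = m := by
  obtain ⟨g, y, φ, ⟨-, hg⟩, hφ, hy, hi⟩ := h
  have hgφ : ∀ i, g i = y (g i) • φ (X.pt i) := fun i => by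
    rw [(hi i).2.1, smul_smul, mul_inv_cancel₀ (hi i).1, one_smul]
  have hneg : ∀ i, i ∉ X.black → y (g i) < 0 := fun i hiB =>
    lt_of_le_of_ne (not_lt.1 fun c => hiB ((hi i).2.2.2 c)) (hi i).1
  constructor
  · rintro ⟨μ, h1, h2, h3, h4, h5⟩
    have hs : ∑ i, (μ i / y (g i)) • g i = 0 := by
      have : ∀ i, (μ i / y (g i)) • g i = μ i • φ (X.pt i) := fun i => by
        conv_lhs => rw [hgφ i]
        rw [smul_smul, ← hgφ i, div_mul_cancel₀ _ (hi i).1]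
      simp_rw [this]
      rw [sum_smul_affine, h4, h5]
      simp
    obtain ⟨l, m, hl⟩ := exists_affine_of_forall_dependency a (h := fun i => μ i / y (g i)) (by
      intro c hc hc'
      obtain ⟨f, hf⟩ := (hg c).1 ⟨hc, hc'⟩
      have := congrArg f hs
      simpa [map_sum, ← hf] using this)
    refine ⟨-l, m, fun i hiT => ?_, fun i hiT => ?_⟩
    · have : 0 < μ i / y (g i) := by
        by_cases hB : i ∈ X.black
        · exact div_pos (h1 i hiT hB) ((hi i).2.2.1 hB)
        · exact div_pos_of_neg_of_neg (h2 i hiT hB) (hneg i hB)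
      rw [hl] at this
      simp
      linarith
    · have := hl i
      simp only [h3 i hiT, zero_div] at this
      simp
      linarith
  · rintro ⟨l, m, h1, h2⟩
    have hs : ∑ i, (m - l (a i)) • g i = 0 := by
      rw [← Module.forall_dual_apply_eq_zero_iff ℝ]
      intro f
      obtain ⟨e1, e2⟩ := (hg fun i => f (g i)).2 ⟨f, fun i => rfl⟩
      have e3 := congrArg l e2
      simp only [map_sum, map_smul, smul_eq_mul, map_zero] at e3 ⊢
      simp_rw [sub_mul]
      rw [Finset.sum_sub_distrib, ← Finset.mul_sum, e1, mul_zero, zero_sub, neg_eq_zero, ← e3]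
      exact Finset.sum_congr rfl fun i _ => mul_comm _ _
    have hs' : ∑ i, ((m - l (a i)) * y (g i)) • φ (X.pt i) = 0 := by
      rw [← hs]
      refine Finset.sum_congr rfl fun i _ => ?_
      rw [mul_smul, ← hgφ i]
    have h4 : ∑ i, (m - l (a i)) * y (g i) = 0 := by
      have := congrArg y hs'
      simpa [map_sum, hy] using this
    refine ⟨fun i => (m - l (a i)) * y (g i), ?_, ?_, ?_, h4, ?_⟩
    · intro i hiT hB
      exact mul_pos (by linarith [h1 i hiT]) ((hi i).2.2.1 hB)
    · intro i hiT hB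
      exact mul_neg_of_pos_of_neg (by linarith [h1 i hiT]) (hneg i hB)
    · intro i hiT
      simp [h2 i hiT]
    · rw [sum_smul_affine, h4, zero_smul, add_zero] at hs'
      exact (map_eq_zero_iff φ.linear (φ.linear_injective_iff.2 hφ)).1 hs'

/-! ### Faces of polytopes -/

section Faces

variable {D : ℕ} {P F F' : Set (E D)}

theorem IsPolytope.convex (hP : IsPolytope P) : Convex ℝ P := by
  obtain ⟨⟨s, rfl⟩, -⟩ := hP
  exact convex_convexHull _ _

theorem IsPolytope.isCompact (hP : IsPolytope P) : IsCompact P := by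
  obtain ⟨⟨s, rfl⟩, -⟩ := hP
  exact s.finite_toSet.isCompact_convexHull _

theorem IsPolytope.convexHull_extremePoints (hP : IsPolytope P) :
    convexHull ℝ (P.extremePoints ℝ) = P := by
  have h := closure_convexHull_extremePoints hP.isCompact hP.convex
  obtain ⟨⟨s, rfl⟩, -⟩ := hP
  have hf : ((convexHull ℝ (s : Set (E D))).extremePoints ℝ).Finite :=
    s.finite_toSet.subset extremePoints_convexHull_subset
  rwa [(hf.isClosed_convexHull ℝ).closure_eq] at h

variable {ι : Type*} {a : ι → E D}

theorem IsPolytope.convexHull_range (hP : IsPolytope P)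
    (ha : Set.range a = P.extremePoints ℝ) : convexHull ℝ (Set.range a) = P := by
  rw [ha, hP.convexHull_extremePoints]

theorem le_of_mem_convexHull {s : Set (E D)} {l : E D →ₗ[ℝ] ℝ} {m : ℝ} (hs : ∀ x ∈ s, l x ≤ m)
    {x : E D} (hx : x ∈ convexHull ℝ s) : l x ≤ m :=
  convexHull_min (t := {x | l x ≤ m}) hs (convex_halfSpace_le l.isLinear m) hx

open Classical in
/-- The points of a convex hull on a supporting hyperplane are the convex hull of the points on the
hyperplane. -/
theorem convexHull_inter_hyperplane {l : E D →ₗ[ℝ] ℝ} {m : ℝ} (hm : ∀ i, l (a i) ≤ m) :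
    {x ∈ convexHull ℝ (Set.range a) | l x = m} = convexHull ℝ (a '' {i | l (a i) = m}) := by
  ext x
  constructor
  · rintro ⟨hx, hlx⟩
    rw [convexHull_range_eq_exists_affineCombination] at hx
    obtain ⟨s, w, hw, hw1, rfl⟩ := hx
    rw [Finset.affineCombination_eq_linear_combination _ _ _ hw1] at hlx ⊢
    rw [map_sum] at hlx
    have hz : ∑ i ∈ s, w i * (m - l (a i)) = 0 := by
      simp_rw [mul_sub]
      rw [Finset.sum_sub_distrib, ← Finset.sum_mul, hw1, one_mul, ← hlx]
      simp
    rw [Finset.sum_eq_zero_iff_of_nonneg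
      (fun i hi => mul_nonneg (hw i hi) (by linarith [hm i]))] at hz
    have hz' : ∀ i ∈ s, w i ≠ 0 → l (a i) = m := fun i hi hwi => by
      have := (mul_eq_zero.1 (hz i hi)).resolve_left hwi
      linarith
    rw [← Finset.sum_filter_ne_zero]
    have e : ∑ i ∈ s with w i • a i ≠ 0, w i • a i = ∑ i ∈ s with w i ≠ 0, w i • a i := by
      rw [Finset.sum_filter_ne_zero]
      refine (Finset.sum_filter_of_ne fun i _ hi => ?_).symm
      exact left_ne_zero_of_smul hi
    rw [e]
    refine (convex_convexHull ℝ _).sum_mem (fun i hi => hw i (Finset.filter_subset _ _ hi)) ?_ ?_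
    · rw [Finset.sum_filter_ne_zero, hw1]
    · intro i hi
      rw [Finset.mem_filter] at hi
      exact subset_convexHull ℝ _ ⟨i, hz' i hi.1 hi.2, rfl⟩
  · intro hx
    refine ⟨convexHull_mono (Set.image_subset_range _ _) hx, ?_⟩
    refine convexHull_min (t := {x | l x = m}) ?_ (convex_hyperplane l.isLinear m) hx
    rintro _ ⟨i, hi, rfl⟩
    exact hi

/-- A face of a polytope is the empty set or the set of points on a supporting hyperplane. -/
theorem exists_of_isExposed (hP : convexHull ℝ (Set.range a) = P) (hF : IsExposed ℝ P F)
    (hne : F.Nonempty) : ∃ (l : E D →ₗ[ℝ] ℝ) (m : ℝ), (∀ i, l (a i) ≤ m) ∧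
      F = convexHull ℝ (a '' {i | l (a i) = m}) ∧ {i | a i ∈ F} = {i | l (a i) = m} := by
  obtain ⟨f, hf⟩ := hF hne
  obtain ⟨x, hx⟩ := hne
  have hx' := hf ▸ hx
  have haP : ∀ i, a i ∈ P := fun i => hP ▸ subset_convexHull ℝ _ ⟨i, rfl⟩
  have hm : ∀ i, (f : E D →ₗ[ℝ] ℝ) (a i) ≤ f x := fun i => hx'.2 _ (haP i)
  have hF' : F = {z ∈ convexHull ℝ (Set.range a) | (f : E D →ₗ[ℝ] ℝ) z = f x} := by
    rw [hP, hf]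
    ext z
    constructor
    · rintro ⟨hz, hz'⟩
      exact ⟨hz, le_antisymm (hx'.2 z hz) (hz' x hx'.1)⟩
    · rintro ⟨hz, hz'⟩
      exact ⟨hz, fun y hy => (hx'.2 y hy).trans hz'.ge⟩
  refine ⟨f, f x, hm, hF'.trans (convexHull_inter_hyperplane hm), ?_⟩
  ext i
  rw [hF']
  exact ⟨fun h => h.2, fun h => ⟨hP ▸ haP i, h⟩⟩

theorem isExposed_of_supporting (hP : convexHull ℝ (Set.range a) = P) {l : E D →ₗ[ℝ] ℝ} {m : ℝ}
    (hm : ∀ i, l (a i) ≤ m) : IsExposed ℝ P (convexHull ℝ (a '' {i | l (a i) = m})) := by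
  rw [← convexHull_inter_hyperplane hm, hP]
  rintro ⟨x, hx, hlx⟩
  refine ⟨LinearMap.toContinuousLinearMap l, ?_⟩
  have hle : ∀ z ∈ P, l z ≤ m := fun z hz => by
    rw [← hP] at hz
    refine le_of_mem_convexHull ?_ hz
    rintro _ ⟨i, rfl⟩
    exact hm i
  ext z
  constructor
  · rintro ⟨hz, hz'⟩
    exact ⟨hz, fun y hy => (hle y hy).trans hz'.ge⟩
  · rintro ⟨hz, hz'⟩
    exact ⟨hz, le_antisymm (hle z hz) (hlx.symm.le.trans (hz' x hx))⟩

/-- A face of a polytope is the convex hull of its vertices. -/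
theorem eq_convexHull_of_isExposed (hP : convexHull ℝ (Set.range a) = P) (hF : IsExposed ℝ P F) :
    F = convexHull ℝ (a '' {i | a i ∈ F}) := by
  rcases F.eq_empty_or_nonempty with rfl | hne
  · simp
  · obtain ⟨l, m, -, h1, h2⟩ := exists_of_isExposed hP hF hne
    rw [h2]
    exact h1

end Faces

namespace PlanarDiagram

variable {D : ℕ} {P : Set (E D)} {ι : Type*} [Fintype ι] {a : ι → E D} {X : PlanarDiagram ι}

theorem IsAffineGaleDiagram.isCoface_univ (h : X.IsAffineGaleDiagram a) :
    IsCoface X.pt X.black Set.univ := by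
  rw [h.isCoface_iff]
  exact ⟨0, 1, by simp⟩

/-- A set of vertices is the set of vertices of a face if and only if its complement is a coface. -/
theorem IsAffineGaleDiagram.exists_face_iff (h : X.IsAffineGaleDiagram a)
    (hP : convexHull ℝ (Set.range a) = P) (S : Set ι) :
    (∃ F, IsExposed ℝ P F ∧ {i | a i ∈ F} = S) ↔ IsCoface X.pt X.black Sᶜ := by
  constructor
  · rintro ⟨F, hF, rfl⟩
    rcases F.eq_empty_or_nonempty with rfl | hne
    · simpa using h.isCoface_univ
    obtain ⟨l, m, hm, -, h2⟩ := exists_of_isExposed hP hF hne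
    rw [h.isCoface_iff, h2]
    exact ⟨l, m, fun i hi => lt_of_le_of_ne (hm i) hi, fun i hi => not_not.1 hi⟩
  · intro hc
    rcases S.eq_empty_or_nonempty with rfl | -
    · exact ⟨∅, fun h => absurd h (by simp), by simp⟩
    obtain ⟨l, m, h1, h2⟩ := (h.isCoface_iff _).1 hc
    have hm : ∀ i, l (a i) ≤ m := fun i => by
      by_cases hi : i ∈ S
      · exact (h2 i (by simpa using hi)).le
      · exact (h1 i hi).le
    have hS : {i | l (a i) = m} = S := by
      ext i
      refine ⟨fun hi => ?_, fun hi => h2 i (by simpa using hi)⟩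
      by_contra hiS
      exact (h1 i hiS).ne hi
    refine ⟨_, isExposed_of_supporting hP hm, ?_⟩
    rw [← convexHull_inter_hyperplane hm]
    ext i
    rw [← hS]
    exact ⟨fun h => h.2, fun h => ⟨subset_convexHull ℝ _ ⟨i, rfl⟩, h⟩⟩

/-- The face lattice of a polytope is isomorphic to the poset of complements of cofaces of a Gale
diagram. -/
theorem IsGaleDiagramOf.exists_orderIso (h : X.IsGaleDiagramOf P) (hP : IsPolytope P) :
    Nonempty (Face P ≃o {S : Set ι // IsCoface X.pt X.black Sᶜ}) := by
  obtain ⟨a, ha, hr, hX⟩ := h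
  have hPa := hP.convexHull_range hr
  refine ⟨RelIso.ofSurjective (r := (· ≤ ·)) (s := (· ≤ ·)) ⟨⟨fun F => ⟨{i | a i ∈ F.1},
    (hX.exists_face_iff hPa _).1 ⟨F.1, F.2, rfl⟩⟩, ?_⟩, ?_⟩ ?_⟩
  · intro F F' e
    have e' : {i | a i ∈ F.1} = {i | a i ∈ F'.1} := congrArg Subtype.val e
    apply Subtype.ext
    rw [eq_convexHull_of_isExposed hPa F.2, eq_convexHull_of_isExposed hPa F'.2, e']
  · intro F F'
    constructor
    · intro hle
      have hle' : {i | a i ∈ F.1} ⊆ {i | a i ∈ F'.1} := hle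
      change F.1 ⊆ F'.1
      rw [eq_convexHull_of_isExposed hPa F.2, eq_convexHull_of_isExposed hPa F'.2]
      exact convexHull_mono (Set.image_mono hle')
    · intro hle i hi
      exact hle hi
  · rintro ⟨S, hS⟩
    obtain ⟨F, hF, e⟩ := (hX.exists_face_iff hPa S).2 hS
    exact ⟨⟨F, hF⟩, Subtype.ext e⟩

/-- Neighborliness in terms of a Gale diagram. -/
theorem IsGaleDiagramOf.isNeighborlyPolytope_iff (h : X.IsGaleDiagramOf P) (hP : IsPolytope P) :
    IsNeighborlyPolytope P ↔ ∀ S : Set ι, S.ncard = D / 2 → IsCoface X.pt X.black Sᶜ := by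
  obtain ⟨a, ha, hr, hX⟩ := h
  have hPa := hP.convexHull_range hr
  constructor
  · rintro ⟨-, hN⟩ S hS
    have := hN (a '' S) (by rw [← hr]; exact Set.image_subset_range _ _)
      (by rw [Set.ncard_image_of_injective _ ha, hS])
    refine (hX.exists_face_iff hPa S).1 ⟨_, this, ?_⟩
    ext i
    refine ⟨fun hi => ?_, fun hi => subset_convexHull ℝ _ ⟨i, hi, rfl⟩⟩
    have hsub : convexHull ℝ (a '' S) ⊆ P := by
      rw [← hPa]; exact convexHull_mono (Set.image_subset_range _ _)
    have hi' : a i ∈ P.extremePoints ℝ := by rw [← hr]; exact ⟨i, rfl⟩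
    have := extremePoints_convexHull_subset
      (inter_extremePoints_subset_extremePoints_of_subset hsub ⟨hi, hi'⟩)
    obtain ⟨j, hj, e⟩ := this
    rwa [← ha e]
  · refine fun hN => ⟨hP, fun S hS hcard => ?_⟩
    rw [← hr] at hS
    obtain ⟨S, rfl⟩ := Set.subset_range_iff_exists_image_eq.1 hS
    rw [Set.ncard_image_of_injective _ ha] at hcard
    obtain ⟨F, hF, e⟩ := (hX.exists_face_iff hPa S).2 (hN S hcard)
    rw [← e, ← eq_convexHull_of_isExposed hPa hF]
    exact hF

end PlanarDiagram

/-! ### Polytopes with a given Gale diagram -/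

/-- The affine embedding of the plane as the plane at height one. -/
noncomputable def liftPlane : E 2 →ᵃ[ℝ] E 3 where
  toFun x := !₂[x 0, x 1, 1]
  linear :=
    { toFun := fun x => !₂[x 0, x 1, 0]
      map_add' := fun x y => by ext i; fin_cases i <;> simp
      map_smul' := fun c x => by ext i; fin_cases i <;> simp }
  map_vadd' p v := by ext i; fin_cases i <;> simp

/-- The height of a point of space. -/
noncomputable def height : E 3 →ₗ[ℝ] ℝ where
  toFun x := x 2
  map_add' x y := by simp
  map_smul' c x := by simp

theorem height_liftPlane (x : E 2) : height (liftPlane x) = 1 := rfl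

theorem liftPlane_injective : Function.Injective liftPlane := by
  intro x y h
  have h0 := congrArg (fun z : E 3 => z 0) h
  have h1 := congrArg (fun z : E 3 => z 1) h
  ext i
  fin_cases i
  · exact h0
  · exact h1

theorem eq_zero_of_forall_liftPlane {l : E 3 →ₗ[ℝ] ℝ} (h : ∀ x, l (liftPlane x) = 0) : l = 0 := by
  have e : ∀ z : E 3, z = liftPlane !₂[z 0, z 1] + (z 2 - 1) •
      (liftPlane !₂[0, 0]) := by
    intro z
    ext i
    fin_cases i <;> simp [liftPlane]
  ext z
  rw [e z, map_add, map_smul, h, h]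
  simp

/-- A space of dependencies of the right dimension is the space of affine dependencies of some
point configuration that affinely spans: up to an affine map, it consists of the images of the unit
vectors in the quotient by the space. -/
theorem exists_config_of_dependencies {ι : Type*} [Fintype ι] [Nonempty ι] {D : ℕ}
    (W : Submodule ℝ (ι → ℝ)) (hW : ∀ c ∈ W, ∑ i, c i = 0)
    (hcard : Fintype.card ι = Module.finrank ℝ W + D + 1) :
    ∃ a : ι → E D, affineSpan ℝ (Set.range a) = ⊤ ∧
      ∀ c : ι → ℝ, (∑ i, c i = 0 ∧ ∑ i, c i • a i = 0) ↔ c ∈ W := by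
  classical
  let σ : (ι → ℝ) →ₗ[ℝ] ℝ := ∑ i, LinearMap.proj i
  have hσ : ∀ c, σ c = ∑ i, c i := fun c => by simp [σ]
  let s : ((ι → ℝ) ⧸ W) →ₗ[ℝ] ℝ := W.liftQ σ fun c hc => by
    rw [LinearMap.mem_ker, hσ]; exact hW c hc
  have hs : ∀ c, s (W.mkQ c) = ∑ i, c i := fun c => by simp [s, hσ]
  have hsurj : Function.Surjective s := by
    refine LinearMap.surjective ?_
    intro h0
    obtain ⟨i⟩ := ‹Nonempty ι›
    have := hs (Pi.single i 1)
    rw [h0] at this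
    simp at this
  have hdim : Module.finrank ℝ (LinearMap.ker s) = Module.finrank ℝ (E D) := by
    have e1 := LinearMap.finrank_range_add_finrank_ker s
    have e2 := Submodule.finrank_quotient_add_finrank W
    rw [LinearMap.range_eq_top.2 hsurj, finrank_top, Module.finrank_self] at e1
    rw [Module.finrank_fintype_fun_eq_card] at e2
    rw [finrank_euclideanSpace_fin]
    omega
  let e : LinearMap.ker s ≃ₗ[ℝ] E D := LinearEquiv.ofFinrankEq _ _ hdim
  obtain ⟨q, hq⟩ := LinearMap.exists_leftInverse_of_injective (LinearMap.ker s).subtype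
    (LinearMap.ker_eq_bot.2 Subtype.val_injective)
  have hq' : ∀ x : LinearMap.ker s, q x = x := fun x => LinearMap.congr_fun hq x
  let A : (ι → ℝ) →ₗ[ℝ] E D := e.toLinearMap ∘ₗ q ∘ₗ W.mkQ
  have hA : ∀ c : ι → ℝ, ∑ i, c i • A (Pi.single i 1) = A c := by
    intro c
    conv_rhs => rw [pi_eq_sum_univ' c]
    rw [map_sum]
    exact Finset.sum_congr rfl fun i _ => (map_smul A _ _).symm
  have hA' : ∀ c : ι → ℝ, (hc : ∑ i, c i = 0) →
      A c = e ⟨W.mkQ c, by rw [LinearMap.mem_ker, hs, hc]⟩ := by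
    intro c hc
    exact congrArg e (hq' ⟨W.mkQ c, by rw [LinearMap.mem_ker, hs, hc]⟩)
  refine ⟨fun i => A (Pi.single i 1), ?_, fun c => ?_⟩
  · rw [AffineSubspace.affineSpan_eq_top_iff_vectorSpan_eq_top_of_nonempty _ _ _
      (Set.range_nonempty _), eq_top_iff]
    intro z _
    obtain ⟨c, hc⟩ := W.mkQ_surjective (e.symm z).1
    have hc0 : ∑ i, c i = 0 := by
      rw [← hs, hc]; exact (e.symm z).2
    have : A c = z := by
      rw [hA' c hc0]
      have : (⟨W.mkQ c, by rw [LinearMap.mem_ker, hs, hc0]⟩ : LinearMap.ker s) = e.symm z :=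
        Subtype.ext hc
      rw [this, LinearEquiv.apply_symm_apply]
    rw [← this, ← hA c]
    have hv := weightedVSub_mem_vectorSpan (k := ℝ) (s := Finset.univ) (w := c) hc0
      (fun i => A (Pi.single i 1))
    rwa [Finset.weightedVSub_eq_linear_combination _ hc0] at hv
  · simp only [hA]
    constructor
    · rintro ⟨h0, h1⟩
      rw [hA' c h0, LinearEquiv.map_eq_zero_iff] at h1
      have := congrArg Subtype.val h1
      simpa using this
    · intro hc
      have h0 := hW c hc
      refine ⟨h0, ?_⟩
      rw [hA' c h0, LinearEquiv.map_eq_zero_iff]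
      apply Subtype.ext
      simpa using hc

/-- A planar diagram is a Gale diagram of a polytope if the set of all points and the sets of all
points but one are cofaces. -/
theorem PlanarDiagram.exists_isGaleDiagramOf {ι : Type*} [Fintype ι] {D : ℕ}
    (X : PlanarDiagram ι) (hcard : Fintype.card ι = D + 4) (h0 : IsCoface X.pt X.black Set.univ)
    (h1 : ∀ i, IsCoface X.pt X.black {i}ᶜ) :
    ∃ P : Set (E D), IsPolytope P ∧ X.IsGaleDiagramOf P := by
  classical
  obtain ⟨μ, m1, m2, -, m4, m5⟩ := h0
  have : Nonempty ι := Fintype.card_pos_iff.1 (by omega)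
  let g : ι → E 3 := fun i => μ i • liftPlane (X.pt i)
  have hg : ∀ i, height (g i) = μ i := fun i => by
    simp [g, height_liftPlane]
  have hμ : ∀ i, μ i ≠ 0 := fun i => by
    by_cases hi : i ∈ X.black
    · exact (m1 i trivial hi).ne'
    · exact (m2 i trivial hi).ne
  have hgsum : ∑ i, g i = 0 := by
    simp only [g]
    rw [sum_smul_affine, m4, m5]
    simp
  let L : Module.Dual ℝ (E 3) →ₗ[ℝ] (ι → ℝ) :=
    { toFun := fun l i => l (g i)
      map_add' := fun l l' => rfl
      map_smul' := fun c l => rfl }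
  have hL : ∀ l : E 3 →ₗ[ℝ] ℝ, (∀ i, l (g i) = 0) → l = 0 := by
    intro l hl
    refine eq_zero_of_forall_liftPlane fun x => ?_
    have hl' : ∀ i, l (liftPlane (X.pt i)) = 0 := fun i => by
      have := hl i
      simp only [g, map_smul, smul_eq_mul] at this
      exact (mul_eq_zero.1 this).resolve_left (hμ i)
    have hx : x ∈ affineSpan ℝ (Set.range X.pt) := by rw [X.spans]; trivial
    have hle : affineSpan ℝ (Set.range X.pt) ≤
        (AffineSubspace.mk' (0 : ℝ) ⊥).comap (l.toAffineMap.comp liftPlane) := by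
      rw [affineSpan_le]
      rintro _ ⟨i, rfl⟩
      simp [hl' i]
    have := hle hx
    simpa using this
  have hLinj : Function.Injective L := by
    rw [← LinearMap.ker_eq_bot, LinearMap.ker_eq_bot']
    exact fun l hl => hL l fun i => congrFun hl i
  obtain ⟨a, ha, hdep⟩ := exists_config_of_dependencies (D := D) (LinearMap.range L) (by
    rintro _ ⟨l, rfl⟩
    change ∑ i, l (g i) = 0
    rw [← map_sum, hgsum, map_zero]) (by
    rw [LinearMap.finrank_range_of_inj hLinj, Subspace.dual_finrank_eq,
      finrank_euclideanSpace_fin]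
    omega)
  have hX : X.IsAffineGaleDiagram a := by
    refine ⟨g, height, liftPlane, ⟨hL, fun c => (hdep c).trans ?_⟩, liftPlane_injective,
      height_liftPlane, fun i => ⟨?_, ?_, ?_⟩⟩
    · constructor
      · rintro ⟨l, rfl⟩
        exact ⟨l, fun i => rfl⟩
      · rintro ⟨l, hl⟩
        exact ⟨l, funext fun i => (hl i).symm⟩
    · rw [hg]; exact hμ i
    · rw [hg]
      simp only [g]
      rw [smul_smul, inv_mul_cancel₀ (hμ i), one_smul]
    · rw [hg]
      refine ⟨m1 i trivial, fun hi => ?_⟩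
      by_contra hB
      exact absurd (m2 i trivial hB) hi.not_gt
  have hsep : ∀ i, ∃ (l : E D →ₗ[ℝ] ℝ), ∀ j, j ≠ i → l (a j) < l (a i) := fun i => by
    obtain ⟨l, m, h2, h3⟩ := (hX.isCoface_iff _).1 (h1 i)
    exact ⟨l, fun j hj => (h2 j (by simpa using hj)).trans_eq (h3 i (by simp)).symm⟩
  have hinj : Function.Injective a := by
    intro i j hij
    by_contra hne
    obtain ⟨l, hl⟩ := hsep i
    have := hl j (Ne.symm hne)
    rw [hij] at this
    exact lt_irrefl _ this
  refine ⟨convexHull ℝ (Set.range a), ⟨⟨Finset.univ.image a, by simp⟩, ?_⟩, a, hinj, ?_, hX⟩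
  · rw [affineSpan_convexHull, ha]
  · refine Set.Subset.antisymm ?_ extremePoints_convexHull_subset
    rintro _ ⟨i, rfl⟩
    obtain ⟨l, hl⟩ := hsep i
    refine exposedPoints_subset_extremePoints ⟨subset_convexHull ℝ _ ⟨i, rfl⟩,
      LinearMap.toContinuousLinearMap l, fun y hy => ?_⟩
    have hle : ∀ j, l (a j) ≤ l (a i) := fun j => by
      by_cases hj : j = i
      · rw [hj]
      · exact (hl j hj).le
    refine ⟨le_of_mem_convexHull (by rintro _ ⟨j, rfl⟩; exact hle j) hy, fun hy' => ?_⟩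
    have hy2 : y ∈ {z ∈ convexHull ℝ (Set.range a) | l z = l (a i)} :=
      ⟨hy, le_antisymm (le_of_mem_convexHull (by rintro _ ⟨j, rfl⟩; exact hle j) hy) hy'⟩
    rw [convexHull_inter_hyperplane hle] at hy2
    have : {j | l (a j) = l (a i)} = {i} := by
      ext j
      refine ⟨fun hj => ?_, fun hj => by rw [Set.mem_singleton_iff.1 hj]; rfl⟩
      by_contra hne
      exact (hl j hne).ne hj
    rw [this] at hy2
    simpa using hy2

/-! ### The affine structure of a neighborly diagram -/

/-- The affine form `α x + β y + γ` on the plane. -/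
noncomputable def affineForm (α β γ : ℝ) : E 2 →ᵃ[ℝ] ℝ where
  toFun x := α * x 0 + β * x 1 + γ
  linear :=
    { toFun := fun x => α * x 0 + β * x 1
      map_add' := fun x y => by simp; ring
      map_smul' := fun c x => by simp; ring }
  map_vadd' p v := by simp; ring

theorem affineForm_apply (α β γ : ℝ) (x : E 2) :
    affineForm α β γ x = α * x 0 + β * x 1 + γ := rfl

theorem sum_mul_affine {ι : Type*} [Fintype ι] {μ : ι → ℝ} {x : ι → E 2} (h : ∑ i, μ i = 0)
    (h' : ∑ i, μ i • x i = 0) (f : E 2 →ᵃ[ℝ] ℝ) : ∑ i, μ i * f (x i) = 0 := by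
  have : ∀ i, f (x i) = f.linear (x i) + f 0 := fun i => by
    have := congrFun f.decomp (x i)
    simpa using this
  simp_rw [this, mul_add, Finset.sum_add_distrib, ← Finset.sum_mul, h, zero_mul, add_zero]
  have := congrArg f.linear h'
  simpa [map_sum] using this

/-- The area of a triangle with two fixed vertices is an affine form of the third vertex. -/
noncomputable def areaForm (s t : E 2) : E 2 →ᵃ[ℝ] ℝ :=
  affineForm (-(t 1 - s 1)) (t 0 - s 0) ((t 1 - s 1) * s 0 - (t 0 - s 0) * s 1)

theorem areaForm_apply (s t x : E 2) : areaForm s t x = area s t x := by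
  rw [areaForm, affineForm_apply, area]
  ring

theorem exists_affineForm_of_area_eq_zero {p q r : E 2} (h : area p q r = 0) :
    ∃ f : E 2 →ᵃ[ℝ] ℝ, (∃ x, f x ≠ 0) ∧ f p = 0 ∧ f q = 0 ∧ f r = 0 := by
  have key : ∀ {s t : E 2}, s ≠ t → ∃ x, areaForm s t x ≠ 0 := by
    intro s t hst
    by_contra hcon
    push Not at hcon
    have h0 := hcon (s + !₂[1, 0])
    have h1 := hcon (s + !₂[0, 1])
    rw [areaForm_apply] at h0 h1
    simp [area] at h0 h1
    apply hst
    ext i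
    fin_cases i <;> simp <;> linarith
  by_cases hpq : p = q
  · by_cases hpr : p = r
    · refine ⟨affineForm 1 0 (-p 0), ⟨p + !₂[1, 0], ?_⟩, ?_, ?_, ?_⟩ <;>
        simp [affineForm_apply, ← hpq, ← hpr]
    · exact ⟨areaForm p r, key hpr, by simp [areaForm_apply], by simp [areaForm_apply, ← hpq],
        by simp [areaForm_apply]⟩
  · exact ⟨areaForm p q, key hpq, by simp [areaForm_apply], by simp [areaForm_apply],
      by rw [areaForm_apply, h]⟩

section Count

variable {ι : Type*} [Fintype ι] {X : PlanarDiagram ι} {d : ℕ}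

theorem PlanarDiagram.exists_ne_zero (X : PlanarDiagram ι) {f : E 2 →ᵃ[ℝ] ℝ}
    (hf : ∃ x, f x ≠ 0) : ∃ i, f (X.pt i) ≠ 0 := by
  by_contra hcon
  push Not at hcon
  obtain ⟨x, hx⟩ := hf
  have hle : affineSpan ℝ (Set.range X.pt) ≤ (AffineSubspace.mk' (0 : ℝ) ⊥).comap f := by
    rw [affineSpan_le]
    rintro _ ⟨i, rfl⟩
    simp [hcon i]
  have hx' : x ∈ affineSpan ℝ (Set.range X.pt) := by rw [X.spans]; trivial
  have := hle hx'
  exact hx (by simpa using this)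

open Classical in
/-- The points where the affine form `f` is positive, with the sign reversed for white points. -/
noncomputable def PlanarDiagram.positive (X : PlanarDiagram ι) (f : E 2 → ℝ) : Finset ι :=
  Finset.univ.filter fun i => (i ∈ X.black ∧ 0 < f (X.pt i)) ∨ (i ∉ X.black ∧ f (X.pt i) < 0)

theorem PlanarDiagram.mem_positive {f : E 2 → ℝ} {i : ι} : i ∈ X.positive f ↔
    (i ∈ X.black ∧ 0 < f (X.pt i)) ∨ (i ∉ X.black ∧ f (X.pt i) < 0) := by
  simp [positive]

variable (hcard : Fintype.card ι = 2 * d + 4)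
  (hN : ∀ T : Set ι, T.ncard = d + 4 → IsCoface X.pt X.black T)

include hcard hN

/-- If `X.positive f` has at most `d` elements, some coface with `d + 4` elements avoids it and
contains `i`; pairing its dependency with `f` gives a sum of nonpositive terms. -/
theorem eq_zero_of_card_positive_le (f : E 2 →ᵃ[ℝ] ℝ) (hf : (X.positive f).card ≤ d) {i : ι}
    (hi : i ∉ X.positive f) : f (X.pt i) = 0 := by
  classical
  have hc : d + 4 ≤ (X.positive f)ᶜ.card := by
    rw [Finset.card_compl]; omega
  obtain ⟨T, hiT, hT, hTc⟩ := Finset.exists_subsuperset_card_eq (s := {i}) (n := d + 4)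
    (t := (X.positive f)ᶜ) (by simpa using hi) (by simp) hc
  obtain ⟨μ, h1, h2, h3, h4, h5⟩ := hN T (by rw [Set.ncard_coe_finset, hTc])
  have hs := sum_mul_affine h4 h5 f
  have hneg : ∀ j, μ j * f (X.pt j) ≤ 0 := by
    intro j
    by_cases hj : j ∈ T
    · have hjZ := Finset.mem_compl.1 (hT hj)
      rw [PlanarDiagram.mem_positive, not_or] at hjZ
      by_cases hB : j ∈ X.black
      · exact mul_nonpos_of_nonneg_of_nonpos (h1 j hj hB).le (not_lt.1 fun c => hjZ.1 ⟨hB, c⟩)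
      · exact mul_nonpos_of_nonpos_of_nonneg (h2 j hj hB).le (not_lt.1 fun c => hjZ.2 ⟨hB, c⟩)
    · simp [h3 j hj]
  have := (Finset.sum_eq_zero_iff_of_nonpos fun j _ => hneg j).1 hs i (Finset.mem_univ i)
  refine (mul_eq_zero.1 this).resolve_left ?_
  have hiT' : i ∈ (T : Set ι) := by simpa using hiT
  by_cases hB : i ∈ X.black
  · exact (h1 i hiT' hB).ne'
  · exact (h2 i hiT' hB).ne

/-- Neighborliness in terms of the diagram: every open half-plane contains many points, counted with
colours. -/
theorem lt_card_positive (f : E 2 →ᵃ[ℝ] ℝ) (hf : ∃ x, f x ≠ 0) : d < (X.positive f).card := by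
  by_contra hcon
  push Not at hcon
  have h1 := fun i => eq_zero_of_card_positive_le hcard hN f hcon (i := i)
  have hsub : X.positive (-f : E 2 →ᵃ[ℝ] ℝ) ⊆ X.positive f := by
    intro i hi
    by_contra hi'
    rw [PlanarDiagram.mem_positive] at hi
    simp [h1 i hi'] at hi
  obtain ⟨i, hi⟩ := X.exists_ne_zero hf
  have hif : i ∈ X.positive f := by
    by_contra c
    exact hi (h1 i c)
  have hif' : i ∉ X.positive (-f : E 2 →ᵃ[ℝ] ℝ) := by
    rw [PlanarDiagram.mem_positive] at hif ⊢
    simp only [AffineMap.coe_neg, Pi.neg_apply, Left.neg_pos_iff, Left.neg_neg_iff]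
    rintro (⟨hB, h⟩ | ⟨hB, h⟩) <;> rcases hif with ⟨hB', h'⟩ | ⟨hB', h'⟩ <;>
      first | contradiction | linarith
  have := eq_zero_of_card_positive_le hcard hN (-f) ((Finset.card_le_card hsub).trans hcon) hif'
  simp at this
  exact hi this

open Classical in
/-- The sets where `f` is positive, negative, and zero (with signs reversed for white
points) together have `2 d + 4` elements, and the second one has more than `d`. -/
theorem card_positive_add (f : E 2 →ᵃ[ℝ] ℝ) (hf : ∃ x, f x ≠ 0) :
    (X.positive f).card + (Finset.univ.filter fun i => f (X.pt i) = 0).card ≤ d + 3 := by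
  have h2 := lt_card_positive hcard hN (-f) (by simpa using hf)
  have hd1 : Disjoint (X.positive f) (X.positive (-f : E 2 →ᵃ[ℝ] ℝ)) := by
    rw [Finset.disjoint_left]
    intro i hi hi'
    rw [PlanarDiagram.mem_positive] at hi hi'
    simp only [AffineMap.coe_neg, Pi.neg_apply, Left.neg_pos_iff, Left.neg_neg_iff] at hi'
    rcases hi with ⟨hB, h⟩ | ⟨hB, h⟩ <;> rcases hi' with ⟨hB', h'⟩ | ⟨hB', h'⟩ <;>
      first | contradiction | linarith
  have hd2 : Disjoint (X.positive f ∪ X.positive (-f : E 2 →ᵃ[ℝ] ℝ))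
      (Finset.univ.filter fun i => f (X.pt i) = 0) := by
    rw [Finset.disjoint_left]
    intro i hi hi'
    simp only [Finset.mem_filter, Finset.mem_univ, true_and] at hi'
    simp [PlanarDiagram.mem_positive, hi'] at hi
  have := Finset.card_le_univ ((X.positive f ∪ X.positive (-f : E 2 →ᵃ[ℝ] ℝ)) ∪
      (Finset.univ.filter fun i => f (X.pt i) = 0))
  rw [Finset.card_union_of_disjoint hd2, Finset.card_union_of_disjoint hd1, hcard] at this
  omega

/-- No three points are collinear, because they would be too many zeros of an affine form. -/
theorem area_ne_zero_of_isCoface {i j k : ι} (hij : i ≠ j) (hjk : j ≠ k) (hki : k ≠ i) :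
    area (X.pt i) (X.pt j) (X.pt k) ≠ 0 := by
  classical
  intro h
  obtain ⟨f, hf, h1, h2, h3⟩ := exists_affineForm_of_area_eq_zero h
  have e1 := card_positive_add hcard hN f hf
  have e2 := lt_card_positive hcard hN f hf
  have : ({i, j, k} : Finset ι) ⊆ Finset.univ.filter fun i => f (X.pt i) = 0 := by
    intro x hx
    simp only [Finset.mem_insert, Finset.mem_singleton] at hx
    rcases hx with rfl | rfl | rfl <;> simpa
  have := Finset.card_le_card this
  rw [Finset.card_eq_three.2 ⟨i, j, k, hij, hki.symm, hjk, rfl⟩] at this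
  omega

variable (hB : X.black.ncard = d + 3)

include hB

open Classical in
/-- On each side of a line through two black points there are as many white points as black
ones. -/
theorem card_white_eq_card_black {i j : ι} (hi : i ∈ X.black) (hj : j ∈ X.black) (hij : i ≠ j) :
    (Finset.univ.filter fun x => x ∉ X.black ∧ area (X.pt i) (X.pt j) (X.pt x) < 0).card =
    (Finset.univ.filter fun x => x ∈ X.black ∧ area (X.pt i) (X.pt j) (X.pt x) < 0).card := by
  have hex : ∃ x, areaForm (X.pt i) (X.pt j) x ≠ 0 := by
    obtain ⟨k, hk, hk'⟩ : ∃ k ∈ X.black, k ∉ ({i, j} : Set ι) := by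
      refine Set.exists_mem_notMem_of_ncard_lt_ncard ?_ (Set.toFinite _)
      rw [Set.ncard_pair hij]; omega
    simp only [Set.mem_insert_iff, Set.mem_singleton_iff, not_or] at hk'
    exact ⟨X.pt k, by
      rw [areaForm_apply]
      exact area_ne_zero_of_isCoface hcard hN hij (Ne.symm hk'.2) hk'.1⟩
  have e1 := card_positive_add hcard hN _ hex
  have e2 := lt_card_positive hcard hN _ hex
  have e3 : ({i, j} : Finset ι) ⊆
      Finset.univ.filter fun x => areaForm (X.pt i) (X.pt j) (X.pt x) = 0 := by
    intro x hx
    simp only [Finset.mem_insert, Finset.mem_singleton] at hx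
    rcases hx with rfl | rfl <;> simp [areaForm_apply]
  have e3 := Finset.card_le_card e3
  rw [Finset.card_pair hij] at e3
  have e4 : (X.positive (areaForm (X.pt i) (X.pt j))).card =
      (Finset.univ.filter fun x => x ∈ X.black ∧ 0 < area (X.pt i) (X.pt j) (X.pt x)).card +
      (Finset.univ.filter fun x => x ∉ X.black ∧ area (X.pt i) (X.pt j) (X.pt x) < 0).card := by
    rw [← Finset.card_union_of_disjoint]
    · congr 1
      ext x
      simp [PlanarDiagram.mem_positive, areaForm_apply]
    · rw [Finset.disjoint_left]
      intro x hx hx'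
      simp only [Finset.mem_filter, Finset.mem_univ, true_and] at hx hx'
      exact hx'.1 hx.1
  have e5 : X.black.ncard =
      (Finset.univ.filter fun x => x ∈ X.black ∧ 0 < area (X.pt i) (X.pt j) (X.pt x)).card +
      (Finset.univ.filter fun x => x ∈ X.black ∧ area (X.pt i) (X.pt j) (X.pt x) < 0).card +
      ({i, j} : Finset ι).card := by
    rw [← Finset.card_union_of_disjoint, ← Finset.card_union_of_disjoint,
      ← Set.ncard_coe_finset]
    · congr 1
      ext x
      simp only [Finset.coe_union, Finset.coe_filter, Finset.mem_univ, true_and, Finset.coe_insert,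
        Finset.coe_singleton, Set.mem_union, Set.mem_ofPred_eq, Set.mem_insert_iff,
        Set.mem_singleton_iff]
      constructor
      · intro hx
        by_cases h1 : x = i
        · simp [h1]
        by_cases h2 : x = j
        · simp [h2]
        rcases lt_or_gt_of_ne (area_ne_zero_of_isCoface hcard hN hij (Ne.symm h2) h1) with h | h
        · exact Or.inl (Or.inr ⟨hx, h⟩)
        · exact Or.inl (Or.inl ⟨hx, h⟩)
      · rintro ((h | h) | (rfl | rfl))
        exacts [h.1, h.1, hi, hj]
    · rw [Finset.disjoint_left]
      intro x hx hx'
      simp only [Finset.mem_insert, Finset.mem_singleton] at hx'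
      rcases hx' with rfl | rfl <;> simp at hx
    · rw [Finset.disjoint_left]
      intro x hx hx'
      simp only [Finset.mem_filter, Finset.mem_univ, true_and] at hx hx'
      linarith
  rw [Finset.card_pair hij] at e5
  omega

variable (hconv : ConvexIndependent ℝ (fun i : X.black => X.pt i))

include hconv

/-- A line through the black point `a` with the other black points strictly on one side has all the
`d + 1` white points strictly on the same side, too: no other point can belong to the set
`X.positive` of the corresponding affine form, which has more than `d` elements. -/
theorem exists_supporting {a : ι} (ha : a ∈ X.black) :
    ∃ q, ∀ x, x ≠ a → 0 < area (X.pt a) q (X.pt x) := by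
  classical
  set K := convexHull ℝ ((fun i : X.black => X.pt i) '' {x | x ≠ ⟨a, ha⟩}) with hK
  have haK : X.pt a ∉ K := fun h => hconv _ ⟨a, ha⟩ h rfl
  have hclosed : IsClosed K := (Set.toFinite _).isClosed_convexHull ℝ
  obtain ⟨f, u, h1, h2⟩ := geometric_hahn_banach_point_closed (convex_convexHull ℝ _) hclosed haK
  set α := f !₂[1, 0] with hα
  set β := f !₂[0, 1] with hβ
  have hf : ∀ x : E 2, f x = α * x 0 + β * x 1 := by
    intro x
    have : x = x 0 • !₂[1, 0] + x 1 • !₂[0, 1] := by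
      ext i; fin_cases i <;> simp
    conv_lhs => rw [this]
    rw [map_add, map_smul, map_smul, smul_eq_mul, smul_eq_mul, mul_comm, mul_comm (x 1)]
  have hpos : ∀ x ∈ X.black, x ≠ a → 0 < f (X.pt x) - f (X.pt a) := by
    intro x hx hxa
    have : X.pt x ∈ K := subset_convexHull ℝ _ ⟨⟨x, hx⟩, fun e => hxa (congrArg Subtype.val e), rfl⟩
    have := h2 _ this
    linarith
  let h : E 2 →ᵃ[ℝ] ℝ := affineForm (-α) (-β) (f (X.pt a))
  have hh : ∀ x, h x = -(f x - f (X.pt a)) := fun x => by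
    rw [hf x]; simp only [h, affineForm_apply]; ring
  obtain ⟨b, hb, hba⟩ : ∃ b ∈ X.black, b ∉ ({a} : Set ι) := by
    refine Set.exists_mem_notMem_of_ncard_lt_ncard ?_ (Set.toFinite _)
    rw [Set.ncard_singleton]; omega
  have hcount := lt_card_positive hcard hN h ⟨X.pt b, by
    rw [hh]; exact (neg_lt_zero.2 (hpos b hb hba)).ne⟩
  have hsub : X.positive h ⊆ Finset.univ.filter fun x => x ∉ X.black := by
    intro x hx
    rw [PlanarDiagram.mem_positive] at hx
    rcases hx with ⟨hxB, hx⟩ | ⟨hxB, hx⟩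
    · rw [hh] at hx
      by_cases hxa : x = a
      · subst hxa; simp at hx
      · have := hpos x hxB hxa
        linarith
    · simpa using hxB
  have hwhite : (Finset.univ.filter fun x => x ∉ X.black).card = d + 1 := by
    have e1 := Set.ncard_add_ncard_compl X.black (Set.toFinite _) (Set.toFinite _)
    have e2 : X.blackᶜ.ncard = (Finset.univ.filter fun x => x ∉ X.black).card := by
      rw [← Set.ncard_coe_finset]
      congr 1
      ext x
      simp
    rw [Nat.card_eq_fintype_card, hcard] at e1
    omega
  have heq := Finset.eq_of_subset_of_card_le hsub (by omega)
  have hposw : ∀ x, x ≠ a → 0 < f (X.pt x) - f (X.pt a) := by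
    intro x hxa
    by_cases hx : x ∈ X.black
    · exact hpos x hx hxa
    · have : x ∈ X.positive h := by rw [heq]; simpa using hx
      rw [PlanarDiagram.mem_positive] at this
      rcases this with ⟨hxB, -⟩ | ⟨-, this⟩
      · exact absurd hxB hx
      · rw [hh] at this
        linarith
  refine ⟨X.pt a + !₂[β, -α], fun x hx => ?_⟩
  have := hposw x hx
  rw [hf (X.pt x), hf (X.pt a)] at this
  simp [area]
  linarith

open Classical in
/-- A triangle of black points contains exactly one white point: every other point lies beyond
exactly one edge of the triangle, and beyond each edge there are as many white points as black
ones. -/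
theorem card_inTri {i j k : ι} (hi : i ∈ X.black) (hj : j ∈ X.black) (hk : k ∈ X.black)
    (hpos : 0 < area (X.pt i) (X.pt j) (X.pt k)) :
    (Finset.univ.filter fun x => x ∉ X.black ∧
      InTri (X.pt i) (X.pt j) (X.pt k) (X.pt x)).card = 1 := by
  have hij : i ≠ j := by rintro rfl; simp at hpos
  have hjk : j ≠ k := by rintro rfl; simp at hpos
  have hki : k ≠ i := by rintro rfl; simp at hpos
  -- every other point is inside or beyond exactly one edge
  have htwo : ∀ {i j k x : ι}, i ∈ X.black → j ∈ X.black → k ∈ X.black → i ≠ j → j ≠ k → k ≠ i →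
      x ≠ j → 0 < area (X.pt i) (X.pt j) (X.pt k) → area (X.pt i) (X.pt j) (X.pt x) < 0 →
      area (X.pt j) (X.pt k) (X.pt x) < 0 → False := by
    intro i j k x hi hj hk hij hjk hki hxj h h1 h2
    obtain ⟨q, hq⟩ := exists_supporting hcard hN hB hconv hj
    refine not_inTri_of_exposed (hq i hij) (hq k hjk.symm) (hq x hxj) (Or.inr ⟨?_, ?_, ?_⟩)
    · rw [area_swap']; linarith
    · rwa [← area_rot]
    · rwa [area_rot]
  have hr1 : 0 < area (X.pt j) (X.pt k) (X.pt i) := by rwa [← area_rot]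
  have hr2 : 0 < area (X.pt k) (X.pt i) (X.pt j) := by rwa [← area_rot]
  have hone : ∀ x, x ≠ i → x ≠ j → x ≠ k →
      (1 : ℕ) = (if area (X.pt i) (X.pt j) (X.pt x) < 0 then 1 else 0) +
        (if area (X.pt j) (X.pt k) (X.pt x) < 0 then 1 else 0) +
        (if area (X.pt k) (X.pt i) (X.pt x) < 0 then 1 else 0) +
        (if InTri (X.pt i) (X.pt j) (X.pt k) (X.pt x) then 1 else 0) := by
    intro x hxi hxj hxk
    have e := area_add (X.pt i) (X.pt j) (X.pt k) (X.pt x)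
    have n1 := area_ne_zero_of_isCoface hcard hN hij hxj.symm hxi
    have n2 := area_ne_zero_of_isCoface hcard hN hjk hxk.symm hxj
    have n3 := area_ne_zero_of_isCoface hcard hN hki hxi.symm hxk
    have t1 := htwo hi hj hk hij hjk hki hxj hpos
    have t2 := htwo hj hk hi hjk hki hij hxk hr1
    have t3 := htwo hk hi hj hki hij hjk hxi hr2
    unfold InTri
    rcases lt_or_gt_of_ne n1 with s1 | s1 <;> rcases lt_or_gt_of_ne n2 with s2 | s2 <;>
      rcases lt_or_gt_of_ne n3 with s3 | s3
    · exact (t1 s1 s2).elim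
    · exact (t1 s1 s2).elim
    · exact (t3 s3 s1).elim
    · simp [s1, s1.not_gt, s2.not_gt, s3.not_gt]
    · exact (t2 s2 s3).elim
    · simp [s2, s1.not_gt, s2.not_gt, s3.not_gt]
    · simp [s3, s1.not_gt, s2.not_gt, s3.not_gt]
    · simp [s1, s2, s3, s1.not_gt, s2.not_gt, s3.not_gt]
  have c1 := card_white_eq_card_black hcard hN hB hi hj hij
  have c2 := card_white_eq_card_black hcard hN hB hj hk hjk
  have c3 := card_white_eq_card_black hcard hN hB hk hi hki
  have hsplit : ∀ (p : ι → Prop), (Finset.univ.filter fun x => x ∉ X.black ∧ p x).card =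
      ∑ x ∈ Finset.univ.filter (fun x => x ∉ X.black), if p x then 1 else 0 := by
    intro p
    rw [← Finset.card_filter, Finset.filter_filter]
  have hwhite : (Finset.univ.filter fun x => x ∉ X.black).card = d + 1 := by
    have e1 := Set.ncard_add_ncard_compl X.black (Set.toFinite _) (Set.toFinite _)
    have e2 : X.blackᶜ.ncard = (Finset.univ.filter fun x => x ∉ X.black).card := by
      rw [← Set.ncard_coe_finset]
      congr 1
      ext x
      simp
    rw [Nat.card_eq_fintype_card, hcard] at e1
    omega
  have hw : d + 1 = (Finset.univ.filter fun x => x ∉ X.black ∧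
        area (X.pt i) (X.pt j) (X.pt x) < 0).card +
      (Finset.univ.filter fun x => x ∉ X.black ∧ area (X.pt j) (X.pt k) (X.pt x) < 0).card +
      (Finset.univ.filter fun x => x ∉ X.black ∧ area (X.pt k) (X.pt i) (X.pt x) < 0).card +
      (Finset.univ.filter fun x => x ∉ X.black ∧
        InTri (X.pt i) (X.pt j) (X.pt k) (X.pt x)).card := by
    simp_rw [hsplit]
    rw [← Finset.sum_add_distrib, ← Finset.sum_add_distrib, ← Finset.sum_add_distrib, ← hwhite,
      Finset.card_eq_sum_ones]
    refine Finset.sum_congr rfl fun x hx => ?_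
    simp only [Finset.mem_filter, Finset.mem_univ, true_and] at hx
    exact hone x (by rintro rfl; exact hx hi) (by rintro rfl; exact hx hj)
      (by rintro rfl; exact hx hk)
  have hblack : (Finset.univ.filter fun x => x ∈ X.black ∧ x ≠ i ∧ x ≠ j ∧ x ≠ k).card = d := by
    have hsub : ({i, j, k} : Set ι) ⊆ X.black := by
      rintro x (rfl | rfl | rfl) <;> assumption
    have e1 := Set.ncard_sdiff_add_ncard_of_subset hsub (Set.toFinite _)
    rw [Set.ncard_eq_three.2 ⟨i, j, k, hij, hki.symm, hjk, rfl⟩] at e1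
    have e2 : (X.black \ {i, j, k}).ncard =
        (Finset.univ.filter fun x => x ∈ X.black ∧ x ≠ i ∧ x ≠ j ∧ x ≠ k).card := by
      rw [← Set.ncard_coe_finset]
      congr 1
      ext x
      simp only [Set.mem_sdiff, Set.mem_insert_iff, Set.mem_singleton_iff, not_or,
        Finset.coe_filter, Finset.mem_univ, true_and, Set.mem_ofPred_eq]
    omega
  have hsplit' : ∀ (p : ι → Prop), ¬ p i → ¬ p j → ¬ p k →
      (Finset.univ.filter fun x => x ∈ X.black ∧ p x).card =
      ∑ x ∈ Finset.univ.filter (fun x => x ∈ X.black ∧ x ≠ i ∧ x ≠ j ∧ x ≠ k),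
        if p x then 1 else 0 := by
    intro p h1 h2 h3
    rw [← Finset.card_filter, Finset.filter_filter]
    congr 1
    ext x
    simp only [Finset.mem_filter, Finset.mem_univ, true_and]
    constructor
    · rintro ⟨hx, hp⟩
      exact ⟨⟨hx, by rintro rfl; exact h1 hp, by rintro rfl; exact h2 hp,
        by rintro rfl; exact h3 hp⟩, hp⟩
    · rintro ⟨⟨hx, -⟩, hp⟩
      exact ⟨hx, hp⟩
  have hb : d = (Finset.univ.filter fun x => x ∈ X.black ∧
        area (X.pt i) (X.pt j) (X.pt x) < 0).card +
      (Finset.univ.filter fun x => x ∈ X.black ∧ area (X.pt j) (X.pt k) (X.pt x) < 0).card +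
      (Finset.univ.filter fun x => x ∈ X.black ∧ area (X.pt k) (X.pt i) (X.pt x) < 0).card := by
    rw [hsplit' _ (by simp) (by simp) hpos.not_gt, hsplit' _ hr1.not_gt (by simp) (by simp),
      hsplit' _ (by simp) hr2.not_gt (by simp)]
    rw [← Finset.sum_add_distrib, ← Finset.sum_add_distrib]
    conv_lhs => rw [← hblack, Finset.card_eq_sum_ones]
    refine Finset.sum_congr rfl fun x hx => ?_
    simp only [Finset.mem_filter, Finset.mem_univ, true_and] at hx
    have h1 := hone x hx.2.1 hx.2.2.1 hx.2.2.2
    rwa [if_neg (c := InTri _ _ _ _), add_zero] at h1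
    obtain ⟨q, hq⟩ := exists_supporting hcard hN hB hconv hx.1
    exact not_inTri_of_exposed (hq i hx.2.1.symm) (hq j hx.2.2.1.symm) (hq k hx.2.2.2.symm)
  omega

/-- A `T`-diagram is a tripod diagram. -/
theorem isTripodDiagram_of_isCoface : IsTripodDiagram X.pt X.black := by
  classical
  have key : ∀ {i j k : ι}, i ∈ X.black → j ∈ X.black → k ∈ X.black →
      area (X.pt i) (X.pt j) (X.pt k) ≠ 0 → ∃ w, ∀ x, (x ∉ X.black ∧
        InTri (X.pt i) (X.pt j) (X.pt k) (X.pt x)) ↔ x = w := by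
    have : ∀ {i j k : ι}, i ∈ X.black → j ∈ X.black → k ∈ X.black →
        0 < area (X.pt i) (X.pt j) (X.pt k) → ∃ w, ∀ x, (x ∉ X.black ∧
        InTri (X.pt i) (X.pt j) (X.pt k) (X.pt x)) ↔ x = w := by
      intro i j k hi hj hk hpos
      obtain ⟨w, hw⟩ := Finset.card_eq_one.1 (card_inTri hcard hN hB hconv hi hj hk hpos)
      refine ⟨w, fun x => ?_⟩
      have := Finset.ext_iff.1 hw x
      simpa using this
    intro i j k hi hj hk hne
    rcases lt_or_gt_of_ne hne with h | h
    · obtain ⟨w, hw⟩ := this hj hi hk (by rw [area_swap]; linarith)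
      exact ⟨w, fun x => ⟨fun hx => (hw x).1 ⟨hx.1, hx.2.swap⟩, fun hx =>
        ⟨((hw x).2 hx).1, ((hw x).2 hx).2.swap⟩⟩⟩
    · exact this hi hj hk h
  have hpre : IsPreTripodDiagram X.pt X.black := by
    refine ⟨fun a ha => exists_supporting hcard hN hB hconv ha, ?_, ?_⟩
    · intro i j x hi hj hij hxi hxj
      exact area_ne_zero_of_isCoface hcard hN hij hxj.symm hxi
    · intro i j k hi hj hk h1 h2 h3
      obtain ⟨w, hw⟩ := key hi hj hk (area_ne_zero_of_isCoface hcard hN h1 h2 h3)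
      exact ⟨w, (hw w).2 rfl⟩
  refine ⟨hpre, ?_, ?_⟩
  · intro w w' i j k hw hw' hi hj hk h h'
    obtain ⟨v, hv⟩ := key hi hj hk h.area_ne
    exact ((hv w).1 ⟨hw, h⟩).trans ((hv w').1 ⟨hw', h'⟩).symm
  · intro w hw
    obtain ⟨a, ha⟩ : X.black.Nonempty := Set.nonempty_of_ncard_ne_zero (by omega)
    have hf := hpre.card_le_fan ha (X.black.toFinset.erase a)
      (fun k hk => by simp at hk; exact ⟨hk.2, hk.1⟩)
    rw [Finset.card_erase_of_mem (by simpa using ha), ← Set.ncard_eq_toFinset_card', hB] at hf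
    set F := {w | w ∉ X.black ∧ ∃ k ∈ X.black.toFinset.erase a, ∃ l ∈ X.black.toFinset.erase a,
      InTri (X.pt a) (X.pt k) (X.pt l) (X.pt w)} with hF
    have hsub : F ⊆ X.blackᶜ := fun x hx => hx.1
    have e1 := Set.ncard_add_ncard_compl X.black (Set.toFinite _) (Set.toFinite _)
    rw [Nat.card_eq_fintype_card, hcard] at e1
    have hFe := Set.eq_of_subset_of_ncard_le hsub (by omega) (Set.toFinite _)
    have : w ∈ F := by rw [hFe]; exact hw
    obtain ⟨-, k, hk, l, hl, hM⟩ := this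
    simp at hk hl
    exact ⟨a, ha, k, hk.2, l, hl.2, hM⟩

end Count

/-! ### A diagram is determined by its cofaces -/

/-- A point is not beyond two edges of a triangle at a black vertex, for that vertex is exposed. -/
theorem IsPreTripodDiagram.not_beyond_two_edges {ι : Type*} {pt : ι → E 2} {B : Set ι}
    {l n s x : ι} (h : IsPreTripodDiagram pt B) (hn : n ∈ B)
    (h0 : 0 < area (pt l) (pt n) (pt s)) (h1 : area (pt l) (pt n) (pt x) < 0)
    (h2 : area (pt n) (pt s) (pt x) < 0) : False := by
  obtain ⟨q, hq⟩ := h.exposed n hn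
  refine not_inTri_of_exposed (hq l ?_) (hq s ?_) (hq x ?_) (Or.inr ⟨?_, ?_, ?_⟩)
  · rintro rfl; simp at h0
  · rintro rfl; simp at h0
  · rintro rfl; simp at h1
  · rw [area_swap']; linarith
  · rwa [← area_rot]
  · rwa [area_rot]

namespace IsTripodDiagram

variable {ι : Type*} [Fintype ι] {pt pt₁ pt₂ : ι → E 2} {B B₁ B₂ T : Set ι}
variable {i j k l n s b p q r x y w w' : ι}

/-- A coface with four elements contains two or three black points. -/
theorem exists_mem_mem (h : IsTripodDiagram pt B) (hT : IsCoface pt B T) (hx : x ∈ T) :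
    ∃ i ∈ T, ∃ j ∈ T, i ∈ B ∧ j ∈ B ∧ i ≠ j := by
  obtain ⟨i, hi, hiB⟩ := hT.exists_mem ⟨x, hx⟩
  obtain ⟨j, hj, hjB, hji⟩ := h.exists_mem_ne hT hiB hi
  exact ⟨i, hi, j, hj, hiB, hjB, hji.symm⟩

/-- Let `l`, `n`, `s` be black points such that the white point `b` is beyond the edge `ln` of their
triangle. It cannot happen that only one four-element coface contains `l`, `n`, `b`, and some
four-element coface contains `n`, `s`, `b`. -/
theorem false_of_unique (h : IsTripodDiagram pt B) (hl : l ∈ B) (hn : n ∈ B) (hs : s ∈ B)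
    (hb : b ∉ B) (h0 : 0 < area (pt l) (pt n) (pt s)) (h1 : area (pt l) (pt n) (pt b) < 0)
    (hu : ∀ x y, x ∉ ({l, n, b} : Set ι) → y ∉ ({l, n, b} : Set ι) →
      IsCoface pt B {l, n, b, x} → IsCoface pt B {l, n, b, y} → x = y)
    (hex : ∃ x, x ∉ ({n, s, b} : Set ι) ∧ IsCoface pt B {n, s, b, x}) : False := by
  classical
  have hln : l ≠ n := by rintro rfl; simp at h0
  have hns : n ≠ s := by rintro rfl; simp at h0
  have hsl : s ≠ l := by rintro rfl; simp at h0
  have mem3 : ∀ {i j k x : ι}, x ∉ ({i, j, k} : Set ι) ↔ x ≠ i ∧ x ≠ j ∧ x ≠ k := by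
    intro i j k x; simp
  -- white points beyond `ln` are unique
  have hw1 : ∀ w w', w ∉ B → w' ∉ B → 0 < area (pt l) (pt n) (pt w) →
      0 < area (pt l) (pt n) (pt w') → w = w' := by
    intro w w' hw hw' a a'
    have hwb : w ≠ b := by rintro rfl; linarith
    have hwb' : w' ≠ b := by rintro rfl; linarith
    exact hu w w' (mem3.2 ⟨ne_white hl hw, ne_white hn hw, hwb⟩)
      (mem3.2 ⟨ne_white hl hw', ne_white hn hw', hwb'⟩)
      (h.isCoface_of_mul_neg hl hn hb hw (mul_neg_of_neg_of_pos h1 a))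
      (h.isCoface_of_mul_neg hl hn hb hw' (mul_neg_of_neg_of_pos h1 a'))
  obtain ⟨v, hv, hM⟩ := h.ex hl hn hs hln hns hsl
  have hvpos := hM.pos_iff.2 h0
  -- therefore `s` is the only black point on its side of `ln`
  have honly : ∀ t ∈ B, 0 < area (pt l) (pt n) (pt t) → t = s := by
    intro t ht hpos
    by_contra hts
    have htn : t ≠ n := by rintro rfl; simp at hpos
    have htl : t ≠ l := by rintro rfl; simp at hpos
    have hc := h.card_le_fan hl {n, s, t} (by
      intro k hk
      simp only [Finset.mem_insert, Finset.mem_singleton] at hk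
      rcases hk with rfl | rfl | rfl
      exacts [⟨hn, hln.symm⟩, ⟨hs, hsl⟩, ⟨ht, htl⟩])
    rw [Finset.card_eq_three.2 ⟨n, s, t, hns, htn.symm, Ne.symm hts, rfl⟩] at hc
    have hc' : 1 < {w | w ∉ B ∧ ∃ k ∈ ({n, s, t} : Finset ι), ∃ l' ∈ ({n, s, t} : Finset ι),
      InTri (pt l) (pt k) (pt l') (pt w)}.ncard := by omega
    rw [Set.one_lt_ncard (Set.toFinite _)] at hc'
    obtain ⟨w, ⟨hw, k, hk, k', hk', hM1⟩, w', ⟨hw', m, hm, m', hm', hM2⟩, hne⟩ := hc'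
    have nn : ∀ k ∈ ({n, s, t} : Finset ι), 0 ≤ area (pt l) (pt n) (pt k) ∧
        (k ≠ n → 0 < area (pt l) (pt n) (pt k)) := by
      intro k hk
      simp only [Finset.mem_insert, Finset.mem_singleton] at hk
      rcases hk with rfl | rfl | rfl
      · simp
      · exact ⟨h0.le, fun _ => h0⟩
      · exact ⟨hpos.le, fun _ => hpos⟩
    have side : ∀ {w k k'}, k ∈ ({n, s, t} : Finset ι) → k' ∈ ({n, s, t} : Finset ι) →
        InTri (pt l) (pt k) (pt k') (pt w) → 0 < area (pt l) (pt n) (pt w) := by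
      intro w k k' hk hk' hM1
      refine hM1.pos (by simp) (nn k hk).1 (nn k' hk').1 ?_
      by_cases hkn : k = n
      · exact Or.inr (Or.inr ((nn k' hk').2 fun e => hM1.ne.2.1 (hkn.trans e.symm)))
      · exact Or.inr (Or.inl ((nn k hk).2 hkn))
    exact hne (hw1 w w' hw hw' (side hk hk' hM1) (side hm hm' hM2))
  -- `b` lies in no triangle with the edge `ln`
  have hno : ∀ x ∈ B, ¬ InTri (pt l) (pt n) (pt x) (pt b) := by
    intro x hx hMx
    have e1 : IsCoface pt B {l, n, b, x} := by
      rw [show ({l, n, b, x} : Set ι) = {l, n, x, b} by rw [Set.pair_comm b x]]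
      exact isCoface_of_inTri hl hn hx hb hMx
    have hvb : v ≠ b := by rintro rfl; linarith
    have := hu x v (mem3.2 ⟨hMx.ne.2.2, hMx.ne.2.1.symm, (ne_white hx hb).symm⟩)
      (mem3.2 ⟨ne_white hl hv, ne_white hn hv, hvb⟩) e1
      (h.isCoface_of_mul_neg hl hn hb hv (mul_neg_of_neg_of_pos h1 hvpos))
    exact hv (this ▸ hx)
  have hbns : 0 < area (pt n) (pt s) (pt b) := by
    refine lt_of_le_of_ne (not_lt.1 fun c => ?_)
      (h.nz hn hs hns (ne_white hn hb) (ne_white hs hb)).symm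
    exact h.not_beyond_two_edges hn h0 h1 c
  obtain ⟨x, hx, hcx⟩ := hex
  rw [mem3] at hx
  by_cases hxB : x ∈ B
  · -- then `b` would lie on both sides of the line `sx`
    have hMx : InTri (pt n) (pt s) (pt x) (pt b) := by
      rw [show ({n, s, b, x} : Set ι) = {n, s, x, b} by rw [Set.pair_comm b x]] at hcx
      exact h.inTri_of_isCoface hn hs hxB hb hns (Ne.symm hx.2.1) hx.1 hcx
    have hMl : InTri (pt l) (pt s) (pt x) (pt b) := by
      rcases h.four hb hn hs hxB hl hMx with c | c | c
      · exact c.1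
      · exact absurd c.2.1.swap (hno x hxB)
      · exact absurd c.2.2.rot.rot (hno s hs)
    have hxl : x ≠ l := hMl.ne.2.2
    have hxneg : area (pt l) (pt n) (pt x) < 0 := by
      refine lt_of_le_of_ne (not_lt.1 fun c => hx.2.1 (honly x hxB c)) ?_
      exact h.nz hl hn hln hxl hx.1
    obtain ⟨c1, c2⟩ := h.crossing hl hn h0 hxneg
    have d1 : 0 < area (pt s) (pt x) (pt n) := by rwa [← area_rot]
    have d2 : area (pt s) (pt x) (pt l) < 0 := by
      rw [← area_rot, area_swap']; linarith
    rw [← hMx.rot.pos_iff] at d1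
    rw [← hMl.rot.neg_iff] at d2
    linarith
  · have hneg := h.mul_neg_of_isCoface hn hs hb hxB hns (Ne.symm hx.2.2) hcx
    have hxn : 0 < area (pt s) (pt n) (pt x) := by
      rw [area_swap]
      have := neg_of_mul_neg_right hneg hbns.le
      linarith
    obtain ⟨p, hp, q, hq, r, hr, hMx, hside⟩ := (h.area_pos_iff hs hn hns.symm hxB).1 hxn
    -- some black point is beyond the edge `ns`
    obtain ⟨t, ht, htpos⟩ : ∃ t ∈ B, 0 < area (pt s) (pt n) (pt t) := by
      have n1 := hMx.ne
      have h1 := hside p (by simp)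
      have h2 := hside q (by simp)
      have h3 := hside r (by simp)
      by_contra hcon
      push Not at hcon
      have := hcon p hp
      have := hcon q hq
      have := hcon r hr
      grind
    rw [area_swap] at htpos
    have hts : t ≠ s := by rintro rfl; simp at htpos
    have htn : t ≠ n := by rintro rfl; simp at htpos
    have htl : t ≠ l := by
      rintro rfl
      rw [← area_rot] at htpos
      linarith
    refine h.not_beyond_two_edges hn h0 (x := t) ?_ (by linarith)
    exact lt_of_le_of_ne (not_lt.1 fun c => hts (honly t ht c)) (h.nz hl hn hln htl htn)

/-- The cofaces determine the colours. If `b` is black in the second diagram only, any two black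
points common to both diagrams lie in a unique four-element coface with `b`. In the first diagram,
this is impossible for the edges of a triangle of three such points, wherever `b` lies. -/
theorem subset_of_isCoface_iff (h₁ : IsTripodDiagram pt₁ B₁) (h₂ : IsTripodDiagram pt₂ B₂)
    (hB₁ : 5 ≤ B₁.ncard) (hT : ∀ T, IsCoface pt₁ B₁ T ↔ IsCoface pt₂ B₂ T) : B₂ ⊆ B₁ := by
  classical
  intro b hb₂
  by_contra hb₁
  -- at most two black points of the first diagram are white in the second one
  have htwo : (B₁ \ B₂).ncard ≤ 2 := by
    by_contra hcon
    obtain ⟨i, ⟨hi, hi'⟩, j, ⟨hj, hj'⟩, k, ⟨hk, hk'⟩, hij, hik, hjk⟩ :=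
      (Set.two_lt_ncard (Set.toFinite _)).1 (not_le.1 hcon)
    obtain ⟨w, hw, hM⟩ := h₁.ex hi hj hk hij hjk hik.symm
    have hc := (hT _).1 (isCoface_of_inTri hi hj hk hw hM)
    obtain ⟨x, hx, y, hy, hxB, hyB, hxy⟩ := h₂.exists_mem_mem hc (x := i) (by simp)
    simp only [Set.mem_insert_iff, Set.mem_singleton_iff] at hx hy
    grind
  have hcard := Set.ncard_inter_add_ncard_sdiff_eq_ncard B₁ B₂ (Set.toFinite _)
  obtain ⟨l, ⟨hl₁, hl₂⟩, n, ⟨hn₁, hn₂⟩, s, ⟨hs₁, hs₂⟩, hln, hls, hns⟩ :=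
    (Set.two_lt_ncard (s := B₁ ∩ B₂) (Set.toFinite _)).1 (by omega)
  -- two common black points and `b` form a triangle of the second diagram
  have uniq : ∀ {l n}, l ∈ B₁ → l ∈ B₂ → n ∈ B₁ → n ∈ B₂ → l ≠ n →
      ∃ v, v ∉ ({l, n, b} : Set ι) ∧ IsCoface pt₁ B₁ {l, n, b, v} ∧
        ∀ x, x ∉ ({l, n, b} : Set ι) → IsCoface pt₁ B₁ {l, n, b, x} → x = v := by
    intro l n hl₁ hl₂ hn₁ hn₂ hln
    have hlb : l ≠ b := by rintro rfl; exact hb₁ hl₁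
    have hnb : n ≠ b := by rintro rfl; exact hb₁ hn₁
    obtain ⟨v, hv, hM⟩ := h₂.ex hl₂ hn₂ hb₂ hln hnb hlb.symm
    refine ⟨v, ?_, (hT _).2 (isCoface_of_inTri hl₂ hn₂ hb₂ hv hM), fun x hx hc => ?_⟩
    · simp only [Set.mem_insert_iff, Set.mem_singleton_iff, not_or]
      exact ⟨ne_white hl₂ hv, ne_white hn₂ hv, ne_white hb₂ hv⟩
    · have hc₂ := (hT _).1 hc
      obtain ⟨w, hw, hwB⟩ := hc₂.exists_notMem ⟨l, by simp⟩
      have hwx : w = x := by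
        simp only [Set.mem_insert_iff, Set.mem_singleton_iff] at hw
        rcases hw with rfl | rfl | rfl | rfl
        exacts [absurd hl₂ hwB, absurd hn₂ hwB, absurd hb₂ hwB, rfl]
      subst hwx
      exact h₂.un hwB hv hl₂ hn₂ hb₂
        (h₂.inTri_of_isCoface hl₂ hn₂ hb₂ hwB hln hnb hlb.symm hc₂) hM
  have uniq' : ∀ {l n}, l ∈ B₁ → l ∈ B₂ → n ∈ B₁ → n ∈ B₂ → l ≠ n → ∀ x y,
      x ∉ ({l, n, b} : Set ι) → y ∉ ({l, n, b} : Set ι) →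
      IsCoface pt₁ B₁ {l, n, b, x} → IsCoface pt₁ B₁ {l, n, b, y} → x = y := by
    intro l n hl₁ hl₂ hn₁ hn₂ hln x y hx hy hcx hcy
    obtain ⟨v, -, -, hv⟩ := uniq hl₁ hl₂ hn₁ hn₂ hln
    exact (hv x hx hcx).trans (hv y hy hcy).symm
  have ex' : ∀ {l n}, l ∈ B₁ → l ∈ B₂ → n ∈ B₁ → n ∈ B₂ → l ≠ n →
      ∃ x, x ∉ ({l, n, b} : Set ι) ∧ IsCoface pt₁ B₁ {l, n, b, x} := by
    intro l n hl₁ hl₂ hn₁ hn₂ hln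
    obtain ⟨v, h1, h2, -⟩ := uniq hl₁ hl₂ hn₁ hn₂ hln
    exact ⟨v, h1, h2⟩
  have main : ∀ {l n s}, l ∈ B₁ → l ∈ B₂ → n ∈ B₁ → n ∈ B₂ → s ∈ B₁ → s ∈ B₂ →
      0 < area (pt₁ l) (pt₁ n) (pt₁ s) → area (pt₁ l) (pt₁ n) (pt₁ b) < 0 → False := by
    intro l n s hl₁ hl₂ hn₁ hn₂ hs₁ hs₂ h0 h1
    have hln : l ≠ n := by rintro rfl; simp at h0
    have hns : n ≠ s := by rintro rfl; simp at h0
    exact h₁.false_of_unique hl₁ hn₁ hs₁ hb₁ h0 h1 (uniq' hl₁ hl₂ hn₁ hn₂ hln)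
      (ex' hn₁ hn₂ hs₁ hs₂ hns)
  -- a white point in a triangle of common black points is in a second triangle over some edge
  have inside : ∀ {l n s}, l ∈ B₁ → l ∈ B₂ → n ∈ B₁ → n ∈ B₂ → s ∈ B₁ → s ∈ B₂ →
      ¬ InTri (pt₁ l) (pt₁ n) (pt₁ s) (pt₁ b) := by
    intro l n s hl₁ hl₂ hn₁ hn₂ hs₁ hs₂ hM
    obtain ⟨n1, n2, n3⟩ := hM.ne
    obtain ⟨t, ht, htn⟩ : ∃ t ∈ B₁, t ∉ ({l, n, s} : Set ι) := by
      refine Set.exists_mem_notMem_of_ncard_lt_ncard ?_ (Set.toFinite _)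
      rw [Set.ncard_eq_three.2 ⟨l, n, s, n1, n3.symm, n2, rfl⟩]
      omega
    simp only [Set.mem_insert_iff, Set.mem_singleton_iff, not_or] at htn
    have edge : ∀ {l n s}, l ∈ B₁ → l ∈ B₂ → n ∈ B₁ → n ∈ B₂ → s ∈ B₁ → t ≠ s →
        InTri (pt₁ l) (pt₁ n) (pt₁ s) (pt₁ b) → InTri (pt₁ l) (pt₁ n) (pt₁ t) (pt₁ b) →
        False := by
      intro l n s hl₁ hl₂ hn₁ hn₂ hs₁ hts hM hM'
      have c1 := isCoface_of_inTri hl₁ hn₁ hs₁ hb₁ hM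
      have c2 := isCoface_of_inTri hl₁ hn₁ ht hb₁ hM'
      rw [show ({l, n, s, b} : Set ι) = {l, n, b, s} by rw [Set.pair_comm b s]] at c1
      rw [show ({l, n, t, b} : Set ι) = {l, n, b, t} by rw [Set.pair_comm b t]] at c2
      refine hts (uniq' hl₁ hl₂ hn₁ hn₂ hM.ne.1 t s ?_ ?_ c2 c1)
      · simp only [Set.mem_insert_iff, Set.mem_singleton_iff, not_or]
        exact ⟨hM'.ne.2.2, hM'.ne.2.1.symm, (ne_white ht hb₁).symm⟩
      · simp only [Set.mem_insert_iff, Set.mem_singleton_iff, not_or]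
        exact ⟨hM.ne.2.2, hM.ne.2.1.symm, (ne_white hs₁ hb₁).symm⟩
    rcases h₁.four hb₁ hl₁ hn₁ hs₁ ht hM with c | c | c
    · exact edge hn₁ hn₂ hs₁ hs₂ hl₁ htn.1 hM.rot c.1.rot
    · exact edge hs₁ hs₂ hl₁ hl₂ hn₁ htn.2.1 hM.rot.rot c.2.1.rot.rot
    · exact edge hl₁ hl₂ hn₁ hn₂ hs₁ htn.2.2 hM c.2.2
  have fin : ∀ {l n s}, l ∈ B₁ → l ∈ B₂ → n ∈ B₁ → n ∈ B₂ → s ∈ B₁ → s ∈ B₂ →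
      0 < area (pt₁ l) (pt₁ n) (pt₁ s) → False := by
    intro l n s hl₁ hl₂ hn₁ hn₂ hs₁ hs₂ h0
    have hln : l ≠ n := by rintro rfl; simp at h0
    have hns : n ≠ s := by rintro rfl; simp at h0
    have hsl : s ≠ l := by rintro rfl; simp at h0
    have r1 : 0 < area (pt₁ n) (pt₁ s) (pt₁ l) := by rwa [← area_rot]
    have r2 : 0 < area (pt₁ s) (pt₁ l) (pt₁ n) := by rwa [← area_rot]
    have nz : ∀ {i j}, i ∈ B₁ → j ∈ B₁ → i ≠ j → area (pt₁ i) (pt₁ j) (pt₁ b) ≠ 0 :=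
      fun hi hj hij => h₁.nz hi hj hij (ne_white hi hb₁) (ne_white hj hb₁)
    rcases lt_or_gt_of_ne (nz hl₁ hn₁ hln) with c1 | c1
    · exact main hl₁ hl₂ hn₁ hn₂ hs₁ hs₂ h0 c1
    rcases lt_or_gt_of_ne (nz hn₁ hs₁ hns) with c2 | c2
    · exact main hn₁ hn₂ hs₁ hs₂ hl₁ hl₂ r1 c2
    rcases lt_or_gt_of_ne (nz hs₁ hl₁ hsl) with c3 | c3
    · exact main hs₁ hs₂ hl₁ hl₂ hn₁ hn₂ r2 c3
    exact inside hl₁ hl₂ hn₁ hn₂ hs₁ hs₂ (Or.inl ⟨c1, c2, c3⟩)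
  rcases lt_or_gt_of_ne (h₁.nz hl₁ hn₁ hln hls.symm hns.symm) with c | c
  · exact fin hn₁ hn₂ hl₁ hl₂ hs₁ hs₂ (by rw [area_swap]; linarith)
  · exact fin hl₁ hl₂ hn₁ hn₂ hs₁ hs₂ c

theorem inTri_iff_of_isCoface_iff (h₁ : IsTripodDiagram pt₁ B) (h₂ : IsTripodDiagram pt₂ B)
    (hT : ∀ T, IsCoface pt₁ B T ↔ IsCoface pt₂ B T) (hi : i ∈ B) (hj : j ∈ B) (hk : k ∈ B)
    (hw : w ∉ B) : InTri (pt₁ i) (pt₁ j) (pt₁ k) (pt₁ w) ↔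
      InTri (pt₂ i) (pt₂ j) (pt₂ k) (pt₂ w) := by
  constructor
  · intro h
    obtain ⟨n1, n2, n3⟩ := h.ne
    exact h₂.inTri_of_isCoface hi hj hk hw n1 n2 n3 ((hT _).1 (isCoface_of_inTri hi hj hk hw h))
  · intro h
    obtain ⟨n1, n2, n3⟩ := h.ne
    exact h₁.inTri_of_isCoface hi hj hk hw n1 n2 n3 ((hT _).2 (isCoface_of_inTri hi hj hk hw h))

/-- Diagrams with the same cofaces have the same orientation up to a global sign. -/
theorem orientation_of_isCoface_iff (h₁ : IsTripodDiagram pt₁ B) (h₂ : IsTripodDiagram pt₂ B)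
    (hT : ∀ T, IsCoface pt₁ B T ↔ IsCoface pt₂ B T) (hB : 3 ≤ B.ncard) :
    (∀ i ∈ B, ∀ j ∈ B, ∀ k ∈ B, 0 < area (pt₁ i) (pt₁ j) (pt₁ k) →
      0 < area (pt₂ i) (pt₂ j) (pt₂ k)) ∨
    (∀ i ∈ B, ∀ j ∈ B, ∀ k ∈ B, 0 < area (pt₁ i) (pt₁ j) (pt₁ k) →
      area (pt₂ i) (pt₂ j) (pt₂ k) < 0) := by
  classical
  -- the two diagrams agree on whether two black points are on the same side of a line
  have sep : ∀ {pt₁ pt₂ : ι → E 2}, IsTripodDiagram pt₁ B → IsTripodDiagram pt₂ B →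
      (∀ T, IsCoface pt₁ B T ↔ IsCoface pt₂ B T) → ∀ {i j k l}, i ∈ B → j ∈ B → k ∈ B → l ∈ B →
      area (pt₁ i) (pt₁ j) (pt₁ k) * area (pt₁ i) (pt₁ j) (pt₁ l) < 0 →
      area (pt₂ i) (pt₂ j) (pt₂ k) * area (pt₂ i) (pt₂ j) (pt₂ l) < 0 := by
    intro pt₁ pt₂ h₁ h₂ hT i j k l hi hj hk hl hneg
    have hij : i ≠ j := by rintro rfl; simp at hneg
    have hki : k ≠ i := by rintro rfl; simp at hneg
    have hkj : k ≠ j := by rintro rfl; simp at hneg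
    have hli : l ≠ i := by rintro rfl; simp at hneg
    have hlj : l ≠ j := by rintro rfl; simp at hneg
    obtain ⟨w, hw, hM⟩ := h₁.ex hi hj hk hij hkj.symm hki
    obtain ⟨w', hw', hM'⟩ := h₁.ex hi hj hl hij hlj.symm hli
    have hM₂ := (inTri_iff_of_isCoface_iff h₁ h₂ hT hi hj hk hw).1 hM
    have hM₂' := (inTri_iff_of_isCoface_iff h₁ h₂ hT hi hj hl hw').1 hM'
    have hneg' : area (pt₁ i) (pt₁ j) (pt₁ w) * area (pt₁ i) (pt₁ j) (pt₁ w') < 0 := by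
      rw [mul_neg_iff] at hneg ⊢
      rw [hM.pos_iff, hM.neg_iff, hM'.pos_iff, hM'.neg_iff]
      exact hneg
    have hww : w ≠ w' := by
      rintro rfl
      exact absurd (mul_self_nonneg (area (pt₁ i) (pt₁ j) (pt₁ w))) (not_le.2 hneg')
    have := h₂.mul_neg_of_isCoface hi hj hw hw' hij hww
      ((hT _).1 (h₁.isCoface_of_mul_neg hi hj hw hw' hneg'))
    rw [mul_neg_iff] at this ⊢
    rw [hM₂.pos_iff, hM₂.neg_iff, hM₂'.pos_iff, hM₂'.neg_iff] at this
    exact this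
  let S : ι → ι → ι → Prop := fun i j k =>
    0 < area (pt₁ i) (pt₁ j) (pt₁ k) * area (pt₂ i) (pt₂ j) (pt₂ k)
  have rot : ∀ {i j k}, S i j k → S j k i := fun {i j k} s => by
    change 0 < _ at s ⊢
    rwa [← area_rot, ← area_rot (pt₂ i)]
  have swap : ∀ {i j k}, S i j k → S j i k := fun {i j k} s => by
    change 0 < _ at s ⊢
    rw [area_swap, area_swap (pt₂ i)]
    linarith
  have exch : ∀ {i j k l}, i ∈ B → j ∈ B → k ∈ B → l ∈ B → l ≠ i → l ≠ j → S i j k → S i j l := by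
    intro i j k l hi hj hk hl hli hlj s
    change 0 < _ at s ⊢
    have hij : i ≠ j := by rintro rfl; simp at s
    have e1 := h₁.nz hi hj hij hli hlj
    have e2 := h₂.nz hi hj hij hli hlj
    have f1 := sep h₁ h₂ hT hi hj hk hl
    have f2 := sep h₂ h₁ (fun T => (hT T).symm) hi hj hk hl
    rw [mul_neg_iff, mul_neg_iff] at f1 f2
    rw [mul_pos_iff] at s ⊢
    rcases lt_or_gt_of_ne e1 with a | a <;> rcases lt_or_gt_of_ne e2 with b | b
    · exact Or.inr ⟨a, b⟩
    · exfalso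
      rcases s with s | s
      · rcases f1 (Or.inl ⟨s.1, a⟩) with c | c <;> linarith
      · rcases f2 (Or.inr ⟨s.2, b⟩) with c | c <;> linarith
    · exfalso
      rcases s with s | s
      · rcases f2 (Or.inl ⟨s.2, b⟩) with c | c <;> linarith
      · rcases f1 (Or.inr ⟨s.1, a⟩) with c | c <;> linarith
    · exact Or.inl ⟨a, b⟩
  have ne : ∀ {i j k}, S i j k → i ≠ j ∧ j ≠ k ∧ k ≠ i := by
    intro i j k s
    change 0 < _ at s
    refine ⟨?_, ?_, ?_⟩ <;> rintro rfl <;> simp at s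
  have fix : ∀ {i j k q r}, i ∈ B → j ∈ B → k ∈ B → q ∈ B → r ∈ B → i ≠ q → q ≠ r → r ≠ i →
      S i j k → S i q r := by
    intro i j k q r hi hj hk hq hr h1 h2 h3 s
    by_cases hqj : q = j
    · subst hqj
      exact exch hi hq hk hr h3 h2.symm s
    · have s1 := exch hi hj hk hq h1.symm hqj s
      have s2 : S i q j := rot (rot (swap (rot s1)))
      exact exch hi hq hj hr h3 h2.symm s2
  have all : ∀ {i j k p q r}, i ∈ B → j ∈ B → k ∈ B → p ∈ B → q ∈ B → r ∈ B → p ≠ q → q ≠ r →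
      r ≠ p → S i j k → S p q r := by
    intro i j k p q r hi hj hk hp hq hr h1 h2 h3 s
    by_cases hip : i = p
    · subst hip
      exact fix hi hj hk hq hr h1 h2 h3 s
    · obtain ⟨x, hx, hxn⟩ : ∃ x ∈ B, x ∉ ({i, p} : Set ι) := by
        refine Set.exists_mem_notMem_of_ncard_lt_ncard ?_ (Set.toFinite _)
        rw [Set.ncard_pair hip]
        omega
      simp only [Set.mem_insert_iff, Set.mem_singleton_iff, not_or] at hxn
      exact fix hp hi hx hq hr h1 h2 h3
        (swap (fix hi hj hk hp hx hip (Ne.symm hxn.2) hxn.1 s))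
  by_cases hex : ∃ i ∈ B, ∃ j ∈ B, ∃ k ∈ B, S i j k
  · obtain ⟨i, hi, j, hj, k, hk, s⟩ := hex
    left
    intro p hp q hq r hr hpos
    have n1 : p ≠ q := by rintro rfl; simp at hpos
    have n2 : q ≠ r := by rintro rfl; simp at hpos
    have n3 : r ≠ p := by rintro rfl; simp at hpos
    exact pos_of_mul_pos_right (all hi hj hk hp hq hr n1 n2 n3 s) hpos.le
  · push Not at hex
    right
    intro p hp q hq r hr hpos
    have n1 : p ≠ q := by rintro rfl; simp at hpos
    have n2 : q ≠ r := by rintro rfl; simp at hpos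
    have n3 : r ≠ p := by rintro rfl; simp at hpos
    refine lt_of_le_of_ne (not_lt.1 fun c => hex p hp q hq r hr (mul_pos hpos c)) ?_
    exact h₂.nz hp hq n1 n3 n2.symm

end IsTripodDiagram

/-! ### Equivalence of tripod systems -/

/-- `e` identifies two tripod systems up to reversal of the cyclic order. -/
structure TripodEquiv {ι ι' κ κ' : Type*} (B : Set ι) (o : ι → ι → ι → Prop) (br : ι → ι → κ)
    (B' : Set ι') (o' : ι' → ι' → ι' → Prop) (br' : ι' → ι' → κ') (e : ι ≃ ι') : Prop where
  mem : ∀ i, e i ∈ B' ↔ i ∈ B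
  splits : ∀ w i j k, w ∉ B → i ∈ B → j ∈ B → k ∈ B →
    (Splits (br' (e w)) (e i) (e j) (e k) ↔ Splits (br w) i j k)
  order : (∀ i j k, i ∈ B → j ∈ B → k ∈ B → (o' (e i) (e j) (e k) ↔ o i j k)) ∨
    (∀ i j k, i ∈ B → j ∈ B → k ∈ B → (o' (e k) (e j) (e i) ↔ o i j k))

namespace TripodEquiv

variable {ι ι' ι'' κ κ' κ'' : Type*} {B : Set ι} {o : ι → ι → ι → Prop} {br : ι → ι → κ}
  {B' : Set ι'} {o' : ι' → ι' → ι' → Prop} {br' : ι' → ι' → κ'}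
  {B'' : Set ι''} {o'' : ι'' → ι'' → ι'' → Prop} {br'' : ι'' → ι'' → κ''}
  {e : ι ≃ ι'} {e' : ι' ≃ ι''}

theorem symm (h : TripodEquiv B o br B' o' br' e) : TripodEquiv B' o' br' B o br e.symm where
  mem i := by rw [← h.mem, e.apply_symm_apply]
  splits w i j k hw hi hj hk := by
    have m : ∀ i, e.symm i ∈ B ↔ i ∈ B' := fun i => by rw [← h.mem, e.apply_symm_apply]
    rw [← h.splits _ _ _ _ (by rwa [m]) ((m _).2 hi) ((m _).2 hj) ((m _).2 hk)]
    simp only [e.apply_symm_apply]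
  order := by
    have m : ∀ i, e.symm i ∈ B ↔ i ∈ B' := fun i => by rw [← h.mem, e.apply_symm_apply]
    refine h.order.imp (fun h i j k hi hj hk => ?_) (fun h i j k hi hj hk => ?_)
    · rw [← h _ _ _ ((m _).2 hi) ((m _).2 hj) ((m _).2 hk)]
      simp only [e.apply_symm_apply]
    · rw [← h _ _ _ ((m _).2 hk) ((m _).2 hj) ((m _).2 hi)]
      simp only [e.apply_symm_apply]

theorem trans (h : TripodEquiv B o br B' o' br' e) (h' : TripodEquiv B' o' br' B'' o'' br'' e') :
    TripodEquiv B o br B'' o'' br'' (e.trans e') where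
  mem i := (h'.mem _).trans (h.mem i)
  splits w i j k hw hi hj hk := (h'.splits _ _ _ _ (by rwa [h.mem]) ((h.mem _).2 hi)
    ((h.mem _).2 hj) ((h.mem _).2 hk)).trans (h.splits _ _ _ _ hw hi hj hk)
  order := by
    rcases h.order with ho | ho <;> rcases h'.order with ho' | ho'
    · exact Or.inl fun i j k hi hj hk => (ho' _ _ _ ((h.mem _).2 hi) ((h.mem _).2 hj)
        ((h.mem _).2 hk)).trans (ho i j k hi hj hk)
    · exact Or.inr fun i j k hi hj hk => (ho' _ _ _ ((h.mem _).2 hi) ((h.mem _).2 hj)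
        ((h.mem _).2 hk)).trans (ho i j k hi hj hk)
    · exact Or.inr fun i j k hi hj hk => (ho' _ _ _ ((h.mem _).2 hk) ((h.mem _).2 hj)
        ((h.mem _).2 hi)).trans (ho i j k hi hj hk)
    · exact Or.inl fun i j k hi hj hk => (ho' _ _ _ ((h.mem _).2 hk) ((h.mem _).2 hj)
        ((h.mem _).2 hi)).trans (ho i j k hi hj hk)

end TripodEquiv

/-- For an equivalence, implications between the cyclic orders suffice, since these are total. -/
theorem TripodSystem.tripodEquiv {ι ι' κ κ' : Type*} {B : Set ι} {o : ι → ι → ι → Prop}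
    {br : ι → ι → κ} {B' : Set ι'} {o' : ι' → ι' → ι' → Prop} {br' : ι' → ι' → κ'} {e : ι ≃ ι'}
    (h : TripodSystem B o br) (h' : TripodSystem B' o' br') (mem : ∀ i, e i ∈ B' ↔ i ∈ B)
    (splits : ∀ w i j k, w ∉ B → i ∈ B → j ∈ B → k ∈ B →
      (Splits (br' (e w)) (e i) (e j) (e k) ↔ Splits (br w) i j k))
    (order : (∀ i j k, i ∈ B → j ∈ B → k ∈ B → o i j k → o' (e i) (e j) (e k)) ∨
      (∀ i j k, i ∈ B → j ∈ B → k ∈ B → o i j k → o' (e k) (e j) (e i))) :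
    TripodEquiv B o br B' o' br' e := by
  refine ⟨mem, splits, order.imp (fun ho i j k hi hj hk => ⟨fun hh => ?_, ho i j k hi hj hk⟩)
    (fun ho i j k hi hj hk => ⟨fun hh => ?_, ho i j k hi hj hk⟩)⟩
  · have mi := (mem i).2 hi
    have mj := (mem j).2 hj
    have mk := (mem k).2 hk
    obtain ⟨n1, n2, n3⟩ := h'.ne_of_order mi mj mk hh
    refine (h.total hi hj hk (ne_of_apply_ne e n1) (ne_of_apply_ne e n2)
      (ne_of_apply_ne e n3)).resolve_right fun c => ?_
    exact h'.asymm mi mj mk hh (ho _ _ _ hk hj hi c)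
  · have mi := (mem i).2 hi
    have mj := (mem j).2 hj
    have mk := (mem k).2 hk
    obtain ⟨n1, n2, n3⟩ := h'.ne_of_order mk mj mi hh
    refine (h.total hi hj hk (ne_of_apply_ne e n2.symm) (ne_of_apply_ne e n1.symm)
      (ne_of_apply_ne e n3.symm)).resolve_right fun c => ?_
    exact h'.asymm mk mj mi hh (ho _ _ _ hk hj hi c)

/-! ### Tripod systems with four leaves -/

namespace TripodSystem

variable {ι κ : Type*} {B : Set ι} {o : ι → ι → ι → Prop} {br : ι → ι → κ}

/-- A tripod system with four leaves consists of two cherries, with leaves `e 0`, `e 1` and `e 2`,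
`e 3` and branching points `e 4` and `e 5`. -/
theorem exists_equiv_fin [Finite ι] (h : TripodSystem B o br) (hB : B.ncard = 4) :
    ∃ e : Fin 6 ≃ ι, (∀ i, e i ∈ B ↔ i < 4) ∧ IsCherry B o br (e 0) (e 1) (e 4) ∧
      IsCherry B o br (e 2) (e 3) (e 5) := by
  classical
  obtain ⟨a₁, a₂, w, hc⟩ := h.exists_isCherry (Set.toFinite _) (by omega)
  have h2 : (B \ {a₁, a₂}).ncard = 2 := by
    have := Set.ncard_sdiff_add_ncard_of_subset (s := {a₁, a₂}) (t := B)
      (by rintro x (rfl | rfl); exacts [hc.mem₁, hc.mem₂])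
    rw [Set.ncard_pair hc.ne] at this
    omega
  obtain ⟨c, d, hcd, hS⟩ := Set.ncard_eq_two.1 h2
  have hmem : ∀ x, x ∈ B → x = a₁ ∨ x = a₂ ∨ x = c ∨ x = d := by
    intro x hx
    by_cases h1 : x = a₁
    · exact Or.inl h1
    by_cases h2 : x = a₂
    · exact Or.inr (Or.inl h2)
    have : x ∈ B \ {a₁, a₂} := ⟨hx, by simp [h1, h2]⟩
    rw [hS] at this
    exact Or.inr (Or.inr this)
  have hc' : c ∈ B \ {a₁, a₂} := by rw [hS]; simp
  have hd' : d ∈ B \ {a₁, a₂} := by rw [hS]; simp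
  clear hS h2
  have hca : c ≠ a₁ ∧ c ≠ a₂ := by simpa using hc'.2
  have hda : d ≠ a₁ ∧ d ≠ a₂ := by simpa using hd'.2
  replace hc' := hc'.1
  replace hd' := hd'.1
  wlog ho : o c d a₁ generalizing c d
  · refine this d c hcd.symm (fun x hx => ?_) hda hca hd' hc' ?_
    · rcases hmem x hx with h | h | h | h <;> simp [h]
    · have := (h.total hc' hd' hc.mem₁ hcd hda.1 hca.1.symm).resolve_left ho
      exact h.cyc hc.mem₁ hd' hc' this
  have ho1 : o a₁ c d := h.cyc hd' hc.mem₁ hc' (h.cyc hc' hd' hc.mem₁ ho)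
  have ho2 : o a₂ c d := (h.order_cherry hc hc' hd' hca.1 hca.2 hda.1 hda.2).2 ho1
  obtain ⟨w', hw', s⟩ := h.ex hc' hd' hc.mem₁ hcd hda.1 hca.1.symm
  have hww : w' ≠ w := by
    rintro rfl
    exact s.1 (h.splits_cherry hc hc' hd' hca.1 hca.2 hda.1 hda.2)
  have hb := h.br_cherry hc hw' hww
  have hcy : IsCherry B o br c d w' := by
    refine ⟨hc', hd', hcd, hw', fun k hk n1 n2 => ?_, fun k hk n1 n2 => ?_⟩
    · rcases hmem k hk with rfl | rfl | rfl | rfl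
      · exact s
      · exact s.congr hb.symm
      · exact absurd rfl n1
      · exact absurd rfl n2
    · rcases hmem k hk with rfl | rfl | rfl | rfl
      · exact ho
      · exact h.cyc hc.mem₂ hc' hd' ho2
      · exact absurd rfl n1
      · exact absurd rfl n2
  have hne : ∀ {x y}, x ∈ B → y ∉ B → x ≠ y := fun hx hy e => hy (e ▸ hx)
  let f : Fin 6 → ι := ![a₁, a₂, c, d, w, w']
  have hf : Function.Injective f := by
    have n1 := hne hc.mem₁ hc.notMem
    have n2 := hne hc.mem₂ hc.notMem
    have n3 := hne hc' hc.notMem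
    have n4 := hne hd' hc.notMem
    have m1 := hne hc.mem₁ hw'
    have m2 := hne hc.mem₂ hw'
    have m3 := hne hc' hw'
    have m4 := hne hd' hw'
    have hn := hc.ne
    intro i j hij
    fin_cases i <;> fin_cases j <;> simp [f] at hij ⊢ <;> grind
  have hcard : Nat.card (Fin 6) = Nat.card ι := by
    have := h.ncard_compl (by omega)
    have := Set.ncard_add_ncard_compl B
    rw [Nat.card_fin]
    omega
  have hbij : Function.Bijective f :=
    (Nat.bijective_iff_injective_and_card f).2 ⟨hf, hcard⟩
  refine ⟨Equiv.ofBijective f hbij, fun i => ?_, hc, hcy⟩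
  have := hc.mem₁
  have := hc.mem₂
  have := hc.notMem
  fin_cases i <;> simp [f, *]

/-- The cyclic order of the leaves of a cherry and one other leaf. -/
theorem order_iff_of_isCherry (h : TripodSystem B o br) {a c d w i j k : ι}
    (hc : IsCherry B o br c d w) (ha : a ∈ B) (hi : i ∈ B) (hj : j ∈ B) (hk : k ∈ B)
    (hi' : i = a ∨ i = c ∨ i = d) (hj' : j = a ∨ j = c ∨ j = d) (hk' : k = a ∨ k = c ∨ k = d)
    (hca : a ≠ c := by decide) (hda : a ≠ d := by decide) :
    o i j k ↔ (i = a ∧ j = c ∧ k = d) ∨ (i = c ∧ j = d ∧ k = a) ∨ (i = d ∧ j = a ∧ k = c) := by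
  have o1 := hc.order a ha hca hda
  have o2 := h.cyc hc.mem₁ hc.mem₂ ha o1
  have o3 := h.cyc hc.mem₂ ha hc.mem₁ o2
  have m1 := h.asymm hc.mem₁ hc.mem₂ ha o1
  have m2 := h.asymm hc.mem₂ ha hc.mem₁ o2
  have m3 := h.asymm ha hc.mem₁ hc.mem₂ o3
  constructor
  · intro ho
    obtain ⟨n1, n2, n3⟩ := h.ne_of_order hi hj hk ho
    rcases hi' with rfl | rfl | rfl <;> rcases hj' with rfl | rfl | rfl <;>
      rcases hk' with rfl | rfl | rfl <;> first | contradiction | simp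
  · rintro (⟨rfl, rfl, rfl⟩ | ⟨rfl, rfl, rfl⟩ | ⟨rfl, rfl, rfl⟩) <;> assumption

/-- Any two tripod systems with four leaves are equivalent. -/
theorem exists_tripodEquiv_of_ncard_four {ι' κ' : Type*} {B' : Set ι'}
    {o' : ι' → ι' → ι' → Prop} {br' : ι' → ι' → κ'} [Finite ι] [Finite ι']
    (h : TripodSystem B o br) (h' : TripodSystem B' o' br') (hB : B.ncard = 4)
    (hB' : B'.ncard = 4) : ∃ e : ι ≃ ι', TripodEquiv B o br B' o' br' e := by
  obtain ⟨e, hm, h1, h2⟩ := h.exists_equiv_fin hB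
  obtain ⟨e', hm', h1', h2'⟩ := h'.exists_equiv_fin hB'
  have key : TripodEquiv (e ⁻¹' B) (fun i j k => o (e i) (e j) (e k)) (fun v i => br (e v) (e i))
      (e' ⁻¹' B') (fun i j k => o' (e' i) (e' j) (e' k)) (fun v i => br' (e' v) (e' i))
      (Equiv.refl _) := by
    have hE : e ⁻¹' B = {i | i < 4} := by ext i; exact hm i
    have hE' : e' ⁻¹' B' = {i | i < 4} := by ext i; exact hm' i
    have c1 := h1.comap e rfl rfl rfl
    have c2 := h2.comap e rfl rfl rfl
    have c1' := h1'.comap e' rfl rfl rfl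
    have c2' := h2'.comap e' rfl rfl rfl
    have t := h.comap e
    have t' := h'.comap e'
    rw [hE] at t c1 c2
    rw [hE'] at t' c1' c2'
    rw [hE, hE']
    refine ⟨fun i => Iff.rfl, fun w i j k hw hi hj hk => ?_, Or.inl fun i j k hi hj hk =>
      t'.order_of_cherry t c1' c1 (fun i j k hi hj hk ni nj nk => ?_) hi hj hk⟩
    · have : w = 4 ∨ w = 5 := by
        simp only [Set.mem_ofPred_eq] at hw
        omega
      rcases this with rfl | rfl
      · exact (t'.splits_cherry_iff c1' hi hj hk).trans (t.splits_cherry_iff c1 hi hj hk).symm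
      · exact (t'.splits_cherry_iff c2' hi hj hk).trans (t.splits_cherry_iff c2 hi hj hk).symm
    · have h0 : (0 : Fin 6) ∈ {i : Fin 6 | i < 4} := by decide
      have hval : ∀ i : Fin 6, i ∈ {i : Fin 6 | i < 4} → i ≠ 1 → i = 0 ∨ i = 2 ∨ i = 3 := by decide
      rw [t'.order_iff_of_isCherry c2' h0 hi hj hk (hval i hi ni) (hval j hj nj) (hval k hk nk),
        t.order_iff_of_isCherry c2 h0 hi hj hk (hval i hi ni) (hval j hj nj) (hval k hk nk)]
  refine ⟨e.symm.trans e', ?_⟩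
  have r : TripodEquiv B o br (e ⁻¹' B) (fun i j k => o (e i) (e j) (e k))
      (fun v i => br (e v) (e i)) e.symm := by
    refine ⟨fun i => by simp, fun w i j k _ _ _ _ => by simp [Splits], Or.inl fun i j k _ _ _ => ?_⟩
    simp
  have r' : TripodEquiv (e' ⁻¹' B') (fun i j k => o' (e' i) (e' j) (e' k))
      (fun v i => br' (e' v) (e' i)) B' o' br' e' :=
    ⟨fun i => Iff.rfl, fun w i j k _ _ _ _ => Iff.rfl, Or.inl fun i j k _ _ _ => Iff.rfl⟩
  exact (r.trans key).trans r'

end TripodSystem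

/-! ### Isomorphism of 3-trees -/

theorem isCycleOn_permCongr {α β : Type*} {σ : Equiv.Perm α} (h : σ.IsCycleOn Set.univ)
    (e : α ≃ β) : (e.permCongr σ).IsCycleOn Set.univ := by
  refine ⟨Set.bijOn_univ.2 (Equiv.bijective _), fun x _ y _ => ?_⟩
  obtain ⟨n, hn⟩ := h.2 (Set.mem_univ (e.symm x)) (Set.mem_univ (e.symm y))
  refine ⟨n, ?_⟩
  have h1 : e.permCongr σ ^ n = e.permCongr (σ ^ n) := (map_zpow e.permCongrHom _ _).symm
  rw [h1, Equiv.permCongr_apply, hn, Equiv.apply_symm_apply]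

namespace ThreeTree

variable {V W : Type*} {G : ThreeTree V} {H : ThreeTree W}

theorem tripodEquiv_of_iso (f : G.graph ≃g H.graph) (hf : ∀ v (x : G.graph.neighborSet v),
    H.rot (f v) (f.mapNeighborSet v x) = f.mapNeighborSet v (G.rot v x)) :
    TripodEquiv G.leaves G.LeafOrder G.step H.leaves H.LeafOrder H.step f.toEquiv := by
  have hl : ∀ v, f v ∈ H.leaves ↔ v ∈ G.leaves := fun v => by
    change (H.graph.neighborSet (f v)).ncard = 1 ↔ (G.graph.neighborSet v).ncard = 1
    rw [← Nat.card_coe_set_eq, ← Nat.card_coe_set_eq, Nat.card_congr (f.mapNeighborSet v)]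
  have hn : ∀ v x, G.graph.Adj v x → H.next (f v) (f x) = f (G.next v x) := fun v x hx => by
    have := congrArg Subtype.val (hf v ⟨x, hx⟩)
    rw [next_of_adj hx, next_of_adj (f.map_adj_iff.2 hx)]
    exact this
  refine TripodSystem.tripodEquiv G.tripodSystem H.tripodSystem hl
    (fun w i j k _ _ _ _ => ?_) (Or.inl fun i j k hi hj hk h => ?_)
  · simp [Splits, step_map]
  · obtain ⟨v, x, hv, hx, h1, h2, h3⟩ := (leafOrder_iff hi hj hk).1 h
    refine (leafOrder_iff ((hl _).2 hi) ((hl _).2 hj) ((hl _).2 hk)).2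
      ⟨f v, f x, by rwa [hl], f.map_adj_iff.2 hx, ?_, ?_, ?_⟩
    · exact (step_map f v i).trans (by rw [h1])
    · exact (step_map f v j).trans (by rw [h2, hn v x hx])
    · exact (step_map f v k).trans (by rw [h3, hn v x hx, hn v _ (adj_next hx)])

/-- The vertices of a 3-tree can be renamed. -/
def map (G : ThreeTree V) (e : V ≃ W) : ThreeTree W where
  finite := have := G.finite; Finite.of_equiv V e
  graph := G.graph.comap e.symm
  isTree := (SimpleGraph.Iso.comap e.symm G.graph).isTree_iff.2 G.isTree
  degree_eq v := by
    rw [← Nat.card_coe_set_eq,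
      Nat.card_congr ((SimpleGraph.Iso.comap e.symm G.graph).mapNeighborSet v), Nat.card_coe_set_eq]
    exact G.degree_eq _
  rot v := ((SimpleGraph.Iso.comap e.symm G.graph).mapNeighborSet v).symm.permCongr
    (G.rot (e.symm v))
  rot_cycle v := isCycleOn_permCongr (G.rot_cycle (e.symm v)) _

theorem tripodEquiv_map (G : ThreeTree V) (e : V ≃ W) :
    TripodEquiv G.leaves G.LeafOrder G.step (G.map e).leaves (G.map e).LeafOrder (G.map e).step
      e := by
  have h := tripodEquiv_of_iso (G := G.map e) (H := G) (SimpleGraph.Iso.comap e.symm G.graph)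
    (fun v x => by
      change _ = (SimpleGraph.Iso.comap e.symm G.graph).mapNeighborSet v
        (((SimpleGraph.Iso.comap e.symm G.graph).mapNeighborSet v).symm _)
      rw [Equiv.apply_symm_apply]
      rfl)
  exact h.symm

theorem Realizes.tripodEquiv {ι κ : Type*} {B : Set ι} {o : ι → ι → ι → Prop} {br : ι → ι → κ}
    {e : V ≃ ι} (h : G.Realizes B o br e) :
    TripodEquiv G.leaves G.LeafOrder G.step B o br e where
  mem := h.leaves
  splits w i j k hw hi hj hk := (h.splits w i j k hw hi hj hk).symm
  order := Or.inl fun i j k hi hj hk => (h.order i j k hi hj hk).symm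

end ThreeTree

/-- Every finite tripod system comes from a 3-tree with the same set of vertices. -/
theorem TripodSystem.exists_threeTree {ι κ : Type*} [Finite ι] {B : Set ι} {o : ι → ι → ι → Prop}
    {br : ι → ι → κ} (h : TripodSystem B o br) (hB : 2 ≤ B.ncard) :
    ∃ (G : ThreeTree ι) (e : ι ≃ ι), TripodEquiv B o br G.leaves G.LeafOrder G.step e := by
  obtain ⟨V, G, e, hG⟩ := ThreeTree.exists_realizes h hB
  exact ⟨G.map e, _, hG.tripodEquiv.symm.trans (G.tripodEquiv_map e)⟩

namespace TripodEquiv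

variable {V W : Type*} {G : ThreeTree V} {H : ThreeTree W}

/-- 3-trees with equivalent tripod systems are isomorphic up to reversal. -/
theorem isomorphic {F : V ≃ W} (h3 : 3 ≤ G.leaves.ncard)
    (h : TripodEquiv G.leaves G.LeafOrder G.step H.leaves H.LeafOrder H.step F) :
    G.Isomorphic H ∨ G.Isomorphic H.reverse := by
  have := G.finite
  refine ThreeTree.isomorphic_of_bijection ?_ F h.mem h.splits ?_
  · have := G.tripodSystem.ncard_compl (by omega)
    obtain ⟨w, hw⟩ := (Set.ncard_pos (Set.toFinite _)).1 (by omega : 0 < G.leavesᶜ.ncard)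
    exact ⟨w, hw⟩
  · exact h.order.imp (fun h i j k hi hj hk => (h i j k hi hj hk).2)
      (fun h i j k hi hj hk => (h i j k hi hj hk).2)

end TripodEquiv

/-! ### Equivalence of tripod diagrams -/

/-- `br` describes which triangles of black points contain a white point `w`: those whose vertices
belong to different classes of `br w`. -/
structure IsSystemOf {ι : Type*} (pt : ι → E 2) (B : Set ι) (br : ι → ι → ι) : Prop where
  system : TripodSystem B (fun i j k => 0 < area (pt i) (pt j) (pt k)) br
  splits : ∀ w i j k, w ∉ B → i ∈ B → j ∈ B → k ∈ B →
    (Splits (br w) i j k ↔ InTri (pt i) (pt j) (pt k) (pt w))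

/-- Equivalence of planar diagrams: `e` preserves the colours, the white points in the triangles of
black points, and the cyclic order of the black points up to reversal. -/
abbrev DiagramEquiv {ι ι' : Type*} (pt : ι → E 2) (B : Set ι) (br : ι → ι → ι) (pt' : ι' → E 2)
    (B' : Set ι') (br' : ι' → ι' → ι') (e : ι ≃ ι') : Prop :=
  TripodEquiv B (fun i j k => 0 < area (pt i) (pt j) (pt k)) br
    B' (fun i j k => 0 < area (pt' i) (pt' j) (pt' k)) br' e

section Equivalence

variable {ι ι' : Type*} {pt : ι → E 2} {B : Set ι} {br : ι → ι → ι} {pt' : ι' → E 2}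
    {B' : Set ι'} {br' : ι' → ι' → ι'} {e : ι ≃ ι'} {T : Set ι}

theorem area_reverse (p q r : E 2) : area r q p = -area p q r := by unfold area; ring

theorem IsTripodDiagram.comap (h : IsTripodDiagram pt' B') (e : ι ≃ ι') :
    IsTripodDiagram (pt' ∘ e) (e ⁻¹' B') where
  exposed a ha := by
    obtain ⟨q, hq⟩ := h.exposed (e a) ha
    exact ⟨q, fun x hx => hq _ (e.injective.ne hx)⟩
  nz hi hj hij hxi hxj :=
    h.nz hi hj (e.injective.ne hij) (e.injective.ne hxi) (e.injective.ne hxj)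
  ex hi hj hk h1 h2 h3 := by
    obtain ⟨w, hw, s⟩ :=
      h.ex hi hj hk (e.injective.ne h1) (e.injective.ne h2) (e.injective.ne h3)
    exact ⟨e.symm w, by simpa using hw, by simpa using s⟩
  un hw hw' hi hj hk s s' := e.injective (h.un hw hw' hi hj hk s s')
  surj hw := by
    obtain ⟨i, hi, j, hj, k, hk, s⟩ := h.surj hw
    exact ⟨e.symm i, by simpa using hi, e.symm j, by simpa using hj, e.symm k, by simpa using hk,
      by simpa using s⟩

theorem isCoface_comap [Fintype ι] [Fintype ι'] (pt' : ι' → E 2) (B' : Set ι') (e : ι ≃ ι')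
    (T : Set ι) : IsCoface (pt' ∘ e) (e ⁻¹' B') T ↔ IsCoface pt' B' (e '' T) := by
  constructor
  · rintro ⟨μ, h1, h2, h3, h4, h5⟩
    refine ⟨μ ∘ e.symm, ?_, ?_, ?_, ?_, ?_⟩
    · rintro _ ⟨i, hi, rfl⟩ hB
      simpa using h1 i hi hB
    · rintro _ ⟨i, hi, rfl⟩ hB
      simpa using h2 i hi hB
    · intro i hi
      exact h3 _ fun c => hi ⟨_, c, by simp⟩
    · rw [← h4]
      exact Equiv.sum_comp e.symm μ
    · rw [← h5, ← Equiv.sum_comp e]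
      simp
  · rintro ⟨μ, h1, h2, h3, h4, h5⟩
    refine ⟨μ ∘ e, fun i hi hB => h1 _ ⟨i, hi, rfl⟩ hB, fun i hi hB => h2 _ ⟨i, hi, rfl⟩ hB,
      fun i hi => h3 _ (by simpa using hi), ?_, ?_⟩
    · rw [← h4]
      exact Equiv.sum_comp e μ
    · rw [← h5, ← Equiv.sum_comp e]
      rfl

theorem DiagramEquiv.isCoface [Fintype ι] [Fintype ι'] (h : IsTripodDiagram pt B)
    (h' : IsTripodDiagram pt' B') (s : IsSystemOf pt B br) (s' : IsSystemOf pt' B' br')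
    (he : DiagramEquiv pt B br pt' B' br' e) (hT : IsCoface pt B T) :
    IsCoface pt' B' (e '' T) := by
  refine IsTripodDiagram.isCoface_image h h' he.mem (fun {i j k w} hi hj hk hw hin => ?_) ?_ hT
  · rw [← s'.splits _ _ _ _ (by rwa [he.mem]) ((he.mem _).2 hi) ((he.mem _).2 hj)
      ((he.mem _).2 hk), he.splits _ _ _ _ hw hi hj hk, s.splits _ _ _ _ hw hi hj hk]
    exact hin
  · refine he.order.imp (fun ho i j k hi hj hk hpos => (ho i j k hi hj hk).2 hpos)
      (fun ho i j k hi hj hk hpos => ?_)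
    have := (ho i j k hi hj hk).2 hpos
    rw [area_reverse] at this
    linarith

/-- Equivalent diagrams have the same cofaces. -/
theorem DiagramEquiv.isCoface_iff [Fintype ι] [Fintype ι'] (h : IsTripodDiagram pt B)
    (h' : IsTripodDiagram pt' B') (s : IsSystemOf pt B br) (s' : IsSystemOf pt' B' br')
    (he : DiagramEquiv pt B br pt' B' br' e) (T : Set ι) :
    IsCoface pt B T ↔ IsCoface pt' B' (e '' T) := by
  refine ⟨he.isCoface h h' s s', fun hT => ?_⟩
  have := DiagramEquiv.isCoface h' h s' s (e := e.symm) he.symm hT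
  rwa [← Set.image_comp, Equiv.symm_comp_self, Set.image_id] at this

/-- Diagrams with at least five black points and the same cofaces are equivalent. This fails for
four black points, because then the cofaces do not determine the colours. -/
theorem diagramEquiv_of_isCoface_iff [Fintype ι] [Fintype ι'] (h : IsTripodDiagram pt B)
    (h' : IsTripodDiagram pt' B') (s : IsSystemOf pt B br) (s' : IsSystemOf pt' B' br')
    (hT : ∀ T, IsCoface pt B T ↔ IsCoface pt' B' (e '' T)) (hB : 5 ≤ B.ncard)
    (hBB : B.ncard = B'.ncard) : DiagramEquiv pt B br pt' B' br' e := by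
  have h₂ := h'.comap e
  have hT₂ : ∀ T, IsCoface pt B T ↔ IsCoface (pt' ∘ e) (e ⁻¹' B') T := fun T => by
    rw [isCoface_comap, hT]
  have hsub := h.subset_of_isCoface_iff h₂ hB hT₂
  have hcard : (e ⁻¹' B').ncard = B.ncard := by
    rw [hBB, ← Set.ncard_image_of_injective _ e.injective, Set.image_preimage_eq _ e.surjective]
  have hBe := Set.eq_of_subset_of_ncard_le hsub hcard.ge (Set.toFinite _)
  have hm : ∀ i, e i ∈ B' ↔ i ∈ B := fun i => by rw [← hBe]; rfl
  rw [hBe] at h₂ hT₂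
  refine TripodSystem.tripodEquiv s.system s'.system hm (fun w i j k hw hi hj hk => ?_) ?_
  · rw [s.splits _ _ _ _ hw hi hj hk, s'.splits _ _ _ _ (by rwa [hm]) ((hm _).2 hi) ((hm _).2 hj)
        ((hm _).2 hk)]
    exact (IsTripodDiagram.inTri_iff_of_isCoface_iff h h₂ hT₂ hi hj hk hw).symm
  · refine (IsTripodDiagram.orientation_of_isCoface_iff h h₂ hT₂ (by omega)).imp
      (fun ho i j k hi hj hk hpos => ho i hi j hj k hk hpos)
      (fun ho i j k hi hj hk hpos => ?_)
    rw [area_reverse]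
    have := ho i hi j hj k hk hpos
    simp only [Function.comp_apply] at this
    linarith

end Equivalence

/-! ### Combinatorial equivalence and cofaces -/

/-- An isomorphism of two posets of sets that contain the empty set and all singletons is induced by
a bijection. -/
theorem exists_equiv_of_orderIso {ι ι' : Type*} {A : Set ι → Prop} {A' : Set ι' → Prop}
    (h0 : A ∅) (h1 : ∀ i, A {i}) (h0' : A' ∅) (h1' : ∀ i, A' {i})
    (Φ : {S // A S} ≃o {S // A' S}) : ∃ σ : ι ≃ ι', ∀ S, A S ↔ A' (σ '' S) := by
  -- singletons are the minimal nonempty sets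
  have hσ : ∀ i, ∃ j, (Φ ⟨{i}, h1 i⟩).1 = {j} := by
    intro i
    have hi := h1 i
    have hbot : Φ ⟨∅, h0⟩ = ⟨∅, h0'⟩ := by
      refine le_antisymm ?_ (Set.empty_subset _)
      rw [← Φ.le_symm_apply]
      exact Set.empty_subset _
    have hne : (Φ ⟨{i}, hi⟩).1.Nonempty := by
      rw [Set.nonempty_iff_ne_empty]
      intro e
      have : Φ ⟨{i}, hi⟩ = Φ ⟨∅, h0⟩ := by rw [hbot]; exact Subtype.ext e
      have := congrArg Subtype.val (Φ.injective this)
      exact Set.singleton_ne_empty i this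
    obtain ⟨j, hj⟩ := hne
    refine ⟨j, ?_⟩
    have h2 : Φ.symm ⟨{j}, h1' j⟩ ≤ ⟨{i}, hi⟩ := by
      rw [Φ.symm_apply_le]
      exact Set.singleton_subset_iff.2 hj
    rcases Set.subset_singleton_iff_eq.1 h2 with e | e
    · have : Φ.symm ⟨{j}, h1' j⟩ = ⟨∅, h0⟩ := Subtype.ext e
      rw [Φ.symm_apply_eq, hbot] at this
      exact absurd (congrArg Subtype.val this) (Set.singleton_ne_empty j)
    · have : Φ.symm ⟨{j}, h1' j⟩ = ⟨{i}, hi⟩ := Subtype.ext e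
      rw [Φ.symm_apply_eq] at this
      rw [← this]
  choose σ hσ using hσ
  have hmem : ∀ (S : {S // A S}) i, σ i ∈ (Φ S).1 ↔ i ∈ S.1 := by
    intro S i
    rw [← Set.singleton_subset_iff, ← Set.singleton_subset_iff, ← hσ]
    exact Φ.le_iff_le (x := ⟨{i}, h1 i⟩) (y := S)
  have hinj : Function.Injective σ := by
    intro i j hij
    have := (hmem ⟨{j}, h1 j⟩ i).1 (by rw [hσ, hij]; rfl)
    exact this
  have hsurj : Function.Surjective σ := by
    intro j
    obtain ⟨S, hS⟩ := Φ.surjective ⟨{j}, h1' j⟩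
    have hne : S.1 ≠ ∅ := by
      intro e
      have h2 : S ≤ Φ.symm ⟨∅, h0'⟩ := by
        change S.1 ⊆ _
        rw [e]
        exact Set.empty_subset _
      rw [Φ.le_symm_apply, hS] at h2
      exact h2 rfl
    obtain ⟨i, hi⟩ := Set.nonempty_iff_ne_empty.2 hne
    have := (hmem S i).2 hi
    rw [hS] at this
    exact ⟨i, this⟩
  have himg : ∀ S : {S // A S}, (Φ S).1 = σ '' S.1 := by
    intro S
    ext j
    obtain ⟨i, rfl⟩ := hsurj j
    rw [hmem, hinj.mem_set_image]
  refine ⟨Equiv.ofBijective σ ⟨hinj, hsurj⟩, fun S => ⟨fun h => ?_, fun h => ?_⟩⟩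
  · have := (Φ ⟨S, h⟩).2
    rwa [himg] at this
  · obtain ⟨S', hS'⟩ := Φ.surjective ⟨_, h⟩
    have := (himg S').symm.trans (congrArg Subtype.val hS')
    rw [← Set.image_injective.2 hinj this]
    exact S'.2

namespace PlanarDiagram

variable {ι ι' : Type*} [Fintype ι] [Fintype ι'] {D D' : ℕ} {X : PlanarDiagram ι}
  {X' : PlanarDiagram ι'} {P : Set (E D)} {P' : Set (E D')}

theorem IsGaleDiagramOf.combEquiv (h : X.IsGaleDiagramOf P) (h' : X'.IsGaleDiagramOf P')
    (hP : IsPolytope P) (hP' : IsPolytope P') (σ : ι ≃ ι')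
    (hσ : ∀ T, IsCoface X.pt X.black T ↔ IsCoface X'.pt X'.black (σ '' T)) : CombEquiv P P' := by
  obtain ⟨Φ⟩ := h.exists_orderIso hP
  obtain ⟨Ψ⟩ := h'.exists_orderIso hP'
  refine ⟨(Φ.trans ⟨(Equiv.Set.congr σ).subtypeEquiv fun S => ?_, fun {S T} => ?_⟩).trans Ψ.symm⟩
  · rw [hσ, Set.image_compl_eq σ.bijective]
    rfl
  · exact Set.image_subset_image_iff σ.injective

/-- Combinatorially equivalent polytopes have Gale diagrams with the same cofaces. -/
theorem IsGaleDiagramOf.exists_equiv (h : X.IsGaleDiagramOf P) (h' : X'.IsGaleDiagramOf P')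
    (hP : IsPolytope P) (hP' : IsPolytope P')
    (h0 : IsCoface X.pt X.black Set.univ) (h1 : ∀ i, IsCoface X.pt X.black {i}ᶜ)
    (h0' : IsCoface X'.pt X'.black Set.univ) (h1' : ∀ i, IsCoface X'.pt X'.black {i}ᶜ)
    (hPP : CombEquiv P P') :
    ∃ σ : ι ≃ ι', ∀ T, IsCoface X.pt X.black T ↔ IsCoface X'.pt X'.black (σ '' T) := by
  obtain ⟨Φ⟩ := h.exists_orderIso hP
  obtain ⟨Ψ⟩ := h'.exists_orderIso hP'
  obtain ⟨Ξ⟩ := hPP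
  obtain ⟨σ, hσ⟩ := exists_equiv_of_orderIso (A := fun S => IsCoface X.pt X.black Sᶜ)
    (A' := fun S => IsCoface X'.pt X'.black Sᶜ) (by simpa using h0) h1 (by simpa using h0') h1'
    ((Φ.symm.trans Ξ).trans Ψ)
  refine ⟨σ, fun T => ?_⟩
  have := hσ Tᶜ
  rwa [compl_compl, Set.image_compl_eq σ.bijective, compl_compl] at this

end PlanarDiagram

/-! ### Points inside a triangle -/

theorem isOpen_setOf_inTri (p q r : E 2) : IsOpen {x | InTri p q r x} := by
  have hc : ∀ p q : E 2, Continuous fun x => area p q x := fun p q => by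
    unfold area
    fun_prop
  unfold InTri
  refine IsOpen.union ?_ ?_
  · exact (isOpen_lt continuous_const (hc p q)).inter
      ((isOpen_lt continuous_const (hc q r)).inter (isOpen_lt continuous_const (hc r p)))
  · exact (isOpen_lt (hc p q) continuous_const).inter
      ((isOpen_lt (hc q r) continuous_const).inter (isOpen_lt (hc r p) continuous_const))

theorem InTri.mem_convexHull {p q r x : E 2} (h : InTri p q r x) :
    x ∈ convexHull ℝ {p, q, r} := by
  have hA := h.area_ne
  have hw : 0 ≤ area q r x / area p q r ∧ 0 ≤ area r p x / area p q r ∧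
      0 ≤ area p q x / area p q r := by
    have := area_add p q r x
    rcases h with ⟨h1, h2, h3⟩ | ⟨h1, h2, h3⟩
    · have : 0 < area p q r := by linarith
      exact ⟨by positivity, by positivity, by positivity⟩
    · have : area p q r < 0 := by linarith
      exact ⟨div_nonneg_of_nonpos h2.le this.le, div_nonneg_of_nonpos h3.le this.le,
        div_nonneg_of_nonpos h1.le this.le⟩
  have hx : x = (area q r x / area p q r) • p + (area r p x / area p q r) • q +
      (area p q x / area p q r) • r := by
    ext i
    fin_cases i <;> simp <;> field_simp <;> unfold area <;> ring
  have := (convex_convexHull ℝ {p, q, r}).sum_mem (t := Finset.univ)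
    (w := ![area q r x / area p q r, area r p x / area p q r, area p q x / area p q r])
    (z := ![p, q, r]) (by intro i _; fin_cases i; exacts [hw.1, hw.2.1, hw.2.2])
    (by
      simp only [Fin.sum_univ_three, Matrix.cons_val_zero, Matrix.cons_val_one, Matrix.cons_val]
      rw [← add_div, ← add_div, div_eq_one_iff_eq hA, ← area_add p q r x]
      ring)
    (by intro i _; apply subset_convexHull; fin_cases i <;> simp)
  rw [hx]
  simpa [Fin.sum_univ_three] using this

/-- A point lies in the interior of a nondegenerate triangle if and only if it sees the three edges
with the same orientation. -/
theorem mem_interior_convexHull_iff {p q r x : E 2} (hA : area p q r ≠ 0) :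
    x ∈ interior (convexHull ℝ {p, q, r}) ↔ InTri p q r x := by
  constructor
  · intro hx
    -- moving `x` parallel to `p - r` decreases the distance from the line `p q`
    have key : ∀ p q r : E 2, area p q r ≠ 0 → x ∈ interior (convexHull ℝ {p, q, r}) →
        0 < area p q r * area p q x := by
      intro p q r hA hx
      have hconv : Convex ℝ {y | 0 ≤ area p q r * area p q y} := by
        intro y hy z hz a b ha hb hab
        have e : area p q (a • y + b • z) = a * area p q y + b * area p q z := by
          have : a = 1 - b := by linarith
          subst this
          simp [area]
          ring
        simp only [Set.mem_ofPred_eq] at hy hz ⊢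
        rw [e]
        nlinarith
      have hsub : convexHull ℝ {p, q, r} ⊆ {y | 0 ≤ area p q r * area p q y} := by
        refine convexHull_min ?_ hconv
        rintro y (rfl | rfl | rfl)
        · simp
        · simp
        · exact mul_self_nonneg (area p q y)
      have hcont : Filter.Tendsto (fun t : ℝ => x + t • (p - r)) (nhdsWithin 0 (Set.Ioi 0))
          (nhds x) := by
        have : Continuous fun t : ℝ => x + t • (p - r) := by fun_prop
        simpa using (this.tendsto 0).mono_left nhdsWithin_le_nhds
      obtain ⟨t, ht, ht0⟩ := ((hcont.eventually (mem_interior_iff_mem_nhds.1 hx)).and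
        self_mem_nhdsWithin).exists
      have h1 : 0 ≤ area p q r * area p q (x + t • (p - r)) := hsub ht
      have e : area p q (x + t • (p - r)) = area p q x - t * area p q r := by
        simp [area]
        ring
      rw [e] at h1
      have : 0 < t * (area p q r * area p q r) := mul_pos ht0 (mul_self_pos.2 hA)
      nlinarith
    have h1 := key p q r hA hx
    have h2 := key q r p (by rwa [← area_rot]) (by convert hx using 3; grind)
    have h3 := key r p q (by rwa [area_rot]) (by convert hx using 3; grind)
    rw [← area_rot] at h2
    rw [area_rot] at h3
    rcases hA.lt_or_gt with h | h
    · exact Or.inr ⟨by nlinarith, by nlinarith, by nlinarith⟩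
    · exact Or.inl ⟨(mul_pos_iff_of_pos_left h).1 h1, (mul_pos_iff_of_pos_left h).1 h2,
        (mul_pos_iff_of_pos_left h).1 h3⟩
  · intro h
    exact mem_interior.2 ⟨_, fun y hy => hy.mem_convexHull, isOpen_setOf_inTri p q r, h⟩

/-! ### Characteristic trees -/

theorem IsTripodDiagram.exists_isSystemOf {ι : Type*} {pt : ι → E 2} {B : Set ι}
    (h : IsTripodDiagram pt B) : ∃ br, IsSystemOf pt B br := by
  obtain ⟨br, h1, h2⟩ := h.exists_tripodSystem
  exact ⟨br, h1, h2⟩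

theorem Splits.ne {ι κ : Type*} {c : ι → κ} {i j k : ι} (h : Splits c i j k) :
    i ≠ j ∧ j ≠ k ∧ k ≠ i :=
  ⟨ne_of_apply_ne c h.1, ne_of_apply_ne c h.2.1, ne_of_apply_ne c h.2.2⟩

/-- The definition of characteristic trees in terms of tripod systems. -/
theorem ThreeTree.isCharacteristicTree_iff {ι V : Type*} {G : ThreeTree V} {X : PlanarDiagram ι}
    {br : ι → ι → ι} (h : IsTripodDiagram X.pt X.black) (s : IsSystemOf X.pt X.black br) :
    G.IsCharacteristicTree X ↔ ∃ f : ι ≃ V, TripodEquiv X.black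
      (fun i j k => 0 < area (X.pt i) (X.pt j) (X.pt k)) br G.leaves G.LeafOrder G.step f := by
  refine exists_congr fun f => ?_
  have ho : ∀ i j k, X.orient i j k = area (X.pt i) (X.pt j) (X.pt k) := fun _ _ _ => rfl
  constructor
  · rintro ⟨h1, h2, h3, h4⟩
    have hm : ∀ i, f i ∈ G.leaves ↔ i ∈ X.black := fun i => by
      refine ⟨fun hi => ?_, h2 i⟩
      by_contra hB
      have e1 : (G.graph.neighborSet (f i)).ncard = 1 := hi
      rw [h1 i hB] at e1
      omega
    refine ⟨hm, fun w i j k hw hi hj hk => ?_, h3.imp (fun h3 i j k hi hj hk => ?_)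
      fun h3 i j k hi hj hk => ?_⟩
    · have hne : ∀ {i}, i ∈ X.black → f i ≠ f w := fun hi e => hw (f.injective e ▸ hi)
      by_cases hd : i ≠ j ∧ j ≠ k ∧ k ≠ i
      · rw [s.splits w i j k hw hi hj hk, ← mem_interior_convexHull_iff
          (h.nz hi hj hd.1 hd.2.2 hd.2.1.symm), h4 w hw i hi j hj k hk hd.1 hd.2.1 hd.2.2,
          hasDisjointPaths_iff (hne hi) (hne hj) (hne hk)]
      · refine iff_of_false (fun c => hd ?_) (fun c => hd c.ne)
        have := c.ne
        simpa using this
    · exact h3 i hi j hj k hk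
    · rw [h3 k hk j hj i hi, ho, area_reverse, neg_lt_zero]
  · rintro ⟨hm, hs, h3⟩
    refine ⟨fun i hi => ncard_of_notMem (by rwa [hm]), fun i hi => (hm i).2 hi,
      h3.imp (fun h3 i hi j hj k hk => h3 i j k hi hj hk) fun h3 i hi j hj k hk => ?_,
      fun w hw i hi j hj k hk n1 n2 n3 => ?_⟩
    · rw [h3 k j i hk hj hi, ho, area_reverse, neg_pos]
    · have hne : ∀ {i}, i ∈ X.black → f i ≠ f w := fun hi e => hw (f.injective e ▸ hi)
      rw [hasDisjointPaths_iff (hne hi) (hne hj) (hne hk), hs w i j k hw hi hj hk,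
        s.splits w i j k hw hi hj hk, mem_interior_convexHull_iff (h.nz hi hj n1 n3 n2.symm)]

/-! ### `T`-diagrams -/

namespace PlanarDiagram.IsTDiagram

variable {d d' : ℕ} {X : PlanarDiagram (Fin (2 * d + 4))} {X' : PlanarDiagram (Fin (2 * d' + 4))}
  {P : Set (E (2 * d))} {P' : Set (E (2 * d'))}

/-- Four vertices do not fit into a space of dimension zero. -/
theorem pos (h : X.IsTDiagram) : 0 < d := by
  rcases Nat.eq_zero_or_pos d with rfl | h0
  · obtain ⟨-, -, P, -, a, ha, -⟩ := h
    have : Subsingleton (E (2 * 0)) := inferInstanceAs (Subsingleton (E 0))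
    exact absurd (ha (Subsingleton.elim (a 0) (a 1))) (by simp)
  · exact h0

theorem isTripodDiagram (h : X.IsTDiagram) : IsTripodDiagram X.pt X.black := by
  obtain ⟨hB, hconv, P, hP, hX⟩ := h
  refine isTripodDiagram_of_isCoface (by simp) (fun T hT => ?_) hB hconv
  have := (hX.isNeighborlyPolytope_iff hP.1).1 hP Tᶜ (by
    have := Set.ncard_add_ncard_compl T
    rw [Nat.card_fin] at this
    omega)
  rwa [compl_compl] at this

/-- Every set of more than `d + 3` points is a coface. -/
theorem isCoface (h : X.IsTDiagram) {T : Set (Fin (2 * d + 4))} (hT : d + 3 < T.ncard) :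
    IsCoface X.pt X.black T := by
  refine h.isTripodDiagram.isCoface_of_ncard_lt ?_ (by rwa [h.1])
  have := Set.ncard_add_ncard_compl X.black
  rw [Nat.card_fin, h.1] at this
  rw [h.1]
  omega

theorem isCoface_univ (h : X.IsTDiagram) : IsCoface X.pt X.black Set.univ := by
  have := h.pos
  exact h.isCoface (by rw [Set.ncard_univ, Nat.card_fin]; omega)

theorem isCoface_compl_singleton (h : X.IsTDiagram) (i : Fin (2 * d + 4)) :
    IsCoface X.pt X.black {i}ᶜ := by
  have := h.pos
  refine h.isCoface ?_
  rw [Set.ncard_compl, Set.ncard_singleton, Nat.card_fin]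
  omega

/-- The `T`-diagrams of combinatorially equivalent polytopes are equivalent. -/
theorem exists_diagramEquiv (h : X.IsTDiagram) (h' : X'.IsTDiagram) (hX : X.IsGaleDiagramOf P)
    (hX' : X'.IsGaleDiagramOf P') (hP : IsPolytope P) (hP' : IsPolytope P') (hPP : CombEquiv P P')
    {br : Fin (2 * d + 4) → Fin (2 * d + 4) → Fin (2 * d + 4)}
    {br' : Fin (2 * d' + 4) → Fin (2 * d' + 4) → Fin (2 * d' + 4)}
    (s : IsSystemOf X.pt X.black br) (s' : IsSystemOf X'.pt X'.black br') :
    ∃ e : Fin (2 * d + 4) ≃ Fin (2 * d' + 4),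
      DiagramEquiv X.pt X.black br X'.pt X'.black br' e := by
  obtain ⟨σ, hσ⟩ := hX.exists_equiv hX' hP hP' h.isCoface_univ h.isCoface_compl_singleton
    h'.isCoface_univ h'.isCoface_compl_singleton hPP
  have hd : d = d' := by
    have := Fintype.card_congr σ
    simp only [Fintype.card_fin] at this
    omega
  have := h.pos
  have hB := h.1
  have hB' := h'.1
  -- for `d = 1`, `σ` need not preserve the colours, but all tripod systems are equivalent
  by_cases h1 : d = 1
  · exact s.system.exists_tripodEquiv_of_ncard_four s'.system (by omega) (by omega)
  · exact ⟨σ, diagramEquiv_of_isCoface_iff h.isTripodDiagram h'.isTripodDiagram s s' hσ (by omega)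
      (by omega)⟩

end PlanarDiagram.IsTDiagram

/-- The characteristic tree of a `T`-polytope. -/
theorem IsTPolytope.exists_threeTree {d : ℕ} {P : Set (E (2 * d))} (hP : IsTPolytope P) :
    ∃ G : ThreeTree (Fin (2 * d + 4)),
      (∀ X : PlanarDiagram (Fin (2 * d + 4)), X.IsTDiagram → X.IsGaleDiagramOf P →
        G.IsCharacteristicTree X) ∧
      (∀ (d' : ℕ) (P' : Set (E (2 * d'))), IsTPolytope P' → CombEquiv P P' →
        ∀ (V : Type*) (G' : ThreeTree V), G'.IsTreeOf P' →
          G'.Isomorphic G ∨ G'.Isomorphic G.reverse) := by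
  obtain ⟨hN, X, hX, hXP⟩ := hP
  obtain ⟨br, s⟩ := hX.isTripodDiagram.exists_isSystemOf
  have hB := hX.1
  obtain ⟨G, e, hG⟩ := s.system.exists_threeTree (by omega)
  refine ⟨G, fun X' hX' hXP' => ?_, fun d' P' hP' hPP V G' hG' => ?_⟩
  · obtain ⟨br', s'⟩ := hX'.isTripodDiagram.exists_isSystemOf
    obtain ⟨f, hf⟩ := hX.exists_diagramEquiv hX' hXP hXP' hN.1 hN.1 ⟨OrderIso.refl _⟩ s s'
    exact (ThreeTree.isCharacteristicTree_iff hX'.isTripodDiagram s').2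
      ⟨_, hf.symm.trans hG⟩
  · obtain ⟨X', hX', hXP', hc⟩ := hG'
    obtain ⟨br', s'⟩ := hX'.isTripodDiagram.exists_isSystemOf
    obtain ⟨f, hf⟩ := hX.exists_diagramEquiv hX' hXP hXP' hN.1 hP'.1.1 hPP s s'
    obtain ⟨g, hg⟩ := (ThreeTree.isCharacteristicTree_iff hX'.isTripodDiagram s').1 hc
    refine TripodEquiv.isomorphic ?_ ((hg.symm.trans hf.symm).trans hG)
    have : G'.leaves.ncard = X'.black.ncard := by
      rw [← Set.ncard_image_of_injective _ g.injective]
      congr 1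
      ext v
      obtain ⟨i, rfl⟩ := g.surjective v
      rw [hg.mem, g.injective.mem_set_image]
    have := hX'.1
    omega

/-- A 3-tree determines the combinatorial type of the `T`-polytopes it comes from. -/
theorem ThreeTree.IsTreeOf.combEquiv {V : Type*} {G : ThreeTree V} {d d' : ℕ} {P : Set (E (2 * d))}
    {P' : Set (E (2 * d'))} (h : G.IsTreeOf P) (h' : G.IsTreeOf P') (hP : IsPolytope P)
    (hP' : IsPolytope P') : CombEquiv P P' := by
  obtain ⟨X, hX, hXP, hc⟩ := h
  obtain ⟨X', hX', hXP', hc'⟩ := h'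
  obtain ⟨br, s⟩ := hX.isTripodDiagram.exists_isSystemOf
  obtain ⟨br', s'⟩ := hX'.isTripodDiagram.exists_isSystemOf
  obtain ⟨f, hf⟩ := (isCharacteristicTree_iff hX.isTripodDiagram s).1 hc
  obtain ⟨f', hf'⟩ := (isCharacteristicTree_iff hX'.isTripodDiagram s').1 hc'
  exact hXP.combEquiv hXP' hP hP' _ (DiagramEquiv.isCoface_iff hX.isTripodDiagram
    hX'.isTripodDiagram s s' (hf.trans hf'.symm))

theorem ThreeTree.two_le_ncard_leaves {V : Type*} (G : ThreeTree V) : 2 ≤ G.leaves.ncard := by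
  have := G.finite
  obtain ⟨v⟩ := G.isTree.connected.nonempty
  obtain ⟨x, hx⟩ : (G.graph.neighborSet v).Nonempty := by
    rw [← Set.ncard_pos]
    rcases G.degree_eq v with h | h <;> omega
  replace hx : G.graph.Adj v x := hx
  -- the two ends of an edge lead to different leaves
  obtain ⟨i, hi, ei⟩ := exists_leaf hx
  obtain ⟨j, hj, ej⟩ := exists_leaf hx.symm
  refine (Set.one_lt_ncard (Set.toFinite _)).2 ⟨i, hi, j, hj, ?_⟩
  rintro rfl
  exact (step_eq_iff hx _).1 ei ej

namespace IsTripodDiagram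

variable {ι : Type*} {pt : ι → E 2} {B : Set ι}

/-- A supporting line at a black point separates it from the convex hull of the others. -/
theorem convexIndependent (h : IsTripodDiagram pt B) :
    ConvexIndependent ℝ (fun i : B => pt i) := by
  intro s x hx
  by_contra hxs
  obtain ⟨q, hq⟩ := h.exposed x.1 x.2
  have hconv : Convex ℝ {y | 0 < area (pt x) q y} := by
    intro y hy z hz a b ha hb hab
    have e : area (pt x) q (a • y + b • z) = a * area (pt x) q y + b * area (pt x) q z := by
      have : a = 1 - b := by linarith
      subst this
      simp [area]
      ring
    simp only [Set.mem_ofPred_eq] at hy hz ⊢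
    rw [e]
    rcases ha.eq_or_lt with rfl | ha
    · have : b = 1 := by linarith
      simpa [this] using hz
    · have := mul_pos ha hy
      have := mul_nonneg hb hz.le
      linarith
  have := convexHull_min (s := (fun i : B => pt i) '' s) (t := {y | 0 < area (pt x) q y}) (by
    rintro _ ⟨y, hy, rfl⟩
    exact hq _ fun e => hxs (Subtype.ext e ▸ hy)) hconv hx
  simp at this

theorem affineSpan_eq_top (h : IsTripodDiagram pt B) {w : ι} (hw : w ∉ B) :
    affineSpan ℝ (Set.range pt) = ⊤ := by
  obtain ⟨i, hi, j, hj, k, hk, hin⟩ := h.surj hw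
  rw [← interior_convexHull_nonempty_iff_affineSpan_eq_top]
  refine ⟨pt w, interior_mono (convexHull_mono ?_)
    ((mem_interior_convexHull_iff hin.area_ne).2 hin)⟩
  rintro _ (rfl | rfl | rfl) <;> exact Set.mem_range_self _

end IsTripodDiagram

/-- Every 3-tree with at least eight vertices comes from a `T`-polytope. -/
theorem ThreeTree.exists_isTreeOf {V : Type*} (G : ThreeTree V) (hV : 8 ≤ Nat.card V) :
    ∃ d : ℕ, Nat.card V = 2 * d + 4 ∧ ∃ P : Set (E (2 * d)), IsTPolytope P ∧ G.IsTreeOf P := by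
  have := G.finite
  have hne := G.two_le_ncard_leaves
  have hc := G.tripodSystem.ncard_compl hne
  have hsum := Set.ncard_add_ncard_compl G.leaves
  obtain ⟨d, hd⟩ : ∃ d, G.leaves.ncard = d + 3 := ⟨G.leaves.ncard - 3, by omega⟩
  have hcard : Nat.card V = 2 * d + 4 := by omega
  refine ⟨d, hcard, ?_⟩
  let e : Fin (2 * d + 4) ≃ V := (Finite.equivFinOfCardEq hcard).symm
  obtain ⟨pt, h, h1, h2⟩ := G.tripodSystem.exists_isTripodDiagram hne
  have ht := h.comap e
  have hB : (e ⁻¹' G.leaves).ncard = d + 3 := by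
    rw [← hd, ← Set.ncard_image_of_injective _ e.injective, Set.image_preimage_eq _ e.surjective]
  obtain ⟨w, hw⟩ := (Set.ncard_pos (Set.toFinite _)).1 (by omega : 0 < G.leavesᶜ.ncard)
  let X : PlanarDiagram (Fin (2 * d + 4)) :=
    ⟨pt ∘ e, e ⁻¹' G.leaves, ht.affineSpan_eq_top (w := e.symm w) (by simpa using hw)⟩
  have hco : ∀ {T : Set (Fin (2 * d + 4))}, d + 3 < T.ncard → IsCoface X.pt X.black T := by
    intro T hT
    refine ht.isCoface_of_ncard_lt ?_ (by rwa [hB])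
    have := Set.ncard_add_ncard_compl (e ⁻¹' G.leaves)
    rw [Nat.card_fin, hB] at this
    rw [hB]
    omega
  obtain ⟨P, hP, hXP⟩ := X.exists_isGaleDiagramOf (D := 2 * d) (by simp)
    (hco (by rw [Set.ncard_univ, Nat.card_fin]; omega))
    (fun i => hco (by rw [Set.ncard_compl, Set.ncard_singleton, Nat.card_fin]; omega))
  have hN : IsNeighborlyPolytope P := (hXP.isNeighborlyPolytope_iff hP).2 fun S hS =>
    hco (by rw [Set.ncard_compl, hS, Nat.card_fin]; omega)
  have hX : X.IsTDiagram := ⟨hB, ht.convexIndependent, P, hN, hXP⟩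
  obtain ⟨br, s⟩ := ht.exists_isSystemOf
  refine ⟨P, ⟨hN, X, hX, hXP⟩, X, hX, hXP, (isCharacteristicTree_iff ht s).2
    ⟨e, fun i => Iff.rfl, fun w i j k hw hi hj hk => ?_, Or.inl fun i j k hi hj hk => ?_⟩⟩
  · rw [s.splits w i j k hw hi hj hk]
    exact h2 _ _ _ _ hw hi hj hk
  · exact h1 _ _ _ hi hj hk

end Neighborly

theorem mainTheorem3 :
    -- every T-polytope determines a 3-tree
    (∀ (d : ℕ) (P : Set (Neighborly.E (2 * d))), Neighborly.IsTPolytope P →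
      ∃ G : Neighborly.ThreeTree (Fin (2 * d + 4)),
        (∀ X : Neighborly.PlanarDiagram (Fin (2 * d + 4)),
          X.IsTDiagram → X.IsGaleDiagramOf P → G.IsCharacteristicTree X) ∧
        (∀ (d' : ℕ) (P' : Set (Neighborly.E (2 * d'))), Neighborly.IsTPolytope P' →
          Neighborly.CombEquiv P P' →
          ∀ (V : Type*) (G' : Neighborly.ThreeTree V), G'.IsTreeOf P' →
            G'.Isomorphic G ∨ G'.Isomorphic G.reverse)) ∧
    -- every 3-tree with at least 8 vertices determines a T-polytope
    (∀ (V : Type*) (G : Neighborly.ThreeTree V), 8 ≤ Nat.card V →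
      (∃ d : ℕ, Nat.card V = 2 * d + 4 ∧
        ∃ P : Set (Neighborly.E (2 * d)), Neighborly.IsTPolytope P ∧ G.IsTreeOf P) ∧
      (∀ (d d' : ℕ) (P : Set (Neighborly.E (2 * d))) (P' : Set (Neighborly.E (2 * d'))),
        Neighborly.IsTPolytope P → Neighborly.IsTPolytope P' →
        G.IsTreeOf P → G.IsTreeOf P' → Neighborly.CombEquiv P P')) :=
  ⟨fun _ _ hP => hP.exists_threeTree, fun _ G hV => ⟨G.exists_isTreeOf hV,
    fun _ _ _ _ hP hP' h h' => h.combEquiv h' hP.1.1 hP'.1.1⟩⟩
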